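/- **Setting.** Let $d\ge 1$ and let $U:\mathbb R^d\to\mathbb R$ be differentiable with $L$-Lipschitz gradient and $\kappa$-strongly convex outside a ball, i.e. there are $\kappa>0$, $R\ge 0$ with $(\nabla U(x)-\nabla U(y))\cdot(x-y)\ge\kappa|x-y|^2$ whenever $|x-y|>R$. Let $U(x)=\tfrac12x^{T}Kx+G(x)$ be a splitting in which $K$ is symmetric positive definite with smallest eigenvalue $\kappa$, $x\mapsto Kx$ is $L_K$-Lipschitz, $\nabla G$ is $L_G$-Lipschitz, and $(\nabla G(x)-\nabla G(y))\cdot(x-y)\ge0$ whenever $|x-y|>R$ (for instance $K=\kappa I_d$). Let $\gamma>0$, $h>0$. **Scheme.** For $t>0$ put $\eta_t=e^{-\gamma t}$, $\mathcal Z^{(1)}=\sqrt t\,\xi^{(1)}$, $$\mathcal Z^{(2)}=\sqrt{\tfrac{1-\eta_t^2}{2\gamma}}\Big(\sqrt{\tfrac{1-\eta_t}{1+\eta_t}\tfrac{2}{\gamma t}}\;\xi^{(1)}+\sqrt{1-\tfrac{1-\eta_t}{1+\eta_t}\tfrac{2}{\gamma t}}\;\xi^{(2)}\Big),$$ $$\mathcal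 U(x,v,t,\xi^{(1)},\xi^{(2)})=\Big(x+\tfrac{1-\eta_t}{\gamma}v+\sqrt{\tfrac2\gamma}(\mathcal Z^{(1)}-\mathcal Z^{(2)}),\ \eta_t v+\sqrt{2\gamma}\,\mathcal Z^{(2)}\Big),\qquad \mathcal B(x,v,t)=(x,v-t\nabla U(x)).$$ One UBU step is $(x,v)\mapsto\mathcal U\big(\mathcal B(\mathcal U(x,v,\tfrac h2,\xi^{(1)},\xi^{(2)}),h),\tfrac h2,\xi^{(3)},\xi^{(4)}\big)$ with independent $\xi^{(i)}\sim\mathcal N(0,I_d)$, fresh and independent of the past at each step. For probability measures $\mu_0,\nu_0$ on $\mathbb R^{2d}$ let $\mu_k,\nu_k$ be the laws of the chain after $k$ steps started from $\mu_0,\nu_0$. **Distance and constants.** Let $\tau=\min(\tfrac18,\tfrac{\kappa}{4\gamma^{2}})$, $\alpha=2L\gamma^{-2}$, and, with $z=x-x'$, $w=v-v'$, $$r_l^2=\gamma^{-2}z^{T}Kz+\tfrac12|(1-2\tau)z+\gamma^{-1}w|^2+\tfrac12\gamma^{-2}|w|^2,\qquad r_s=\alpha|z|+|z+\gamma^{-1}w|,$$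 $$\epsilon=\tfrac12\min\Big(1,\tfrac{2\alpha}{3\sqrt{L_K}\gamma^{-1}},\alpha\Big),\quad \mathcal E=\min\Big(\tfrac{\sqrt\kappa\gamma^{-1}}{\sqrt8\alpha},\tfrac12\Big),\quad \Delta=r_s-\epsilon r_l,\quad \mathcal R=\tau^{-1}L_GR^2\gamma^{-2}.$$ Let $D_{\mathcal K}$ be the supremum of $\Delta$ over pairs of points with $\kappa\gamma^{-2}|z|^2+\tfrac12|z+\gamma^{-1}w|^2+\tfrac12|\gamma^{-1}w|^2\le\mathcal R$, and $R_1$ the supremum of $r_s$ over pairs with $\Delta\le D_{\mathcal K}$. Put $\phi(s)=\exp(-64\alpha\gamma^2(s\wedge R_1)^2)$, $\Phi(s)=\int_0^s\phi$, $\hat c=\big(\gamma\int_0^{R_1}\Phi\phi^{-1}\big)^{-1}$, $\psi(s)=1-\tfrac{\hat c}{2}\gamma\int_0^{s\wedge R_1}\Phi\phi^{-1}$, $f(r)=\int_0^r\phi\psi$, and $$\rho=f\big(\Delta\wedge D_{\mathcal K}+\epsilon r_l\big).$$ If $R_1=0$, then $\hat c=\infty$, $1/(8LR_1^2)=\infty$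 and $\psi=1$. Let $$c=\min\Big(f'(R_1)\tfrac{7\epsilon\kappa\gamma^{-1}}{96}\mathcal E,\ f'(R_1)\tfrac{7\epsilon\gamma}{256}\mathcal E,\ f'(R_1)e^{-\gamma h}\tfrac{\gamma}{16},\ f'(R_1)e^{-\gamma h}\tfrac{\gamma\alpha}{4},\ \tfrac{9\hat c}{640},\ \tfrac{\hat c}{32(4\alpha+1)}\Big),$$ $$\mathbf C=\Big(1+\tfrac{\gamma h}{16}\Big)\max\Big(\big(1+\tfrac{\alpha\gamma h}2\big)^2,\,1+\gamma h\max(1,L_K\gamma^{-2})\Big),\qquad \mathbf M=f'(R_1)^{-1}\,\frac{2\max(\gamma(1+\alpha),1)}{\epsilon\min(\sqrt{2\kappa},1)}.$$ For a distance $\varrho$ on $\mathbb R^{2d}$ let $\mathcal W_\varrho(\mu,\nu)=\inf_\omega\int\varrho\,d\omega\in[0,\infty]$, over all couplings $\omega$ of $\mu$ and $\nu$; $\mathcal W_1$ is the case of the Euclidean distance. **Corollary (convergence in $L^1$-Wasserstein distance, UBU).** Assume $\gamma\ge\sqrt{13L_G^2/\kappa}$ and $$L\gamma^{-1}h\le\min\Big(\tfrac1{8LR_1^2},\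 \tfrac1{256\cdot75\,(2L\gamma^{-2}+1)},\ \tfrac{L\gamma^{-2}}{15},\ \tfrac{L}{55L_K}\Big).$$ Then $c>0$, $\mathbf C>0$, and for all probability measures $\mu_0,\nu_0$ on $\mathbb R^{2d}$ and all $k\ge0$, $$\mathcal W_\rho(\mu_k,\nu_k)\le\mathbf C e^{-ckh}\,\mathcal W_\rho(\mu_0,\nu_0),\qquad \mathcal W_1(\mu_k,\nu_k)\le\mathbf C\mathbf M e^{-ckh}\,\mathcal W_1(\mu_0,\nu_0).$$ Moreover the UBU chain has a unique invariant probability measure $\mu_{h,\infty}$; it has a finite first moment, and for all $\mu_0$ and all $k\ge0$, $$\mathcal W_\rho(\mu_k,\mu_{h,\infty})\le\mathbf C e^{-ckh}\,\mathcal W_\rho(\mu_0,\mu_{h,\infty}),\qquad \mathcal W_1(\mu_k,\mu_{h,\infty})\le\mathbf C\mathbf M e^{-ckh}\,\mathcal W_1(\mu_0,\mu_{h,\infty}).$$ -/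

import Mathlib

open MeasureTheory ProbabilityTheory

noncomputable section

namespace KineticLangevin

/-- Position (or velocity) space `ℝ^d` with the Euclidean norm. -/
abbrev E (d : ℕ) := EuclideanSpace ℝ (Fin d)

/-- Phase space `ℝ^{2d}` of pairs `(x, v)`. It only carries its product (Borel) sigma-algebra here;
the Euclidean distance on it is `euclDist` below (the product norm of `E d × E d` is not used). -/
abbrev Phase (d : ℕ) := E d × E d

/-- Action of a matrix on Euclidean space. -/
def act {d : ℕ} (K : Matrix (Fin d) (Fin d) ℝ) (x : E d) : E d := Matrix.toEuclideanLin K x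

/-! ### The data and the assumption on the potential -/

/-- The matrix and the real constants on which the distance and the rates depend. -/
structure Data (d : ℕ) where
  /-- quadratic part of the potential -/
  K : Matrix (Fin d) (Fin d) ℝ
  /-- convexity constant, smallest eigenvalue of `K` -/
  κ : ℝ
  /-- Lipschitz constant of `∇U` -/
  L : ℝ
  /-- Lipschitz constant of `∇G` -/
  LG : ℝ
  /-- Lipschitz constant of `x ↦ K x` -/
  LK : ℝ
  /-- radius outside of which the potential is strongly convex -/
  R : ℝ
  /-- friction -/
  γ : ℝ

/-- `U` is `κ`-strongly convex outside a ball of radius `R`, has an `L`-Lipschitz gradient and is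
split as `U x = xᵀ K x / 2 + G x`, with `K` symmetric positive definite with smallest eigenvalue
`κ`, and `G` convex outside a ball of radius `R` with `LG`-Lipschitz gradient. (Since `K` has an
eigenvalue, the dimension is at least one.) -/
structure Data.IsPotential {d : ℕ} (S : Data d) (U G : E d → ℝ) : Prop where
  differentiable : Differentiable ℝ U
  kappa_pos : 0 < S.κ
  R_nonneg : 0 ≤ S.R
  strongly_convex : ∀ x y : E d, S.R < ‖x - y‖ →
    S.κ * ‖x - y‖ ^ 2 ≤ inner ℝ (gradient U x - gradient U y) (x - y)
  lipschitz : ∀ x y : E d, ‖gradient U x - gradient U y‖ ≤ S.L * ‖x - y‖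
  posDef : S.K.PosDef
  smallest_eigenvalue : IsLeast (spectrum ℝ S.K) S.κ
  splitting : ∀ x : E d, U x = (1 / 2) * inner ℝ x (act S.K x) + G x
  G_convex : ∀ x y : E d, S.R < ‖x - y‖ →
    0 ≤ inner ℝ (gradient G x - gradient G y) (x - y)
  G_lipschitz : ∀ x y : E d, ‖gradient G x - gradient G y‖ ≤ S.LG * ‖x - y‖
  K_lipschitz : ∀ x y : E d, ‖act S.K x - act S.K y‖ ≤ S.LK * ‖x - y‖

/-! ### The UBU scheme -/

/-- `η = exp (-γ h)`. -/
def eta (γ h : ℝ) : ℝ := Real.exp (-(γ * h))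

/-- The step `𝓑`. -/
def stepB {d : ℕ} (U : E d → ℝ) (h : ℝ) (z : Phase d) : Phase d :=
  (z.1, z.2 - h • gradient U z.1)

/-- The Gaussian increment `𝓩⁽¹⁾`. -/
def noise1 {d : ℕ} (h : ℝ) (ξ₁ : E d) : E d := √h • ξ₁

/-- The Gaussian increment `𝓩⁽²⁾`. -/
def noise2 {d : ℕ} (γ h : ℝ) (ξ₁ ξ₂ : E d) : E d :=
  √((1 - eta γ h ^ 2) / (2 * γ)) •
    (√((1 - eta γ h) / (1 + eta γ h) * (2 / (γ * h))) • ξ₁ +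
      √(1 - (1 - eta γ h) / (1 + eta γ h) * (2 / (γ * h))) • ξ₂)

/-- The step `𝓤`, the exact solution of the kinetic Ornstein-Uhlenbeck part over time `h`. -/
def stepU {d : ℕ} (γ h : ℝ) (ξ₁ ξ₂ : E d) (z : Phase d) : Phase d :=
  (z.1 + ((1 - eta γ h) / γ) • z.2 + √(2 / γ) • (noise1 h ξ₁ - noise2 γ h ξ₁ ξ₂),
    eta γ h • z.2 + √(2 * γ) • noise2 γ h ξ₁ ξ₂)

/-- One step of the UBU scheme with noise `ξ⁽¹⁾, …, ξ⁽⁴⁾`. -/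
def stepUBU {d : ℕ} (U : E d → ℝ) (γ h : ℝ) (z : Phase d) (ξ : Fin 4 → E d) : Phase d :=
  stepU γ (h / 2) (ξ 2) (ξ 3) (stepB U h (stepU γ (h / 2) (ξ 0) (ξ 1) z))

/-- The law of four independent standard Gaussian vectors in `ℝ^d`. -/
def noiseLaw (d : ℕ) : Measure (Fin 4 → E d) := Measure.pi fun _ => stdGaussian (E d)

/-- The law of `UBU(Z, ξ)` for `Z ∼ μ` and independent Gaussian noise `ξ`. -/
def ubuPush {d : ℕ} (U : E d → ℝ) (γ h : ℝ) (μ : Measure (Phase d)) : Measure (Phase d) :=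
  Measure.map (fun p : Phase d × (Fin 4 → E d) => stepUBU U γ h p.1 p.2) (μ.prod (noiseLaw d))

/-- The law of `(X_k, V_k)` for the UBU chain with `(X_0, V_0) ∼ μ₀`. -/
def ubuLaw {d : ℕ} (U : E d → ℝ) (γ h : ℝ) (μ₀ : Measure (Phase d)) : ℕ → Measure (Phase d)
  | 0 => μ₀
  | k + 1 => ubuPush U γ h (ubuLaw U γ h μ₀ k)

/-! ### Wasserstein distances -/

/-- The Euclidean distance on `ℝ^{2d}`. -/
def euclDist {d : ℕ} (z z' : Phase d) : ℝ := √(‖z.1 - z'.1‖ ^ 2 + ‖z.2 - z'.2‖ ^ 2)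

/-- The `L¹`-Wasserstein distance with respect to the distance `ρ`, with values in `[0, ∞]`. -/
def wasserstein {d : ℕ} (ρ : Phase d → Phase d → ℝ) (μ ν : Measure (Phase d)) : ENNReal :=
  ⨅ (ω : Measure (Phase d × Phase d)) (_ : ω.fst = μ ∧ ω.snd = ν),
    ∫⁻ p, ENNReal.ofReal (ρ p.1 p.2) ∂ω

/-! ### The distance `ρ` and the constants -/

namespace Data

variable {d : ℕ} (S : Data d)

def τ : ℝ := min (1 / 8) (S.γ⁻¹ ^ 2 * S.κ / 4)

def α : ℝ := 2 * S.L * S.γ⁻¹ ^ 2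

def rl (z z' : Phase d) : ℝ :=
  √(S.γ⁻¹ ^ 2 * inner ℝ (z.1 - z'.1) (act S.K (z.1 - z'.1))
    + (1 / 2) * ‖(1 - 2 * S.τ) • (z.1 - z'.1) + S.γ⁻¹ • (z.2 - z'.2)‖ ^ 2
    + (1 / 2) * S.γ⁻¹ ^ 2 * ‖z.2 - z'.2‖ ^ 2)

def rs (z z' : Phase d) : ℝ :=
  S.α * ‖z.1 - z'.1‖ + ‖(z.1 - z'.1) + S.γ⁻¹ • (z.2 - z'.2)‖

def ε : ℝ := (1 / 2) * min 1 (min (2 * S.α / (3 * √S.LK * S.γ⁻¹)) S.α)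

/-- The constant written as a calligraphic `E`. -/
def calE : ℝ := min (√S.κ * S.γ⁻¹ / (√8 * S.α)) (1 / 2)

def Δ (z z' : Phase d) : ℝ := S.rs z z' - S.ε * S.rl z z'

/-- The constant written as a calligraphic `R`. -/
def calR : ℝ := S.τ⁻¹ * S.LG * S.R ^ 2 * S.γ⁻¹ ^ 2

/-- The compact set of differences `(z, w)`, written as a calligraphic `K`. -/
def calK : Set (Phase d) :=
  {p | S.κ * S.γ⁻¹ ^ 2 * ‖p.1‖ ^ 2 + (1 / 2) * ‖p.1 + S.γ⁻¹ • p.2‖ ^ 2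
    + (1 / 2) * ‖S.γ⁻¹ • p.2‖ ^ 2 ≤ S.calR}

/-- The supremum of `Δ` over pairs whose difference lies in `calK`. -/
def DK : ℝ := sSup {t | ∃ z z' : Phase d, z - z' ∈ S.calK ∧ t = S.Δ z z'}

def R₁ : ℝ := sSup {t | ∃ z z' : Phase d, S.Δ z z' ≤ S.DK ∧ t = S.rs z z'}

def φ (s : ℝ) : ℝ := Real.exp (-(128 * S.α * S.γ ^ 2 * ((min s S.R₁) ^ 2 / 2)))

def Φ (s : ℝ) : ℝ := ∫ x in (0 : ℝ)..s, S.φ x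

/-- The constant `ĉ`. If `R₁ = 0` then `ĉ` stands for `∞`, and the real value `0` that Lean
assigns is not used as a rate: see `rate`. -/
def cHat : ℝ := 1 / (S.γ * ∫ s in (0 : ℝ)..S.R₁, S.Φ s * (S.φ s)⁻¹)

/-- If `R₁ = 0`, the integral vanishes and `ψ = 1`. -/
def ψ (s : ℝ) : ℝ := 1 - S.cHat / 2 * S.γ * ∫ x in (0 : ℝ)..(min s S.R₁), S.Φ x * (S.φ x)⁻¹

def f (r : ℝ) : ℝ := ∫ s in (0 : ℝ)..r, S.φ s * S.ψ s

/-- The distance `ρ` on phase space. -/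
def ρ (z z' : Phase d) : ℝ := S.f (min (S.Δ z z') S.DK + S.ε * S.rl z z')

/-- The derivative `f'(R₁)`. -/
def fPrime : ℝ := deriv S.f S.R₁

/-- The four terms of the rate that do not involve `ĉ`. -/
def rateBase (h : ℝ) : ℝ :=
  min (S.fPrime * (7 * S.ε * S.κ * S.γ⁻¹ / 96) * S.calE)
    (min (S.fPrime * (7 * S.ε * S.γ / 256) * S.calE)
      (min (S.fPrime * Real.exp (-(S.γ * h)) * (S.γ / 16))
        (S.fPrime * Real.exp (-(S.γ * h)) * (S.γ * S.α / 4))))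

open Classical in
/-- The contraction rate `c`. If `R₁ = 0` then `ĉ = ∞`, so that the last two terms drop out. -/
def rate (h : ℝ) : ℝ :=
  if S.R₁ = 0 then S.rateBase h
  else min (S.rateBase h) (min (9 * S.cHat / 640) (S.cHat / (32 * (4 * S.α + 1))))

/-- The prefactor `C`. -/
def C (h : ℝ) : ℝ :=
  (1 + S.γ * h / 16) *
    max ((1 + S.α * S.γ * h / 2) ^ 2) (1 + S.γ * h * max 1 (S.LK * S.γ⁻¹ ^ 2))

/-- The prefactor `M`. -/
def M : ℝ :=
  S.fPrime⁻¹ * (2 * max (S.γ * (1 + S.α)) 1 / (S.ε * min (√(2 * S.κ)) 1))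

/-- The friction is large enough. -/
def LargeFriction : Prop := √(13 * S.LG ^ 2 / S.κ) ≤ S.γ

/-- The step size is small enough: `L γ⁻¹ h` is at most the minimum of `1 / (8 L R₁²)` and three
further numbers. The first bound is multiplied out, as it reads `∞` if `R₁ = 0`. -/
def SmallStep (h : ℝ) : Prop :=
  S.L * S.γ⁻¹ * h * (8 * S.L * S.R₁ ^ 2) ≤ 1 ∧
  S.L * S.γ⁻¹ * h ≤ 1 / (256 * 75 * (2 * S.L * S.γ⁻¹ ^ 2 + 1)) ∧
  S.L * S.γ⁻¹ * h ≤ S.L * S.γ⁻¹ ^ 2 / 15 ∧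
  S.L * S.γ⁻¹ * h ≤ S.L / (55 * S.LK)

end Data

end KineticLangevin

end

/-! Write z = `dz` for the position difference and p = `dp` for the velocity difference divided by
γ. The free flight damps p but leaves z + p unchanged up to noise, so z + p feels only the kick and
the Gaussian increments. Two mechanisms contract the difference.

With equal noise, a kick followed by a damped flight contracts the twisted energy `rl`². Its linear
part is dissipative. The nonlinear force is small because γ² ≥ 13 L_G²/κ, and outside `calK` its
inner product with z is bounded below well enough (`energy_contraction`, `neg_inner_dG_le`). This
serves large distances.

At smaller distances the noise is coupled so that the gap in z + p closes with maximal probability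
and is otherwise reflected (`reflNoise`, `map_reflNoise`). The gap is then multiplied by 1 - s,
where s has mean zero. The concave profile f turns this fluctuation into a decrease of the mean
(`f_sub_le`, `f_add_le`), which beats the drift of order α γ h caused by the kick
(`StepBounds.expectation_f_le`). If z is much larger than z + p, no noise coupling is needed: z
relaxes towards z + p, and the term α|z| in `rs` drops (`ρ_stepQ_le_position`).

The regimes fit together because ρ = f(min(rs, DK + ε rl)) by `ρ_eq`: whichever argument was active
before the step may be used to bound ρ after it. The result is `lintegral_ρ_stepQ_le`.

This contraction is proved for `stepQ`, a kick followed by both half flights, not for UBU itself: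
there the gap to be closed is known before any noise is drawn. A chain of k + 1 UBU steps is a half
flight, then k steps `stepQ`, then a kick with a half flight (`ubuLaw_succ_eq`). The two ends cost a
factor `lossFactor` each, and together with the one missing contraction they make up the prefactor C
(`lossFactor_mul_pow_le`). Comparing ρ with the Euclidean distance from both sides gives M.

For the invariant measure, the chain from the origin has summable successive W₁ distances, hence
bounded first moments and tight laws. A limit point is invariant by the Feller property. Uniqueness
holds among all probability measures, since the iterated Markov operator flattens bounded Lipschitz
functions pointwise. -/

noncomputable section

namespace KineticLangevin

open scoped RealInnerProductSpace

/-! ### The twisted energy: contraction under a kick followed by a flight. -/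

section Energy

variable {V : Type*} [NormedAddCommGroup V] [InnerProductSpace ℝ V]

/-- The quadratic form `⟪z, T z⟫ + |b z + p|² / 2 + |p|² / 2`. -/
def energy (T : V →ₗ[ℝ] V) (b : ℝ) (z p : V) : ℝ :=
  ⟪z, T z⟫ + 1 / 2 * ‖b • z + p‖ ^ 2 + 1 / 2 * ‖p‖ ^ 2

lemma energy_eq (T : V →ₗ[ℝ] V) (b : ℝ) (z p : V) :
    energy T b z p = ⟪z, T z⟫ + 1 / 2 * b ^ 2 * ‖z‖ ^ 2 + b * ⟪z, p⟫ + ‖p‖ ^ 2 := by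
  rw [energy, norm_add_sq_real, norm_smul, real_inner_smul_left, mul_pow, Real.norm_eq_abs, sq_abs]
  ring

/-- Here P is the velocity after the kick. The term 2e⟪P, T z⟫ is the one that has to cancel against
the kick to first order. -/
lemma energy_step {T : V →ₗ[ℝ] V} (hT : T.IsSymmetric) (b e : ℝ) (z P : V) :
    energy T b (z + e • P) ((1 - e) • P) = ⟪z, T z⟫ + 1 / 2 * b ^ 2 * ‖z‖ ^ 2 + 2 * e * ⟪P, T z⟫
      + e ^ 2 * ⟪P, T P⟫ + b * (1 - (1 - b) * e) * ⟪z, P⟫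
      + (1 - e * (2 - b) + e ^ 2 * (1 - b + b ^ 2 / 2)) * ‖P‖ ^ 2 := by
  have h1 : ⟪z, T P⟫ = ⟪P, T z⟫ := by rw [← hT z P, real_inner_comm]
  rw [energy_eq]
  simp only [map_add, map_smul, inner_add_left, inner_add_right, real_inner_smul_left,
    real_inner_smul_right, norm_add_sq_real, norm_smul, Real.norm_eq_abs, mul_pow, sq_abs, h1,
    real_inner_self_eq_norm_sq]
  ring

lemma two_mul_inner_le (x y : V) {s : ℝ} (hs : 0 < s) :
    2 * ⟪x, y⟫ ≤ s * ‖x‖ ^ 2 + s⁻¹ * ‖y‖ ^ 2 := by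
  have h := norm_sub_sq_real (s • x) y
  have h0 : 0 ≤ ‖s • x - y‖ ^ 2 := by positivity
  rw [h, norm_smul, real_inner_smul_left, Real.norm_eq_abs, mul_pow, sq_abs] at h0
  have h1 : 0 ≤ s⁻¹ * (s ^ 2 * ‖x‖ ^ 2 - 2 * (s * ⟪x, y⟫) + ‖y‖ ^ 2) := by positivity
  have h2 : s⁻¹ * (s ^ 2 * ‖x‖ ^ 2 - 2 * (s * ⟪x, y⟫) + ‖y‖ ^ 2)
      = s * ‖x‖ ^ 2 - 2 * ⟪x, y⟫ + s⁻¹ * ‖y‖ ^ 2 := by field_simp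
  linarith

lemma neg_two_mul_inner_le (x y : V) {s : ℝ} (hs : 0 < s) :
    -(2 * ⟪x, y⟫) ≤ s * ‖x‖ ^ 2 + s⁻¹ * ‖y‖ ^ 2 := by
  simpa using two_mul_inner_le (-x) y hs

/-- The coefficients of the cross terms have no fixed sign, so Young's inequality is needed for both
signs of the product. -/
lemma two_mul_mul_le_of_abs_le {a x D S : ℝ} (ha : |a| ≤ D) (h1 : 2 * x ≤ S) (h2 : -(2 * x) ≤ S) :
    2 * a * x ≤ D * S := by
  have hx : |2 * x| ≤ S := abs_le.2 ⟨by linarith, h1⟩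
  calc 2 * a * x = a * (2 * x) := by ring
    _ ≤ |a * (2 * x)| := le_abs_self _
    _ = |a| * |2 * x| := abs_mul _ _
    _ ≤ D * S := mul_le_mul ha hx (abs_nonneg _) ((abs_nonneg _).trans ha)

lemma flight_coeff_nonneg {δ e : ℝ} (hδ0 : 0 < δ) (hδ1 : δ ≤ 1 / 15) (he0 : δ - δ ^ 2 / 2 ≤ e) :
    0 ≤ e := by nlinarith

/-- The number c is the coefficient of ‖P‖² in `energy_step` at b = 1 - 2τ. Its upper bound provides
the dissipation of the velocity; with its lower bound, e - δc is of order δ². -/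
lemma kinetic_coeff_bounds {τ δ e c : ℝ} (hτ0 : 0 < τ) (hτ1 : τ ≤ 1 / 8) (hδ0 : 0 < δ)
    (hδ1 : δ ≤ 1 / 15) (he0 : δ - δ ^ 2 / 2 ≤ e) (he1 : e ≤ δ)
    (hc : c = 1 - e * (2 - (1 - 2 * τ))
      + e ^ 2 * (1 - (1 - 2 * τ) + (1 - 2 * τ) ^ 2 / 2)) :
    c ≤ 1 - 93 / 100 * δ - 2 * (τ * e) ∧ 1 - 5 / 4 * δ ≤ c := by
  have he : 0 < e := by nlinarith
  have hν1 : 1 - (1 - 2 * τ) + (1 - 2 * τ) ^ 2 / 2 ≤ 54 / 100 := by nlinarith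
  have hν0 : 0 ≤ 1 - (1 - 2 * τ) + (1 - 2 * τ) ^ 2 / 2 := by nlinarith
  have he2 : e ^ 2 ≤ δ ^ 2 := by nlinarith
  have hτe : τ * e ≤ δ / 8 := by nlinarith
  constructor
  · have : e ^ 2 * (1 - (1 - 2 * τ) + (1 - 2 * τ) ^ 2 / 2) ≤ δ ^ 2 * (54 / 100) :=
      mul_le_mul he2 hν1 hν0 (by positivity)
    rw [hc]; nlinarith
  · have : 0 ≤ e ^ 2 * (1 - (1 - 2 * τ) + (1 - 2 * τ) ^ 2 / 2) := by positivity
    rw [hc]; nlinarith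

lemma kinetic_small_bounds {τ δ e c : ℝ} (hτ0 : 0 < τ) (hτ1 : τ ≤ 1 / 8) (hδ0 : 0 < δ)
    (hδ1 : δ ≤ 1 / 15) (he0 : δ - δ ^ 2 / 2 ≤ e) (he1 : e ≤ δ) (hc : c ≤ 1) :
    29 / 30 * δ ≤ e ∧ τ * e ≤ 1 / 120 ∧ δ ^ 2 ≤ 1 / 15 * δ ∧
      -(2 * e * δ) + c * δ ^ 2 ≤ -(9 / 10) * δ ^ 2 ∧ c * δ ^ 2 ≤ 1 / 15 * δ := by
  have h1 : 29 / 30 * δ ≤ e := by nlinarith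
  have h2 : δ ^ 2 ≤ 1 / 15 * δ := by nlinarith
  have h3 : 0 ≤ δ ^ 2 := sq_nonneg δ
  refine ⟨h1, by nlinarith, h2, ?_, ?_⟩
  · have := mul_le_mul_of_nonneg_right hc h3
    have := mul_le_mul_of_nonneg_right h1 hδ0.le
    nlinarith
  · have := mul_le_mul_of_nonneg_right hc h3
    linarith

/-- The balance of the ‖z‖² terms, all charged to ⟪z, T z⟫ ≥ κ‖z‖². The 117/1000 pays for the force
through 13‖G‖² ≤ κ‖z‖², the 5/1000 for the remaining ‖T z‖², and 7/12 τ for the contraction itself.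
-/
lemma energy_contraction_coeff {κ τ : ℝ} (hκ : 0 < κ) (hτ0 : 0 < τ) (hτ1 : τ ≤ 1 / 8)
    (hτ2 : τ ≤ κ / 4) :
    (1 - 2 * τ) ^ 2 * τ + (1 - 2 * τ) * τ * κ + 12 * (1 - 2 * τ) * τ ^ 3 + 117 / 1000 * κ
      ≤ κ * (59 / 60 * (1 - 2 * τ) - 7 / 12 * τ - 5 / 1000) := by
  have hb : 0 ≤ 1 - 2 * τ := by linarith
  have h1 : (1 - 2 * τ) ^ 2 * τ ≤ (1 - 2 * τ) ^ 2 * (κ / 4) :=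
    mul_le_mul_of_nonneg_left hτ2 (sq_nonneg _)
  have h2 : 12 * (1 - 2 * τ) * τ ^ 3 ≤ 12 * (1 - 2 * τ) * (1 / 64 * (κ / 4)) := by
    apply mul_le_mul_of_nonneg_left _ (by linarith)
    calc τ ^ 3 = τ ^ 2 * τ := by ring
      _ ≤ 1 / 64 * (κ / 4) := mul_le_mul (by nlinarith) hτ2 hτ0.le (by norm_num)
  have h3 : (1 - 2 * τ) ^ 2 / 4 + (1 - 2 * τ) * τ + 12 * (1 - 2 * τ) / 256 + 117 / 1000
      ≤ 59 / 60 * (1 - 2 * τ) - 7 / 12 * τ - 5 / 1000 := by nlinarith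
  have h4 := mul_le_mul_of_nonneg_left h3 hκ.le
  linarith

-- Scalar core of `energy_contraction`: Z, P, K2, GG are the squared norms of z, p, T z, G; C, k, m,
-- pG, zG, tG are the inner products ⟪z, p⟫, ⟪z, T z⟫, ⟪p, T z⟫, ⟪p, G⟫, ⟪z, G⟫, ⟪T z, G⟫; and W is
-- the form of T at the kicked velocity.
set_option maxHeartbeats 400000 in
lemma energy_contraction_real {κ τ δ e c Z P C k K2 GG m pG tG zG W : ℝ} (hκ : 0 < κ)
    (hτ0 : 0 < τ) (hτ1 : τ ≤ 1 / 8) (hτ2 : τ ≤ κ / 4) (hδ0 : 0 < δ) (hδ1 : δ ≤ 1 / 15)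
    (he0 : δ - δ ^ 2 / 2 ≤ e) (he1 : e ≤ δ)
    (hc_up : c ≤ 1 - 93 / 100 * δ - 2 * (τ * e))
    (hZ : 0 ≤ Z) (hP : 0 ≤ P) (hK2 : 0 ≤ K2) (hGG : 0 ≤ GG) (hk : κ * Z ≤ k)
    (hK2k : δ * K2 ≤ k / 55) (hG : 13 * GG ≤ κ * Z)
    (hY : 0 ≤ (1 - 2 * τ) ^ 2 * Z + 2 * (1 - 2 * τ) * C + P)
    (hyz : 2 * (2 * τ * ((1 - 2 * τ) * Z + C)) ≤
      1 / 5 * ((1 - 2 * τ) ^ 2 * Z + 2 * (1 - 2 * τ) * C + P) + 5 * (4 * τ ^ 2 * Z))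
    (hzG : -zG ≤ τ * (κ * Z + 1 / 2 * (Z + 2 * C + P) + 1 / 2 * P))
    (hW : e ^ 2 * W ≤ δ / 55 * (2 * P + 4 * δ ^ 2 * (K2 + GG)))
    (hm : 2 * (e - δ * c) * m ≤ 1 / 10 * δ * P + 16 * δ ^ 3 * K2)
    (hpG : 2 * (-(δ * c)) * pG ≤ δ * (7 / 10 * P + 10 / 7 * GG))
    (htG : 2 * (δ * (δ * c - e)) * tG ≤ 5 / 4 * δ ^ 3 * (K2 + GG)) :
    k + 1 / 2 * (1 - 2 * τ) ^ 2 * Z + 2 * e * (m - δ * K2 - δ * tG) + e ^ 2 * W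
      + (1 - 2 * τ) * (1 - (1 - (1 - 2 * τ)) * e) * (C - δ * k - δ * zG)
      + c * (P - 2 * δ * (m + pG) + δ ^ 2 * (K2 + 2 * tG + GG))
      ≤ (1 - 7 / 12 * τ * δ) * (k + 1 / 2 * ((1 - 2 * τ) ^ 2 * Z + 2 * (1 - 2 * τ) * C + P)
        + 1 / 2 * P) := by
  have hc1 : c ≤ 1 := by
    have : 0 ≤ τ * e := mul_nonneg hτ0.le (flight_coeff_nonneg hδ0 hδ1 he0)
    linarith
  obtain ⟨heδ, hτe1, hδδ, hcK, hcG⟩ := kinetic_small_bounds hτ0 hτ1 hδ0 hδ1 he0 he1 hc1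
  have he : 0 < e := by linarith
  have hk0 : 0 ≤ k := (mul_nonneg hκ.le hZ).trans hk
  have hτe : 0 < τ * e := mul_pos hτ0 he
  have hK2b := mul_le_mul_of_nonneg_right hcK hK2
  have hGGb := mul_le_mul_of_nonneg_right hcG hGG
  -- The indefinite C is traded for Y = ‖(1 - 2τ)z + p‖², which is nonnegative and part of the
  -- energy.
  obtain ⟨Y, hYd⟩ : ∃ Y, Y = (1 - 2 * τ) ^ 2 * Z + 2 * (1 - 2 * τ) * C + P := ⟨_, rfl⟩
  rw [← hYd] at hY hyz ⊢
  -- Since z + p is (1 - 2τ)z + p plus 2τz, Young's inequality with weight 1/5 gives ‖z + p‖² ≤ 6/5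
  -- Y + 24τ²Z.
  obtain ⟨X, hXd⟩ : ∃ X, X = τ * (κ * Z + 1 / 2 * (6 / 5 * Y + 24 * τ ^ 2 * Z) + 1 / 2 * P) :=
    ⟨_, rfl⟩
  have hX : -zG ≤ X := by
    rw [hXd]
    refine hzG.trans (mul_le_mul_of_nonneg_left ?_ hτ0.le)
    linarith
  have hX0 : 0 ≤ X := by rw [hXd]; positivity
  have hzGb : (1 - 2 * τ) * (1 - 2 * (τ * e)) * δ * (-zG) ≤ (1 - 2 * τ) * δ * X := by
    have hb : 0 ≤ (1 - 2 * τ) * δ := mul_nonneg (by linarith) hδ0.le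
    have h1 : (1 - 2 * (τ * e)) * (-zG) ≤ (1 - 2 * (τ * e)) * X :=
      mul_le_mul_of_nonneg_left hX (by linarith)
    have h2 : (1 - 2 * (τ * e)) * X ≤ X := by
      have := mul_nonneg hτe.le hX0
      linarith
    calc (1 - 2 * τ) * (1 - 2 * (τ * e)) * δ * (-zG)
        = (1 - 2 * τ) * δ * ((1 - 2 * (τ * e)) * (-zG)) := by ring
      _ ≤ _ := mul_le_mul_of_nonneg_left (h1.trans h2) hb
  have hK2c : δ ^ 2 * (δ * K2) ≤ 1 / 15 * (δ ^ 2 * K2) := by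
    have := mul_le_mul_of_nonneg_right hδ1 (mul_nonneg (sq_nonneg δ) hK2)
    linarith
  have hK2d : δ ^ 2 * K2 ≤ δ * (k / 55) := by
    have := mul_le_mul_of_nonneg_left hK2k hδ0.le
    linarith
  have hGGc : δ ^ 2 * (δ * GG) ≤ 1 / 15 * δ * GG * (1 / 15) := by
    have := mul_le_mul_of_nonneg_right hδδ (mul_nonneg hδ0.le hGG)
    have := mul_le_mul_of_nonneg_right hδδ hGG
    linarith
  have hcP : c * P ≤ (1 - 93 / 100 * δ - 2 * (τ * e)) * P := mul_le_mul_of_nonneg_right hc_up hP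
  have hkk : (1 - 2 * τ) * (1 - 2 * (τ * e)) * δ * (-k) ≤ -((1 - 2 * τ) * (59 / 60) * δ * k) := by
    have h1 : 0 ≤ (1 - 2 * τ) * δ * k := by
      apply mul_nonneg (mul_nonneg (by linarith) hδ0.le) hk0
    have h2 := mul_le_mul_of_nonneg_right hτe1 h1
    linarith
  -- collect the coefficients of `Y`, `P`, `Z` and `k`
  have hCY : (1 - 2 * τ) * C = 1 / 2 * (Y - (1 - 2 * τ) ^ 2 * Z - P) := by linarith
  have hLHS : k + 1 / 2 * (1 - 2 * τ) ^ 2 * Z + 2 * e * (m - δ * K2 - δ * tG) + e ^ 2 * W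
      + (1 - 2 * τ) * (1 - (1 - (1 - 2 * τ)) * e) * (C - δ * k - δ * zG)
      + c * (P - 2 * δ * (m + pG) + δ ^ 2 * (K2 + 2 * tG + GG))
      = k + 1 / 2 * (1 - 2 * τ) ^ 2 * Z + e ^ 2 * W + 2 * (e - δ * c) * m
        + 2 * (-(δ * c)) * pG + 2 * (δ * (δ * c - e)) * tG + (-(2 * e * δ) + c * δ ^ 2) * K2
        + c * δ ^ 2 * GG + (1 - 2 * τ) * (1 - 2 * (τ * e)) * δ * (-k)
        + (1 - 2 * τ) * (1 - 2 * (τ * e)) * δ * (-zG) + c * P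
        + (1 - 2 * (τ * e)) * ((1 - 2 * τ) * C) := by ring
  rw [hLHS, hCY]
  -- The term Y decays at rate τe ≥ 29/30 τδ. This pays 3/5(1 - 2τ) for the force and 7/24, half of
  -- 7/12, for the contraction.
  have hYc : τ * (δ * Y) * (3 / 5 * (1 - 2 * τ) + 7 / 24) ≤ τ * e * Y := by
    have h0 : 0 ≤ τ * (δ * Y) := mul_nonneg hτ0.le (mul_nonneg hδ0.le hY)
    have h1 := mul_le_mul_of_nonneg_left (by linarith : 3 / 5 * (1 - 2 * τ) + 7 / 24 ≤ 29 / 30) h0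
    have h2 := mul_le_mul_of_nonneg_left (mul_le_mul_of_nonneg_right heδ hY) hτ0.le
    linarith
  have hPc : τ * (δ * P) * (1 / 2 * (1 - 2 * τ) + 7 / 24) ≤ τ * e * P := by
    have h0 : 0 ≤ τ * (δ * P) := mul_nonneg hτ0.le (mul_nonneg hδ0.le hP)
    have h1 := mul_le_mul_of_nonneg_left (by linarith : 1 / 2 * (1 - 2 * τ) + 7 / 24 ≤ 29 / 30) h0
    have h2 := mul_le_mul_of_nonneg_left (mul_le_mul_of_nonneg_right heδ hP) hτ0.le
    linarith
  have hZk : ((1 - 2 * τ) ^ 2 * τ + (1 - 2 * τ) * τ * κ + 12 * (1 - 2 * τ) * τ ^ 3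
      + 117 / 1000 * κ) * (δ * Z) ≤ (59 / 60 * (1 - 2 * τ) - 7 / 12 * τ - 5 / 1000) * (δ * k) := by
    have h0 : 0 ≤ 59 / 60 * (1 - 2 * τ) - 7 / 12 * τ - 5 / 1000 := by linarith
    calc _ ≤ κ * (59 / 60 * (1 - 2 * τ) - 7 / 12 * τ - 5 / 1000) * (δ * Z) :=
          mul_le_mul_of_nonneg_right (energy_contraction_coeff hκ hτ0 hτ1 hτ2)
            (mul_nonneg hδ0.le hZ)
      _ = (59 / 60 * (1 - 2 * τ) - 7 / 12 * τ - 5 / 1000) * (δ * (κ * Z)) := by ring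
      _ ≤ _ := mul_le_mul_of_nonneg_left (mul_le_mul_of_nonneg_left hk hδ0.le) h0
  have hZe : τ * e * ((1 - 2 * τ) ^ 2 * Z) ≤ τ * δ * ((1 - 2 * τ) ^ 2 * Z) :=
    mul_le_mul_of_nonneg_right (mul_le_mul_of_nonneg_left he1 hτ0.le)
      (mul_nonneg (sq_nonneg _) hZ)
  have hGδ := mul_le_mul_of_nonneg_left hG hδ0.le
  have hδP : 0 ≤ δ * P := mul_nonneg hδ0.le hP
  have hδk : 0 ≤ δ * k := mul_nonneg hδ0.le hk0
  have hδK : 0 ≤ δ ^ 2 * K2 := mul_nonneg (sq_nonneg δ) hK2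
  have hδG : 0 ≤ δ * GG := mul_nonneg hδ0.le hGG
  have hX2 : (1 - 2 * τ) * δ * X = (1 - 2 * τ) * τ * κ * (δ * Z)
      + 12 * (1 - 2 * τ) * τ ^ 3 * (δ * Z) + τ * (δ * Y) * (3 / 5 * (1 - 2 * τ))
      + τ * (δ * P) * (1 / 2 * (1 - 2 * τ)) := by rw [hXd]; ring
  rw [hX2] at hzGb
  linarith

set_option maxHeartbeats 1000000 in
/-- One step of the kick `p ↦ p - δ (T z + G)` followed by the damped free flight contracts the
energy, when the nonlinear force `G` is small and not too far from being monotone. -/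
lemma energy_contraction {T : V →ₗ[ℝ] V} (hT : T.IsSymmetric) {κ Λ τ δ e : ℝ} (hκ : 0 < κ)
    (hlow : ∀ x, κ * ‖x‖ ^ 2 ≤ ⟪x, T x⟫) (hup : ∀ x, ⟪x, T x⟫ ≤ Λ * ‖x‖ ^ 2)
    (hsq : ∀ x, ‖T x‖ ^ 2 ≤ Λ * ⟪x, T x⟫) (hΛ : 0 < Λ) (hτ0 : 0 < τ) (hτ1 : τ ≤ 1 / 8)
    (hτ2 : τ ≤ κ / 4) (hδ0 : 0 < δ) (hδ1 : δ ≤ 1 / 15) (hδΛ : δ * Λ ≤ 1 / 55)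
    (he0 : δ - δ ^ 2 / 2 ≤ e) (he1 : e ≤ δ) (z p G : V) (hG : 13 * ‖G‖ ^ 2 ≤ κ * ‖z‖ ^ 2)
    (hzG : -⟪z, G⟫ ≤ τ * (κ * ‖z‖ ^ 2 + 1 / 2 * ‖z + p‖ ^ 2 + 1 / 2 * ‖p‖ ^ 2)) :
    energy T (1 - 2 * τ) (z + e • (p - δ • (T z + G))) ((1 - e) • (p - δ • (T z + G)))
      ≤ (1 - 7 / 12 * τ * δ) * energy T (1 - 2 * τ) z p := by
  have hlz := hlow z
  have hsz := hsq z
  have hup' := hup (p - δ • (T z + G))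
  have hPP : ‖p - δ • (T z + G)‖ ^ 2 = ‖p‖ ^ 2 - 2 * δ * (⟪p, T z⟫ + ⟪p, G⟫)
      + δ ^ 2 * (‖T z‖ ^ 2 + 2 * ⟪T z, G⟫ + ‖G‖ ^ 2) := by
    rw [norm_sub_sq_real, norm_smul, real_inner_smul_right, inner_add_right, mul_pow,
      Real.norm_eq_abs, sq_abs, norm_add_sq_real]
    ring
  -- The coefficient of ⟪p, T z⟫ will be of order δ². This weight turns it into δ‖p‖²/10 plus
  -- O(δ³)‖T z‖².
  have hm1 := two_mul_inner_le p (T z) (s := 8 / 100 / δ) (by positivity)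
  have hm2 := neg_two_mul_inner_le p (T z) (s := 8 / 100 / δ) (by positivity)
  have hpG := neg_two_mul_inner_le p G (s := 7 / 10) (by norm_num)
  have hpG' := two_mul_inner_le p G (s := 7 / 10) (by norm_num)
  have htG1 := two_mul_inner_le (T z) G (s := 1) (by norm_num)
  have htG2 := neg_two_mul_inner_le (T z) G (s := 1) (by norm_num)
  have hpT1 := neg_two_mul_inner_le p (T z) (s := 1 / δ / 2) (by positivity)
  have hpG1 := neg_two_mul_inner_le p G (s := 1 / δ / 2) (by positivity)
  have hy1 : ‖(1 - 2 * τ) • z + p‖ ^ 2 = (1 - 2 * τ) ^ 2 * ‖z‖ ^ 2 + 2 * (1 - 2 * τ) * ⟪z, p⟫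
      + ‖p‖ ^ 2 := by
    rw [norm_add_sq_real, norm_smul, real_inner_smul_left, mul_pow, Real.norm_eq_abs, sq_abs]; ring
  have hzp : ‖z + p‖ ^ 2 = ‖z‖ ^ 2 + 2 * ⟪z, p⟫ + ‖p‖ ^ 2 := norm_add_sq_real z p
  have hyz := two_mul_inner_le ((1 - 2 * τ) • z + p) ((2 * τ) • z) (s := 1 / 5) (by norm_num)
  rw [inner_add_left, real_inner_smul_left, real_inner_smul_right, real_inner_smul_right,
    real_inner_self_eq_norm_sq, norm_smul, mul_pow, Real.norm_eq_abs, sq_abs, hy1,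
    real_inner_comm] at hyz
  rw [energy_step hT, energy, hy1, hPP]
  have e1 : ⟪p - δ • (T z + G), T z⟫ = ⟪p, T z⟫ - δ * ‖T z‖ ^ 2 - δ * ⟪T z, G⟫ := by
    rw [inner_sub_left, real_inner_smul_left, inner_add_left, real_inner_self_eq_norm_sq,
      real_inner_comm]; rw [real_inner_comm G]; ring
  have e2 : ⟪z, p - δ • (T z + G)⟫ = ⟪z, p⟫ - δ * ⟪z, T z⟫ - δ * ⟪z, G⟫ := by
    rw [inner_sub_right, real_inner_smul_right, inner_add_right]; ring
  rw [e1, e2]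
  rw [hPP] at hup'
  rw [hzp] at hzG
  have hZ0 : 0 ≤ ‖z‖ ^ 2 := by positivity
  have hP0 : 0 ≤ ‖p‖ ^ 2 := by positivity
  have hK0 : 0 ≤ ‖T z‖ ^ 2 := by positivity
  have hGG0 : 0 ≤ ‖G‖ ^ 2 := by positivity
  have hY0 : 0 ≤ ‖(1 - 2 * τ) • z + p‖ ^ 2 := by positivity
  rw [hy1] at hY0
  generalize ⟪p - δ • (T z + G), T (p - δ • (T z + G))⟫ = W at *
  generalize ‖z‖ ^ 2 = Z at *
  generalize ‖p‖ ^ 2 = P at *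
  generalize ‖T z‖ ^ 2 = K2 at *
  generalize ‖G‖ ^ 2 = GG at *
  generalize ⟪z, T z⟫ = k at *
  generalize ⟪p, T z⟫ = m at *
  generalize ⟪p, G⟫ = pG at *
  generalize ⟪z, G⟫ = zG at *
  generalize ⟪T z, G⟫ = tG at *
  generalize ⟪z, p⟫ = C at *
  clear hlow hup hsq hT e1 e2 hPP hy1 hzp
  obtain ⟨c, hc⟩ : ∃ c, c = 1 - e * (2 - (1 - 2 * τ))
      + e ^ 2 * (1 - (1 - 2 * τ) + (1 - 2 * τ) ^ 2 / 2) := ⟨_, rfl⟩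
  obtain ⟨hc_up, hc_low⟩ := kinetic_coeff_bounds hτ0 hτ1 hδ0 hδ1 he0 he1 hc
  rw [← hc]
  have hτe : 0 ≤ τ * e := mul_nonneg hτ0.le (flight_coeff_nonneg hδ0 hδ1 he0)
  have hc1 : c ≤ 1 := by linarith
  obtain ⟨heδ, -, hδδ, -, -⟩ := kinetic_small_bounds hτ0 hτ1 hδ0 hδ1 he0 he1 hc1
  have hk0 : 0 ≤ k := (mul_nonneg hκ.le hZ0).trans hlz
  have hK2k : δ * K2 ≤ k / 55 := by
    have h1 := mul_le_mul_of_nonneg_left hsz hδ0.le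
    have h2 := mul_le_mul_of_nonneg_right hδΛ hk0
    linarith
  have hPPb : P - 2 * δ * (m + pG) + δ ^ 2 * (K2 + 2 * tG + GG)
      ≤ 2 * P + 4 * δ ^ 2 * (K2 + GG) := by
    have a1 := mul_le_mul_of_nonneg_left hpT1 hδ0.le
    have a2 := mul_le_mul_of_nonneg_left hpG1 hδ0.le
    have a3 := mul_le_mul_of_nonneg_left htG1 (sq_nonneg δ)
    have b1 : δ * (1 / δ / 2 * P + (1 / δ / 2)⁻¹ * K2) = P / 2 + 2 * δ ^ 2 * K2 := by
      field_simp
    have b2 : δ * (1 / δ / 2 * P + (1 / δ / 2)⁻¹ * GG) = P / 2 + 2 * δ ^ 2 * GG := by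
      field_simp
    rw [b1] at a1
    rw [b2] at a2
    linarith
  have hWb : e ^ 2 * W ≤ δ / 55 * (2 * P + 4 * δ ^ 2 * (K2 + GG)) := by
    have a0 : 0 ≤ 2 * P + 4 * δ ^ 2 * (K2 + GG) := by positivity
    have hΛe : e ^ 2 * Λ ≤ δ / 55 := by
      have h1 : e ^ 2 ≤ δ ^ 2 := pow_le_pow_left₀ (by linarith) he1 2
      have h2 := mul_le_mul_of_nonneg_right h1 hΛ.le
      have h3 := mul_le_mul_of_nonneg_left hδΛ hδ0.le
      linarith
    calc e ^ 2 * W ≤ e ^ 2 * (Λ * (2 * P + 4 * δ ^ 2 * (K2 + GG))) := by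
          apply mul_le_mul_of_nonneg_left _ (sq_nonneg e)
          exact hup'.trans (mul_le_mul_of_nonneg_left hPPb hΛ.le)
      _ = e ^ 2 * Λ * (2 * P + 4 * δ ^ 2 * (K2 + GG)) := by ring
      _ ≤ _ := mul_le_mul_of_nonneg_right hΛe a0
  -- The flight contributes 2e⟪p, T z⟫ and the damped kick -2δc⟪p, T z⟫. They cancel up to second
  -- order in δ.
  have hd1 : e - δ * c ≤ 5 / 4 * δ ^ 2 := by
    have := mul_le_mul_of_nonneg_left hc_low hδ0.le
    linarith
  have hd2 : -(5 / 4 * δ ^ 2) ≤ e - δ * c := by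
    have := mul_le_mul_of_nonneg_left hc1 hδ0.le
    linarith [sq_nonneg δ]
  have hmb : 2 * (e - δ * c) * m ≤ 1 / 10 * δ * P + 16 * δ ^ 3 * K2 := by
    have b1 : 5 / 4 * δ ^ 2 * (8 / 100 / δ * P + (8 / 100 / δ)⁻¹ * K2)
        = 1 / 10 * δ * P + 125 / 8 * δ ^ 3 * K2 := by
      field_simp; ring
    have h3 : 0 ≤ δ ^ 3 * K2 := by positivity
    have := two_mul_mul_le_of_abs_le (abs_le.2 ⟨hd2, hd1⟩) hm1 hm2
    linarith
  have hpGb : 2 * (-(δ * c)) * pG ≤ δ * (7 / 10 * P + 10 / 7 * GG) := by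
    norm_num at hpG hpG'
    apply two_mul_mul_le_of_abs_le _ hpG' hpG
    have h0 : 0 ≤ δ * c := mul_nonneg hδ0.le (by linarith)
    have := mul_le_mul_of_nonneg_left hc1 hδ0.le
    rw [abs_neg, abs_of_nonneg h0]
    linarith
  have htGb : 2 * (δ * (δ * c - e)) * tG ≤ 5 / 4 * δ ^ 3 * (K2 + GG) := by
    norm_num at htG1 htG2
    apply two_mul_mul_le_of_abs_le _ htG1 htG2
    rw [abs_mul, abs_of_pos hδ0]
    have : |δ * c - e| ≤ 5 / 4 * δ ^ 2 := abs_le.2 ⟨by linarith, by linarith⟩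
    have := mul_le_mul_of_nonneg_left this hδ0.le
    linarith
  norm_num at hyz
  refine energy_contraction_real hκ hτ0 hτ1 hτ2 hδ0 hδ1 he0 he1 hc_up hZ0 hP0 hK0 hGG0 hlz hK2k hG
    hY0 ?_ hzG hWb hmb hpGb htGb
  linarith

end Energy

end KineticLangevin
end

noncomputable section

namespace KineticLangevin

open scoped RealInnerProductSpace

/-! ### Growth of the energy under the two halves of a UBU step. -/

section EnergyGrowth

variable {V : Type*} [NormedAddCommGroup V] [InnerProductSpace ℝ V]

/-- Growth of the energy under half a free flight. -/
lemma energy_flight_le {T : V →ₗ[ℝ] V} (hT : T.IsSymmetric) {Λ τ δ e M : ℝ}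
    (hnn : ∀ x, 0 ≤ ⟪x, T x⟫) (hup : ∀ x, ⟪x, T x⟫ ≤ Λ * ‖x‖ ^ 2)
    (hsq : ∀ x, ‖T x‖ ^ 2 ≤ Λ * ⟪x, T x⟫) (hΛ : 0 < Λ) (hM : 1 ≤ M) (hΛM : Λ ≤ M)
    (hτ0 : 0 < τ) (hτ1 : τ ≤ 1 / 8) (hδ0 : 0 < δ) (hδ1 : δ ≤ 1 / 15) (hδΛ : δ * Λ ≤ 1 / 55)
    (he0 : 0 ≤ e) (he1 : e ≤ δ / 2) (z p : V) :
    energy T (1 - 2 * τ) (z + e • p) ((1 - e) • p) ≤ (1 + δ * M) * energy T (1 - 2 * τ) z p := by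
  have hsz := hsq z
  have hup' := hup p
  have hk0 := hnn z
  have hm := two_mul_inner_le p (T z) (s := 1) (by norm_num)
  have hy1 : ‖(1 - 2 * τ) • z + p‖ ^ 2 = (1 - 2 * τ) ^ 2 * ‖z‖ ^ 2 + 2 * (1 - 2 * τ) * ⟪z, p⟫
      + ‖p‖ ^ 2 := by
    rw [norm_add_sq_real, norm_smul, real_inner_smul_left, mul_pow, Real.norm_eq_abs, sq_abs]; ring
  have hyp := neg_two_mul_inner_le ((1 - 2 * τ) • z + p) p (s := 1) (by norm_num)
  rw [inner_add_left, real_inner_smul_left, real_inner_self_eq_norm_sq, hy1] at hyp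
  rw [energy_step hT, energy, hy1]
  have hP0 : 0 ≤ ‖p‖ ^ 2 := by positivity
  have hY0 : 0 ≤ ‖(1 - 2 * τ) • z + p‖ ^ 2 := by positivity
  rw [hy1] at hY0
  norm_num at hm hyp
  generalize ‖z‖ ^ 2 = Z at *
  generalize ‖p‖ ^ 2 = P at *
  generalize ‖T z‖ ^ 2 = K2 at *
  generalize ⟪z, T z⟫ = k at *
  generalize ⟪p, T z⟫ = m at *
  generalize ⟪p, T p⟫ = W at *
  generalize ⟪z, p⟫ = C at *
  clear hnn hup hsq hT
  obtain ⟨Y, hYd⟩ : ∃ Y, Y = (1 - 2 * τ) ^ 2 * Z + 2 * (1 - 2 * τ) * C + P := ⟨_, rfl⟩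
  rw [← hYd] at hY0 hyp ⊢
  have hW : e ^ 2 * W ≤ e * P / 110 := by
    have h1 : e * Λ ≤ 1 / 110 := by
      have := mul_le_mul_of_nonneg_right he1 hΛ.le
      linarith
    calc e ^ 2 * W ≤ e ^ 2 * (Λ * P) := mul_le_mul_of_nonneg_left hup' (sq_nonneg e)
      _ = e * P * (e * Λ) := by ring
      _ ≤ e * P * (1 / 110) := mul_le_mul_of_nonneg_left h1 (mul_nonneg he0 hP0)
      _ = _ := by ring
  have hν : e ^ 2 * (1 - (1 - 2 * τ) + (1 - 2 * τ) ^ 2 / 2) * P ≤ e * P * (2 / 100) := by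
    have hν1 : 1 - (1 - 2 * τ) + (1 - 2 * τ) ^ 2 / 2 ≤ 54 / 100 := by nlinarith
    have h2 := mul_le_mul_of_nonneg_left hν1 (mul_nonneg (sq_nonneg e) hP0)
    have h3 := mul_le_mul_of_nonneg_left (by linarith : e ≤ 1 / 30) (mul_nonneg he0 hP0)
    nlinarith
  -- M enters only here, through 2⟪p, T z⟫ ≤ ‖p‖² + ‖T z‖². The velocity share e‖p‖² is compensated
  -- by the damping.
  have hk : K2 ≤ M * k := hsz.trans (mul_le_mul_of_nonneg_right hΛM hk0)
  have h1 : e * (2 * m) ≤ e * (P + M * k) := mul_le_mul_of_nonneg_left (by linarith) he0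
  have h2 : e * τ * (-(2 * ((1 - 2 * τ) * C + P))) ≤ e * (1 / 8) * (Y + P) := by
    calc e * τ * (-(2 * ((1 - 2 * τ) * C + P))) ≤ e * τ * (Y + P) :=
          mul_le_mul_of_nonneg_left (by linarith) (mul_nonneg he0 hτ0.le)
      _ ≤ _ := mul_le_mul_of_nonneg_right (mul_le_mul_of_nonneg_left hτ1 he0) (by linarith)
  have hN0 : 0 ≤ k + 1 / 2 * Y + 1 / 2 * P := by linarith
  have h3 : e * (M * k + 1 / 2 * Y + 1 / 2 * P) ≤ δ * M * (k + 1 / 2 * Y + 1 / 2 * P) := by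
    have h4 : M * k + 1 / 2 * Y + 1 / 2 * P ≤ M * (k + 1 / 2 * Y + 1 / 2 * P) := by
      have := mul_le_mul_of_nonneg_right hM (by linarith : 0 ≤ 1 / 2 * Y + 1 / 2 * P)
      linarith
    have h5 : 0 ≤ M * (k + 1 / 2 * Y + 1 / 2 * P) := mul_nonneg (by linarith) hN0
    calc _ ≤ e * (M * (k + 1 / 2 * Y + 1 / 2 * P)) := mul_le_mul_of_nonneg_left h4 he0
      _ ≤ δ * (M * (k + 1 / 2 * Y + 1 / 2 * P)) := mul_le_mul_of_nonneg_right (by linarith) h5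
      _ = _ := by ring
  have h6 : 0 ≤ e * P := mul_nonneg he0 hP0
  have h7 : 0 ≤ e * Y := mul_nonneg he0 hY0
  have hL : k + 1 / 2 * (1 - 2 * τ) ^ 2 * Z + 2 * e * m + e ^ 2 * W
      + (1 - 2 * τ) * (1 - (1 - (1 - 2 * τ)) * e) * C
      + (1 - e * (2 - (1 - 2 * τ)) + e ^ 2 * (1 - (1 - 2 * τ) + (1 - 2 * τ) ^ 2 / 2)) * P
      = k + 1 / 2 * Y + 1 / 2 * P + e * (2 * m) + e ^ 2 * W
        + e * τ * (-(2 * ((1 - 2 * τ) * C + P))) - e * P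
        + e ^ 2 * (1 - (1 - 2 * τ) + (1 - 2 * τ) ^ 2 / 2) * P := by rw [hYd]; ring
  rw [hL]
  linarith

lemma half_kinetic_coeff_bounds {τ δ e c : ℝ} (hτ0 : 0 < τ) (hτ1 : τ ≤ 1 / 8) (hδ0 : 0 < δ)
    (hδ1 : δ ≤ 1 / 15) (he0 : δ / 2 - δ ^ 2 / 8 ≤ e) (he1 : e ≤ δ / 2)
    (hc : c = 1 - e * (2 - (1 - 2 * τ))
      + e ^ 2 * (1 - (1 - 2 * τ) + (1 - 2 * τ) ^ 2 / 2)) :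
    c ≤ 1 - 47 / 100 * δ - 2 * (τ * e) ∧ 1 - 625 / 1000 * δ ≤ c := by
  have he : 0 < e := by nlinarith
  have hν1 : 1 - (1 - 2 * τ) + (1 - 2 * τ) ^ 2 / 2 ≤ 54 / 100 := by nlinarith
  have hν0 : 0 ≤ 1 - (1 - 2 * τ) + (1 - 2 * τ) ^ 2 / 2 := by nlinarith
  have he2 : e ^ 2 ≤ (δ / 2) ^ 2 := by nlinarith
  have hτe : τ * e ≤ δ / 16 := by nlinarith
  constructor
  · have : e ^ 2 * (1 - (1 - 2 * τ) + (1 - 2 * τ) ^ 2 / 2) ≤ (δ / 2) ^ 2 * (54 / 100) :=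
      mul_le_mul he2 hν1 hν0 (by positivity)
    rw [hc]; nlinarith
  · have : 0 ≤ e ^ 2 * (1 - (1 - 2 * τ) + (1 - 2 * τ) ^ 2 / 2) := by positivity
    rw [hc]; nlinarith

-- Now a full kick meets half a flight: e is about δ/2 and δc about δ, so the cross term with T z
-- survives at first order. It is absorbed by K2 ≤ M k, which makes M the growth rate. For the
-- force, smallness suffices and no monotonicity is needed.
set_option maxHeartbeats 400000 in
lemma energy_kick_flight_real {τ δ e c M Z P C Y k K2 GG m pG tG zG W : ℝ} (hM : 1 ≤ M)
    (hτ0 : 0 < τ) (hτ1 : τ ≤ 1 / 8) (hδ0 : 0 < δ) (hδ1 : δ ≤ 1 / 15)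
    (he : 0 ≤ e) (he0 : δ / 2 - δ ^ 2 / 8 ≤ e) (he1 : e ≤ δ / 2)
    (hc_up : c ≤ 1 - 47 / 100 * δ - 2 * (τ * e))
    (hP : 0 ≤ P) (hK2 : 0 ≤ K2) (hGG : 0 ≤ GG) (hk0 : 0 ≤ k)
    (hK2M : K2 ≤ M * k) (hK2k : δ * K2 ≤ k / 55) (hG : 13 * GG ≤ k)
    (hYd : Y = (1 - 2 * τ) ^ 2 * Z + 2 * (1 - 2 * τ) * C + P) (hY : 0 ≤ Y)
    (hyp : -(2 * ((1 - 2 * τ) * C + P)) ≤ Y + P)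
    (hzG : -((1 - 2 * τ) * zG) ≤ 3 / 20 * Y + 1 / 8 * P + 4 * GG)
    (hW : e ^ 2 * W ≤ δ / 220 * (2 * P + 4 * δ ^ 2 * (K2 + GG)))
    (hm : 2 * (e - δ * c) * m ≤ 51 / 100 * δ * (95 / 100 * P + 100 / 95 * K2))
    (hpG : 2 * (-(δ * c)) * pG ≤ δ * (1 / 4 * P + 4 * GG))
    (htG : 2 * (δ * (δ * c - e)) * tG ≤ 51 / 100 * δ ^ 2 * (K2 + GG)) :
    k + 1 / 2 * (1 - 2 * τ) ^ 2 * Z + 2 * e * (m - δ * K2 - δ * tG) + e ^ 2 * W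
      + (1 - 2 * τ) * (1 - (1 - (1 - 2 * τ)) * e) * (C - δ * k - δ * zG)
      + c * (P - 2 * δ * (m + pG) + δ ^ 2 * (K2 + 2 * tG + GG))
      ≤ (1 + δ * M) * (k + 1 / 2 * Y + 1 / 2 * P) := by
  have hτe : 0 ≤ τ * e := mul_nonneg hτ0.le he
  have hc1 : c ≤ 1 := by linarith
  have hτe1 : τ * e ≤ 1 / 240 := by nlinarith
  have hδδ : δ ^ 2 ≤ 1 / 15 * δ := by nlinarith
  have hK2b : (-(2 * e * δ) + c * δ ^ 2) * K2 ≤ 1 / 4 * δ ^ 2 * K2 := by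
    apply mul_le_mul_of_nonneg_right _ hK2
    have h1 := mul_le_mul_of_nonneg_right hc1 (sq_nonneg δ)
    have h2 := mul_le_mul_of_nonneg_right he0 hδ0.le
    have h3 := mul_le_mul_of_nonneg_right hδ1 (sq_nonneg δ)
    nlinarith
  have hGGb : c * δ ^ 2 * GG ≤ 1 / 15 * δ * GG := by
    apply mul_le_mul_of_nonneg_right _ hGG
    have h1 := mul_le_mul_of_nonneg_right hc1 (sq_nonneg δ)
    linarith
  have hX0 : 0 ≤ 3 / 20 * Y + 1 / 8 * P + 4 * GG := by linarith
  have hzGb : (1 - 2 * τ) * (1 - 2 * (τ * e)) * δ * (-zG)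
      ≤ δ * (3 / 20 * Y + 1 / 8 * P + 4 * GG) := by
    have h1 : (1 - 2 * (τ * e)) * (-((1 - 2 * τ) * zG))
        ≤ (1 - 2 * (τ * e)) * (3 / 20 * Y + 1 / 8 * P + 4 * GG) :=
      mul_le_mul_of_nonneg_left hzG (by linarith)
    have h2 := mul_nonneg hτe hX0
    have h3 := mul_le_mul_of_nonneg_left (by linarith :
      (1 - 2 * (τ * e)) * (-((1 - 2 * τ) * zG)) ≤ 3 / 20 * Y + 1 / 8 * P + 4 * GG) hδ0.le
    linarith
  have hkk : (1 - 2 * τ) * (1 - 2 * (τ * e)) * δ * (-k) ≤ -(7 / 10 * (δ * k)) := by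
    have h0 : 0 ≤ δ * k := mul_nonneg hδ0.le hk0
    have h1 : 7 / 10 ≤ (1 - 2 * τ) * (1 - 2 * (τ * e)) := by nlinarith
    have h2 := mul_le_mul_of_nonneg_right h1 h0
    linarith
  have hcP : c * P ≤ (1 - 47 / 100 * δ - 2 * (τ * e)) * P := mul_le_mul_of_nonneg_right hc_up hP
  have h2 : e * τ * (-(2 * ((1 - 2 * τ) * C + P))) ≤ δ / 16 * (Y + P) := by
    calc e * τ * (-(2 * ((1 - 2 * τ) * C + P))) ≤ e * τ * (Y + P) :=
          mul_le_mul_of_nonneg_left hyp (mul_nonneg he hτ0.le)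
      _ ≤ _ := by
        apply mul_le_mul_of_nonneg_right _ (by linarith)
        have := mul_le_mul he1 hτ1 hτ0.le (by linarith : 0 ≤ δ / 2)
        linarith
  have hK2c : δ ^ 2 * (δ * K2) ≤ δ ^ 2 * K2 := by
    have := mul_le_mul_of_nonneg_right (hδ1.trans (by norm_num : (1 : ℝ) / 15 ≤ 1))
      (mul_nonneg (sq_nonneg δ) hK2)
    linarith
  have hK2d : δ ^ 2 * K2 ≤ δ * (k / 55) := by
    have := mul_le_mul_of_nonneg_left hK2k hδ0.le
    linarith
  have hGG1 : δ ^ 2 * GG ≤ 1 / 15 * (δ * GG) := by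
    have := mul_le_mul_of_nonneg_right hδδ hGG
    linarith
  have hGG2 : δ ^ 2 * (δ * GG) ≤ δ ^ 2 * GG := by
    have := mul_le_mul_of_nonneg_right (hδ1.trans (by norm_num : (1 : ℝ) / 15 ≤ 1))
      (mul_nonneg (sq_nonneg δ) hGG)
    linarith
  have hGδ := mul_le_mul_of_nonneg_left hG hδ0.le
  have hKM := mul_le_mul_of_nonneg_left hK2M hδ0.le
  have hδP : 0 ≤ δ * P := mul_nonneg hδ0.le hP
  have hδY : 0 ≤ δ * Y := mul_nonneg hδ0.le hY
  have hδk : 0 ≤ δ * k := mul_nonneg hδ0.le hk0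
  have hδMk := mul_le_mul_of_nonneg_right hM hδk
  have hδMY := mul_le_mul_of_nonneg_right hM hδY
  have hδMP := mul_le_mul_of_nonneg_right hM hδP
  have hLHS : k + 1 / 2 * (1 - 2 * τ) ^ 2 * Z + 2 * e * (m - δ * K2 - δ * tG) + e ^ 2 * W
      + (1 - 2 * τ) * (1 - (1 - (1 - 2 * τ)) * e) * (C - δ * k - δ * zG)
      + c * (P - 2 * δ * (m + pG) + δ ^ 2 * (K2 + 2 * tG + GG))
      = k + 1 / 2 * Y - 1 / 2 * P + e ^ 2 * W + 2 * (e - δ * c) * m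
        + 2 * (-(δ * c)) * pG + 2 * (δ * (δ * c - e)) * tG + (-(2 * e * δ) + c * δ ^ 2) * K2
        + c * δ ^ 2 * GG + (1 - 2 * τ) * (1 - 2 * (τ * e)) * δ * (-k)
        + (1 - 2 * τ) * (1 - 2 * (τ * e)) * δ * (-zG) + c * P + 2 * (τ * e) * P
        + e * τ * (-(2 * ((1 - 2 * τ) * C + P))) := by rw [hYd]; ring
  rw [hLHS]
  linarith

set_option maxHeartbeats 1000000 in
/-- Growth of the energy under the kick `p ↦ p - δ (T z + G)` followed by half a free flight. -/
lemma energy_kick_flight_le {T : V →ₗ[ℝ] V} (hT : T.IsSymmetric) {Λ τ δ e M : ℝ}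
    (hnn : ∀ x, 0 ≤ ⟪x, T x⟫) (hup : ∀ x, ⟪x, T x⟫ ≤ Λ * ‖x‖ ^ 2)
    (hsq : ∀ x, ‖T x‖ ^ 2 ≤ Λ * ⟪x, T x⟫) (hΛ : 0 < Λ) (hM : 1 ≤ M) (hΛM : Λ ≤ M)
    (hτ0 : 0 < τ) (hτ1 : τ ≤ 1 / 8) (hδ0 : 0 < δ) (hδ1 : δ ≤ 1 / 15) (hδΛ : δ * Λ ≤ 1 / 55)
    (he0 : δ / 2 - δ ^ 2 / 8 ≤ e) (he1 : e ≤ δ / 2) (z p G : V) (hG : 13 * ‖G‖ ^ 2 ≤ ⟪z, T z⟫) :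
    energy T (1 - 2 * τ) (z + e • (p - δ • (T z + G))) ((1 - e) • (p - δ • (T z + G)))
      ≤ (1 + δ * M) * energy T (1 - 2 * τ) z p := by
  have he : 0 ≤ e := by nlinarith
  have hsz := hsq z
  have hk0 := hnn z
  have hup' := hup (p - δ • (T z + G))
  have hPP : ‖p - δ • (T z + G)‖ ^ 2 = ‖p‖ ^ 2 - 2 * δ * (⟪p, T z⟫ + ⟪p, G⟫)
      + δ ^ 2 * (‖T z‖ ^ 2 + 2 * ⟪T z, G⟫ + ‖G‖ ^ 2) := by
    rw [norm_sub_sq_real, norm_smul, real_inner_smul_right, inner_add_right, mul_pow,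
      Real.norm_eq_abs, sq_abs, norm_add_sq_real]
    ring
  have hm1 := two_mul_inner_le p (T z) (s := 95 / 100) (by norm_num)
  have hm2 := neg_two_mul_inner_le p (T z) (s := 95 / 100) (by norm_num)
  have hpG := neg_two_mul_inner_le p G (s := 1 / 4) (by norm_num)
  have hpG' := two_mul_inner_le p G (s := 1 / 4) (by norm_num)
  have htG1 := two_mul_inner_le (T z) G (s := 1) (by norm_num)
  have htG2 := neg_two_mul_inner_le (T z) G (s := 1) (by norm_num)
  have hpT1 := neg_two_mul_inner_le p (T z) (s := 1 / δ / 2) (by positivity)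
  have hpG1 := neg_two_mul_inner_le p G (s := 1 / δ / 2) (by positivity)
  have hy1 : ‖(1 - 2 * τ) • z + p‖ ^ 2 = (1 - 2 * τ) ^ 2 * ‖z‖ ^ 2 + 2 * (1 - 2 * τ) * ⟪z, p⟫
      + ‖p‖ ^ 2 := by
    rw [norm_add_sq_real, norm_smul, real_inner_smul_left, mul_pow, Real.norm_eq_abs, sq_abs]; ring
  have hyp := neg_two_mul_inner_le ((1 - 2 * τ) • z + p) p (s := 1) (by norm_num)
  have hyG := neg_two_mul_inner_le ((1 - 2 * τ) • z + p) G (s := 3 / 10) (by norm_num)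
  rw [inner_add_left, real_inner_smul_left, hy1] at hyG
  rw [inner_add_left, real_inner_smul_left, real_inner_self_eq_norm_sq, hy1] at hyp
  rw [energy_step hT, energy, hy1, hPP]
  have e1 : ⟪p - δ • (T z + G), T z⟫ = ⟪p, T z⟫ - δ * ‖T z‖ ^ 2 - δ * ⟪T z, G⟫ := by
    rw [inner_sub_left, real_inner_smul_left, inner_add_left, real_inner_self_eq_norm_sq,
      real_inner_comm]; rw [real_inner_comm G]; ring
  have e2 : ⟪z, p - δ • (T z + G)⟫ = ⟪z, p⟫ - δ * ⟪z, T z⟫ - δ * ⟪z, G⟫ := by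
    rw [inner_sub_right, real_inner_smul_right, inner_add_right]; ring
  rw [e1, e2]
  rw [hPP] at hup'
  have hP0 : 0 ≤ ‖p‖ ^ 2 := by positivity
  have hK0 : 0 ≤ ‖T z‖ ^ 2 := by positivity
  have hGG0 : 0 ≤ ‖G‖ ^ 2 := by positivity
  have hY0 : 0 ≤ ‖(1 - 2 * τ) • z + p‖ ^ 2 := by positivity
  rw [hy1] at hY0
  norm_num at hm1 hm2 hpG hpG' htG1 htG2 hyp hyG
  generalize ⟪p - δ • (T z + G), T (p - δ • (T z + G))⟫ = W at *
  generalize ‖z‖ ^ 2 = Z at *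
  generalize ‖p‖ ^ 2 = P at *
  generalize ‖T z‖ ^ 2 = K2 at *
  generalize ‖G‖ ^ 2 = GG at *
  generalize ⟪z, T z⟫ = k at *
  generalize ⟪p, T z⟫ = m at *
  generalize ⟪p, G⟫ = pG at *
  generalize ⟪z, G⟫ = zG at *
  generalize ⟪T z, G⟫ = tG at *
  generalize ⟪z, p⟫ = C at *
  clear hnn hup hsq hT e1 e2 hPP hy1
  obtain ⟨c, hc⟩ : ∃ c, c = 1 - e * (2 - (1 - 2 * τ))
      + e ^ 2 * (1 - (1 - 2 * τ) + (1 - 2 * τ) ^ 2 / 2) := ⟨_, rfl⟩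
  obtain ⟨hc_up, hc_low⟩ := half_kinetic_coeff_bounds hτ0 hτ1 hδ0 hδ1 he0 he1 hc
  rw [← hc]
  obtain ⟨Y, hYd⟩ : ∃ Y, Y = (1 - 2 * τ) ^ 2 * Z + 2 * (1 - 2 * τ) * C + P := ⟨_, rfl⟩
  rw [← hYd] at hY0 hyp hyG ⊢
  have hτe : 0 ≤ τ * e := mul_nonneg hτ0.le he
  have hc1 : c ≤ 1 := by linarith
  have hδδ : δ ^ 2 ≤ 1 / 15 * δ := by
    have := mul_le_mul_of_nonneg_right hδ1 hδ0.le
    linarith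
  have hK2k : δ * K2 ≤ k / 55 := by
    have h1 := mul_le_mul_of_nonneg_left hsz hδ0.le
    have h2 := mul_le_mul_of_nonneg_right hδΛ hk0
    linarith
  have hPPb : P - 2 * δ * (m + pG) + δ ^ 2 * (K2 + 2 * tG + GG)
      ≤ 2 * P + 4 * δ ^ 2 * (K2 + GG) := by
    have a1 := mul_le_mul_of_nonneg_left hpT1 hδ0.le
    have a2 := mul_le_mul_of_nonneg_left hpG1 hδ0.le
    have a3 := mul_le_mul_of_nonneg_left htG1 (sq_nonneg δ)
    have b1 : δ * (1 / δ / 2 * P + (1 / δ / 2)⁻¹ * K2) = P / 2 + 2 * δ ^ 2 * K2 := by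
      field_simp
    have b2 : δ * (1 / δ / 2 * P + (1 / δ / 2)⁻¹ * GG) = P / 2 + 2 * δ ^ 2 * GG := by
      field_simp
    rw [b1] at a1
    rw [b2] at a2
    linarith
  have hWb : e ^ 2 * W ≤ δ / 220 * (2 * P + 4 * δ ^ 2 * (K2 + GG)) := by
    have a0 : 0 ≤ 2 * P + 4 * δ ^ 2 * (K2 + GG) := by positivity
    have hΛe : e ^ 2 * Λ ≤ δ / 220 := by
      have h1 : e ^ 2 ≤ (δ / 2) ^ 2 := pow_le_pow_left₀ he he1 2
      have h2 := mul_le_mul_of_nonneg_right h1 hΛ.le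
      have h3 := mul_le_mul_of_nonneg_left hδΛ hδ0.le
      linarith
    calc e ^ 2 * W ≤ e ^ 2 * (Λ * (2 * P + 4 * δ ^ 2 * (K2 + GG))) := by
          apply mul_le_mul_of_nonneg_left _ (sq_nonneg e)
          exact hup'.trans (mul_le_mul_of_nonneg_left hPPb hΛ.le)
      _ = e ^ 2 * Λ * (2 * P + 4 * δ ^ 2 * (K2 + GG)) := by ring
      _ ≤ _ := mul_le_mul_of_nonneg_right hΛe a0
  have hδc := mul_le_mul_of_nonneg_left hc_low hδ0.le
  have hδc1 := mul_le_mul_of_nonneg_left hc1 hδ0.le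
  have hd1 : |e - δ * c| ≤ 51 / 100 * δ := abs_le.2 ⟨by linarith, by linarith⟩
  have hmb : 2 * (e - δ * c) * m ≤ 51 / 100 * δ * (95 / 100 * P + 100 / 95 * K2) :=
    two_mul_mul_le_of_abs_le hd1 (by linarith) (by linarith)
  have hpGb : 2 * (-(δ * c)) * pG ≤ δ * (1 / 4 * P + 4 * GG) := by
    apply two_mul_mul_le_of_abs_le _ hpG' hpG
    have h0 : 0 ≤ δ * c := mul_nonneg hδ0.le (by linarith)
    rw [abs_neg, abs_of_nonneg h0]
    linarith
  have htGb : 2 * (δ * (δ * c - e)) * tG ≤ 51 / 100 * δ ^ 2 * (K2 + GG) := by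
    apply two_mul_mul_le_of_abs_le _ htG1 htG2
    rw [abs_mul, abs_of_pos hδ0, abs_sub_comm]
    have := mul_le_mul_of_nonneg_left hd1 hδ0.le
    linarith
  exact energy_kick_flight_real hM hτ0 hτ1 hδ0 hδ1 he he0 he1 hc_up hP0 hK0 hGG0 hk0
    (hsz.trans (mul_le_mul_of_nonneg_right hΛM hk0)) hK2k hG hYd hY0 (by linarith) (by linarith)
    hWb hmb hpGb htGb

end EnergyGrowth

end KineticLangevin
end

/-! ### Spectral bounds for K, the split gradient, and the scaled differences. -/

noncomputable section

namespace KineticLangevin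

open scoped RealInnerProductSpace

namespace Data

variable {d : ℕ} {S : Data d} {U G : E d → ℝ}

/-- The operator `γ⁻² K`. -/
def T (S : Data d) : E d →ₗ[ℝ] E d := S.γ⁻¹ ^ 2 • Matrix.toEuclideanLin S.K

lemma T_apply (S : Data d) (x : E d) : S.T x = S.γ⁻¹ ^ 2 • act S.K x := rfl

lemma IsPotential.act_symmetric (hU : S.IsPotential U G) :
    (Matrix.toEuclideanLin S.K).IsSymmetric :=
  Matrix.isSymmetric_toEuclideanLin_iff.2 hU.posDef.isHermitian

/-- Subtracting κ from K shifts the spectrum by -κ, so the difference is positive semidefinite. -/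
lemma IsPotential.kappa_le_inner (hU : S.IsPotential U G) (x : E d) :
    S.κ * ‖x‖ ^ 2 ≤ ⟪x, act S.K x⟫ := by
  have hA : (S.K - algebraMap ℝ _ S.κ).IsHermitian := by
    refine hU.posDef.isHermitian.sub ?_
    rw [Matrix.IsHermitian, Matrix.algebraMap_eq_diagonal, Matrix.diagonal_conjTranspose]
    simp
  have hpos : (S.K - algebraMap ℝ _ S.κ).PosSemidef := by
    rw [hA.posSemidef_iff_eigenvalues_nonneg]
    intro i
    have h := hA.eigenvalues_mem_spectrum_real i
    rw [← spectrum.sub_singleton_eq] at h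
    obtain ⟨y, hy, w, hw, hyw⟩ := h
    have := hU.smallest_eigenvalue.2 hy
    rw [Set.mem_singleton_iff] at hw
    simp only [Pi.zero_apply]
    linarith
  have h := (Matrix.isPositive_toEuclideanLin_iff.2 hpos).2 x
  rw [map_sub, LinearMap.sub_apply, inner_sub_left, map_sub] at h
  have h2 : Matrix.toEuclideanLin (algebraMap ℝ (Matrix (Fin d) (Fin d) ℝ) S.κ) x = S.κ • x := by
    ext i
    simp [Matrix.algebraMap_eq_diagonal, Matrix.toLpLin_apply, Matrix.mulVec_diagonal]
  rw [h2] at h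
  simp only [RCLike.re_to_real, real_inner_smul_left, real_inner_self_eq_norm_sq] at h
  rw [real_inner_comm]
  simpa [act] using h

lemma IsPotential.act_norm_le (hU : S.IsPotential U G) (x : E d) :
    ‖act S.K x‖ ≤ S.LK * ‖x‖ := by
  simpa [act] using hU.K_lipschitz x 0

/-- In dimension zero every matrix is a unit and has empty spectrum, so an eigenvalue forces d ≥ 1.
-/
lemma IsPotential.exists_norm_eq (hU : S.IsPotential U G) (r : ℝ) (hr : 0 ≤ r) :
    ∃ x : E d, ‖x‖ = r := by
  have hd : Nonempty (Fin d) := by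
    by_contra h
    rw [not_nonempty_iff] at h
    have := hU.smallest_eigenvalue.1
    rw [spectrum.mem_iff] at this
    exact this (isUnit_of_subsingleton _)
  obtain ⟨i⟩ := hd
  exact ⟨EuclideanSpace.single i r, by simp [abs_of_nonneg hr]⟩

lemma IsPotential.kappa_le_LK (hU : S.IsPotential U G) : S.κ ≤ S.LK := by
  obtain ⟨x, hx⟩ := hU.exists_norm_eq 1 zero_le_one
  have h1 := hU.kappa_le_inner x
  have h2 := real_inner_le_norm x (act S.K x)
  have h3 := hU.act_norm_le x
  rw [hx] at h1 h2 h3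
  linarith

lemma IsPotential.LK_pos (hU : S.IsPotential U G) : 0 < S.LK :=
  hU.kappa_pos.trans_le hU.kappa_le_LK

/-- Strong convexity at distance R + 1 forces two distinct gradients. -/
lemma IsPotential.L_pos (hU : S.IsPotential U G) : 0 < S.L := by
  obtain ⟨x, hx⟩ := hU.exists_norm_eq (S.R + 1) (by linarith [hU.R_nonneg])
  have hR := hU.R_nonneg
  have h1 := hU.strongly_convex x 0 (by rw [sub_zero, hx]; linarith)
  have h2 := real_inner_le_norm (gradient U x - gradient U 0) (x - 0)
  have h3 := hU.lipschitz x 0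
  rw [sub_zero, hx] at h1 h2 h3
  have h4 := hU.kappa_pos
  have h5 : 0 < S.κ * (S.R + 1) ^ 2 := by positivity
  have h6 := mul_le_mul_of_nonneg_right h3 (by linarith : 0 ≤ S.R + 1)
  by_contra hL
  push Not at hL
  have : S.L * (S.R + 1) * (S.R + 1) ≤ 0 :=
    mul_nonpos_of_nonpos_of_nonneg (mul_nonpos_of_nonpos_of_nonneg hL (by linarith)) (by linarith)
  linarith

lemma IsPotential.LG_nonneg (hU : S.IsPotential U G) : 0 ≤ S.LG := by
  obtain ⟨x, hx⟩ := hU.exists_norm_eq 1 zero_le_one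
  have h3 := hU.G_lipschitz x 0
  rw [sub_zero, hx] at h3
  linarith [norm_nonneg (gradient G x - gradient G 0)]

lemma IsPotential.hasGradientAt_quadratic (hU : S.IsPotential U G) (x : E d) :
    HasGradientAt (fun x : E d => (1 / 2) * ⟪x, act S.K x⟫) (act S.K x) x := by
  rw [hasGradientAt_iff_hasFDerivAt]
  have h0 : HasFDerivAt (fun y : E d => act S.K y)
      (Matrix.toEuclideanLin S.K).toContinuousLinearMap x :=
    (Matrix.toEuclideanLin S.K).toContinuousLinearMap.hasFDerivAt
  have h := ((hasFDerivAt_id x).inner ℝ h0).const_mul (1 / 2)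
  refine h.congr_fderiv ?_
  ext y
  have h1 : ⟪x, act S.K y⟫ = ⟪y, act S.K x⟫ := by
    rw [← show ⟪act S.K x, y⟫ = ⟪x, act S.K y⟫ from hU.act_symmetric x y, real_inner_comm]
  have h2 : ⟪act S.K x, y⟫ = ⟪y, act S.K x⟫ := real_inner_comm _ _
  simp [fderivInnerCLM_apply]
  change 2⁻¹ * (⟪x, act S.K y⟫ + ⟪y, act S.K x⟫) = ⟪act S.K x, y⟫
  rw [h1, h2]; ring

/-- G is differentiable as the difference of U and the quadratic part. -/
lemma IsPotential.gradient_eq (hU : S.IsPotential U G) (x : E d) :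
    gradient U x = act S.K x + gradient G x := by
  have hG : G = fun x => U x - (1 / 2) * ⟪x, act S.K x⟫ := by
    ext y; rw [hU.splitting y]; ring
  have h1 := (hU.differentiable x).hasGradientAt
  have h2 : HasGradientAt G (gradient U x - act S.K x) x := by
    rw [hG]
    have h3 := hU.hasGradientAt_quadratic x
    rw [hasGradientAt_iff_hasFDerivAt] at *
    rw [map_sub]
    exact h1.sub h3
  rw [h2.gradient]; abel

lemma IsPotential.continuous_gradient (hU : S.IsPotential U G) : Continuous (gradient U) := by
  have hL := hU.L_pos
  refine (LipschitzWith.of_dist_le_mul (K := S.L.toNNReal) fun x y => ?_).continuous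
  rw [dist_eq_norm, dist_eq_norm, Real.coe_toNNReal _ hL.le]
  exact hU.lipschitz x y

/-! ### Scaled constants -/

/-- The convexity constant in units of the friction. -/
def κs (S : Data d) : ℝ := S.γ⁻¹ ^ 2 * S.κ

/-- The Lipschitz constant of `T`. -/
def Λ (S : Data d) : ℝ := S.γ⁻¹ ^ 2 * S.LK

lemma κs_pos (hU : S.IsPotential U G) (hγ : 0 < S.γ) : 0 < S.κs := by
  have := hU.kappa_pos
  unfold κs; positivity

lemma Λ_pos (hU : S.IsPotential U G) (hγ : 0 < S.γ) : 0 < S.Λ := by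
  have := hU.LK_pos
  unfold Λ; positivity

lemma τ_pos (hU : S.IsPotential U G) (hγ : 0 < S.γ) : 0 < S.τ := by
  have := hU.kappa_pos
  unfold τ; positivity

lemma τ_le (S : Data d) : S.τ ≤ 1 / 8 := min_le_left _ _

lemma τ_le' (S : Data d) : S.τ ≤ S.κs / 4 := min_le_right _ _

lemma α_pos (hU : S.IsPotential U G) (hγ : 0 < S.γ) : 0 < S.α := by
  have := hU.L_pos
  unfold α; positivity

lemma T_symmetric (hU : S.IsPotential U G) : S.T.IsSymmetric := by
  intro x y
  have := hU.act_symmetric x y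
  simp only [T_apply, real_inner_smul_left, real_inner_smul_right]
  rw [show ⟪act S.K x, y⟫ = ⟪x, act S.K y⟫ from this]

lemma κs_le_inner (hU : S.IsPotential U G) (x : E d) : S.κs * ‖x‖ ^ 2 ≤ ⟪x, S.T x⟫ := by
  rw [T_apply, real_inner_smul_right, κs, mul_assoc]
  exact mul_le_mul_of_nonneg_left (hU.kappa_le_inner x) (by positivity)

lemma inner_T_nonneg (hU : S.IsPotential U G) (x : E d) : 0 ≤ ⟪x, S.T x⟫ := by
  refine le_trans ?_ (κs_le_inner hU x)
  have := hU.kappa_pos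
  unfold κs; positivity

lemma inner_T_le (hU : S.IsPotential U G) (x : E d) : ⟪x, S.T x⟫ ≤ S.Λ * ‖x‖ ^ 2 := by
  rw [T_apply, real_inner_smul_right, Λ, mul_assoc]
  refine mul_le_mul_of_nonneg_left ?_ (by positivity)
  have h2 := real_inner_le_norm x (act S.K x)
  have h3 := mul_le_mul_of_nonneg_left (hU.act_norm_le x) (norm_nonneg x)
  linarith

/-- Cocoercivity: expand ⟪y, T y⟫ ≥ 0 at y = x - Λ⁻¹ T x and bound the quadratic term by ⟪T x, T(T
x)⟫ ≤ Λ‖T x‖². -/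
lemma norm_T_sq_le (hU : S.IsPotential U G) (hγ : 0 < S.γ) (x : E d) :
    ‖S.T x‖ ^ 2 ≤ S.Λ * ⟪x, S.T x⟫ := by
  have hΛ := Λ_pos hU hγ
  have h1 := inner_T_nonneg hU (x - S.Λ⁻¹ • S.T x)
  have h2 := inner_T_le hU (S.T x)
  have h3 : ⟪x, S.T (S.T x)⟫ = ‖S.T x‖ ^ 2 := by
    rw [← T_symmetric hU, real_inner_self_eq_norm_sq]
  simp only [map_sub, map_smul, inner_sub_left, inner_sub_right, real_inner_smul_left,
    real_inner_smul_right, h3, real_inner_self_eq_norm_sq] at h1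
  have h4 : S.Λ⁻¹ * (S.Λ⁻¹ * ⟪S.T x, S.T (S.T x)⟫) ≤ S.Λ⁻¹ * ‖S.T x‖ ^ 2 := by
    have := mul_le_mul_of_nonneg_left h2 (by positivity : 0 ≤ S.Λ⁻¹ * S.Λ⁻¹)
    have e : S.Λ⁻¹ * S.Λ⁻¹ * (S.Λ * ‖S.T x‖ ^ 2) = S.Λ⁻¹ * ‖S.T x‖ ^ 2 := by field_simp
    linarith
  have h5 : S.Λ⁻¹ * ‖S.T x‖ ^ 2 ≤ ⟪x, S.T x⟫ := by linarith
  have h6 := mul_le_mul_of_nonneg_left h5 hΛ.le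
  rwa [← mul_assoc, mul_inv_cancel₀ hΛ.ne', one_mul] at h6

/-! ### Scaled differences -/

/-- The position difference. -/
def dz (a b : Phase d) : E d := a.1 - b.1

/-- The velocity difference in units of the friction. -/
def dp (S : Data d) (a b : Phase d) : E d := S.γ⁻¹ • (a.2 - b.2)

lemma rl_eq (S : Data d) (a b : Phase d) :
    S.rl a b = √(energy S.T (1 - 2 * S.τ) (dz a b) (S.dp a b)) := by
  rw [rl, energy, T_apply, real_inner_smul_right, dz, dp, norm_smul, mul_pow, Real.norm_eq_abs,
    sq_abs, mul_assoc (1 / 2) (S.γ⁻¹ ^ 2)]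

lemma rs_eq (S : Data d) (a b : Phase d) :
    S.rs a b = S.α * ‖dz a b‖ + ‖dz a b + S.dp a b‖ := rfl

lemma energy_nonneg (hU : S.IsPotential U G) (b : ℝ) (z p : E d) : 0 ≤ energy S.T b z p := by
  have := inner_T_nonneg hU z
  unfold energy; positivity

lemma rl_sq (hU : S.IsPotential U G) (a b : Phase d) :
    S.rl a b ^ 2 = energy S.T (1 - 2 * S.τ) (dz a b) (S.dp a b) := by
  rw [rl_eq, Real.sq_sqrt (energy_nonneg hU _ _ _)]

lemma rl_nonneg (S : Data d) (a b : Phase d) : 0 ≤ S.rl a b := Real.sqrt_nonneg _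

lemma rs_nonneg (hU : S.IsPotential U G) (hγ : 0 < S.γ) (a b : Phase d) : 0 ≤ S.rs a b := by
  have := α_pos hU hγ
  unfold rs; positivity

end Data

end KineticLangevin
end

/-! ### Comparison of `rs`, `rl` and the Euclidean distance. -/

noncomputable section

namespace KineticLangevin

open scoped RealInnerProductSpace

namespace Data

variable {d : ℕ} {S : Data d} {U G : E d → ℝ}

lemma ε_pos (hU : S.IsPotential U G) (hγ : 0 < S.γ) : 0 < S.ε := by
  have h1 := α_pos hU hγ
  have h2 := hU.LK_pos
  unfold ε; positivity

lemma ε_le_half (S : Data d) : S.ε ≤ 1 / 2 := by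
  have : min 1 (min (2 * S.α / (3 * √S.LK * S.γ⁻¹)) S.α) ≤ 1 := min_le_left _ _
  unfold ε; linarith

lemma ε_le_α (S : Data d) : S.ε ≤ S.α / 2 := by
  have : min 1 (min (2 * S.α / (3 * √S.LK * S.γ⁻¹)) S.α) ≤ S.α :=
    (min_le_right _ _).trans (min_le_right _ _)
  unfold ε; linarith

lemma ε_sq_mul_Λ_le (hU : S.IsPotential U G) (hγ : 0 < S.γ) :
    S.ε ^ 2 * S.Λ ≤ S.α ^ 2 / 9 := by
  have h1 : S.ε ≤ S.α / (3 * √S.LK * S.γ⁻¹) := by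
    have : min 1 (min (2 * S.α / (3 * √S.LK * S.γ⁻¹)) S.α) ≤ 2 * S.α / (3 * √S.LK * S.γ⁻¹) :=
      (min_le_right _ _).trans (min_le_left _ _)
    unfold ε
    calc _ ≤ 1 / 2 * (2 * S.α / (3 * √S.LK * S.γ⁻¹)) := by linarith
      _ = _ := by ring
  have hLK := hU.LK_pos
  have h0 := (ε_pos hU hγ).le
  rw [le_div_iff₀ (by positivity)] at h1
  have h2 := pow_le_pow_left₀ (by positivity) h1 2
  have h3 : (S.ε * (3 * √S.LK * S.γ⁻¹)) ^ 2 = 9 * (S.ε ^ 2 * S.Λ) := by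
    rw [Λ, mul_pow, mul_pow, mul_pow, Real.sq_sqrt hLK.le]; ring
  linarith

/-- This dictates ε: after expanding the energy in ‖z‖ and ‖z + p‖, the bound with √L_K controls the
part of T, and the bounds by 1 and α control the rest. It makes `Δ` comparable to `rs`. -/
lemma ε_mul_rl_le (hU : S.IsPotential U G) (hγ : 0 < S.γ) (a b : Phase d) :
    S.ε * S.rl a b ≤ S.rs a b / 2 := by
  have hε := (ε_pos hU hγ).le
  have hα := (α_pos hU hγ).le
  refine le_of_sq_le_sq ?_ (by linarith [rs_nonneg hU hγ a b])
  rw [mul_pow, rl_sq hU, rs_eq, energy]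
  set z := dz a b
  set p := S.dp a b
  have hT := inner_T_le hU z
  have h1 : ‖(1 - 2 * S.τ) • z + p‖ ≤ ‖z + p‖ + 1 / 4 * ‖z‖ := by
    have e : (1 - 2 * S.τ) • z + p = (z + p) - (2 * S.τ) • z := by module
    rw [e]
    refine (norm_sub_le _ _).trans ?_
    rw [norm_smul, Real.norm_eq_abs, abs_of_pos (by linarith [τ_pos hU hγ])]
    have := mul_le_mul_of_nonneg_right (by linarith [S.τ_le] : 2 * S.τ ≤ 1 / 4) (norm_nonneg z)
    linarith
  have h2 : ‖p‖ ≤ ‖z + p‖ + ‖z‖ := by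
    have e : p = (z + p) - z := by module
    calc ‖p‖ = ‖(z + p) - z‖ := by rw [← e]
      _ ≤ _ := norm_sub_le _ _
  have h3 := pow_le_pow_left₀ (norm_nonneg _) h1 2
  have h4 := pow_le_pow_left₀ (norm_nonneg _) h2 2
  have hz := norm_nonneg z
  have hq := norm_nonneg (z + p)
  generalize ‖z‖ = x at *
  generalize ‖z + p‖ = q at *
  generalize ⟪z, S.T z⟫ = k at *
  generalize ‖(1 - 2 * S.τ) • z + p‖ ^ 2 = A at *
  generalize ‖p‖ ^ 2 = B at *
  have e1 := ε_sq_mul_Λ_le hU hγ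
  have e2 : S.ε ^ 2 ≤ 1 / 4 := by
    have := pow_le_pow_left₀ hε S.ε_le_half 2
    linarith
  have e3 : S.ε ^ 2 ≤ S.α ^ 2 / 4 := by
    have := pow_le_pow_left₀ hε S.ε_le_α 2
    linarith
  have e4 : S.ε ^ 2 ≤ S.α / 4 := by
    have := mul_le_mul S.ε_le_half S.ε_le_α hε (by norm_num)
    nlinarith
  calc S.ε ^ 2 * (k + 1 / 2 * A + 1 / 2 * B)
      ≤ S.ε ^ 2 * (S.Λ * x ^ 2 + (q ^ 2 + 5 / 4 * (q * x) + 17 / 32 * x ^ 2)) :=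
        mul_le_mul_of_nonneg_left (by linarith) (sq_nonneg _)
    _ = S.ε ^ 2 * S.Λ * x ^ 2 + S.ε ^ 2 * q ^ 2 + S.ε ^ 2 * (5 / 4 * (q * x))
        + S.ε ^ 2 * (17 / 32 * x ^ 2) := by ring
    _ ≤ S.α ^ 2 / 9 * x ^ 2 + 1 / 4 * q ^ 2 + S.α / 4 * (5 / 4 * (q * x))
        + S.α ^ 2 / 4 * (17 / 32 * x ^ 2) := by gcongr
    _ ≤ ((S.α * x + q) / 2) ^ 2 := by
        have : 0 ≤ S.α * (q * x) := by positivity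
        have : 0 ≤ S.α ^ 2 * x ^ 2 := by positivity
        linarith

lemma rs_half_le_Δ (hU : S.IsPotential U G) (hγ : 0 < S.γ) (a b : Phase d) :
    S.rs a b / 2 ≤ S.Δ a b := by
  have := ε_mul_rl_le hU hγ a b
  unfold Δ; linarith

lemma Δ_le_rs (hU : S.IsPotential U G) (hγ : 0 < S.γ) (a b : Phase d) : S.Δ a b ≤ S.rs a b := by
  have := mul_nonneg (ε_pos hU hγ).le (S.rl_nonneg a b)
  unfold Δ; linarith

lemma calE_nonneg (hU : S.IsPotential U G) (hγ : 0 < S.γ) : 0 < S.calE := by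
  have h1 := α_pos hU hγ
  have h2 := hU.kappa_pos
  unfold calE; positivity

/-- With a = z + p, the two kinetic terms are ½‖a - 2τz‖² and ½‖a - z‖². Completing the square
leaves ½‖a‖² - 2τ‖z‖², and 2τ ≤ κs/2 is paid by T. -/
lemma energy_lower (hU : S.IsPotential U G) (z p : E d) :
    S.κs * ‖z‖ ^ 2 / 4 + ‖z + p‖ ^ 2 / 2 ≤ energy S.T (1 - 2 * S.τ) z p := by
  have hT := κs_le_inner hU z
  have h0 : 0 ≤ ‖(z + p) - (1 + 2 * S.τ) • z‖ ^ 2 := by positivity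
  rw [energy]
  have e1 : (1 - 2 * S.τ) • z + p = (z + p) - (2 * S.τ) • z := by module
  have e2 : ‖p‖ ^ 2 = ‖(z + p) - z‖ ^ 2 := by congr 2; module
  rw [e1, e2]
  rw [norm_sub_sq_real, norm_smul, real_inner_smul_right, mul_pow, Real.norm_eq_abs, sq_abs] at *
  rw [norm_sub_sq_real]
  have := mul_le_mul_of_nonneg_right S.τ_le' (sq_nonneg ‖z‖)
  have : 0 ≤ S.κs * ‖z‖ ^ 2 := by
    have := hU.kappa_pos
    unfold κs; positivity
  linarith

/-- Used at large distances, where the decay of `rl` has to be measured against `rs`. -/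
lemma calE_mul_rs_le (hU : S.IsPotential U G) (hγ : 0 < S.γ) (a b : Phase d) :
    S.calE * S.rs a b ≤ S.rl a b := by
  have hα := α_pos hU hγ
  have hκ := hU.kappa_pos
  refine le_of_sq_le_sq ?_ (S.rl_nonneg a b)
  rw [rl_sq hU, rs_eq]
  refine le_trans ?_ (energy_lower hU _ _)
  set x := ‖dz a b‖
  set q := ‖dz a b + S.dp a b‖
  have hx : 0 ≤ x := norm_nonneg _
  have hq : 0 ≤ q := norm_nonneg _
  have h1 : S.calE * S.α ≤ √S.κ * S.γ⁻¹ / √8 := by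
    calc S.calE * S.α ≤ √S.κ * S.γ⁻¹ / (√8 * S.α) * S.α :=
          mul_le_mul_of_nonneg_right (min_le_left _ _) hα.le
      _ = _ := by field_simp
  have h2 : S.calE ≤ 1 / 2 := min_le_right _ _
  have h3 : S.calE * (S.α * x + q) ≤ √S.κ * S.γ⁻¹ / √8 * x + 1 / 2 * q := by
    have := mul_le_mul_of_nonneg_right h1 hx
    have := mul_le_mul_of_nonneg_right h2 hq
    linarith
  have h4 := pow_le_pow_left₀ (mul_nonneg (calE_nonneg hU hγ).le (by positivity)) h3 2
  have h5 : (√S.κ * S.γ⁻¹ / √8) ^ 2 = S.κs / 8 := by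
    rw [div_pow, mul_pow, Real.sq_sqrt hκ.le, Real.sq_sqrt (by norm_num), κs]; ring
  have h6 := sq_nonneg (√S.κ * S.γ⁻¹ / √8 * x - 1 / 2 * q)
  have h7 : (√S.κ * S.γ⁻¹ / √8) ^ 2 * x ^ 2 = S.κs / 8 * x ^ 2 := by rw [h5]
  nlinarith

/-- The factor √2 here and the one in `γ_mul_rs_le` multiply to the 2 in M. -/
lemma min_mul_euclDist_le (hU : S.IsPotential U G) (hγ : 0 < S.γ) (a b : Phase d) :
    min (√(2 * S.κ)) 1 * euclDist a b ≤ √2 * S.γ * S.rl a b := by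
  have hκ := hU.kappa_pos
  have hm : 0 ≤ min (√(2 * S.κ)) 1 := by positivity
  refine le_of_sq_le_sq ?_ (mul_nonneg (by positivity) (S.rl_nonneg a b))
  rw [mul_pow, mul_pow, mul_pow, rl_sq hU, euclDist, Real.sq_sqrt (by positivity),
    Real.sq_sqrt (by norm_num), energy]
  have hT := hU.kappa_le_inner (a.1 - b.1)
  have hT2 : S.γ ^ 2 * ⟪dz a b, S.T (dz a b)⟫ = ⟪a.1 - b.1, act S.K (a.1 - b.1)⟫ := by
    rw [T_apply, real_inner_smul_right, dz]; field_simp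
  have hp : S.γ ^ 2 * ‖S.dp a b‖ ^ 2 = ‖a.2 - b.2‖ ^ 2 := by
    rw [dp, norm_smul, mul_pow, Real.norm_eq_abs, sq_abs]; field_simp
  have m1 : min (√(2 * S.κ)) 1 ^ 2 ≤ 2 * S.κ := by
    have := pow_le_pow_left₀ hm (min_le_left (√(2 * S.κ)) 1) 2
    rwa [Real.sq_sqrt (by positivity)] at this
  have m2 : min (√(2 * S.κ)) 1 ^ 2 ≤ 1 := by
    have := pow_le_pow_left₀ hm (min_le_right (√(2 * S.κ)) 1) 2
    linarith
  have h1 := mul_le_mul_of_nonneg_right m1 (sq_nonneg ‖a.1 - b.1‖)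
  have h2 := mul_le_mul_of_nonneg_right m2 (sq_nonneg ‖a.2 - b.2‖)
  have h3 : 0 ≤ S.γ ^ 2 * ‖(1 - 2 * S.τ) • dz a b + S.dp a b‖ ^ 2 := by positivity
  linarith

lemma γ_mul_rs_le (hU : S.IsPotential U G) (hγ : 0 < S.γ) (a b : Phase d) :
    S.γ * S.rs a b ≤ √2 * max (S.γ * (1 + S.α)) 1 * euclDist a b := by
  have hα := α_pos hU hγ
  set m := max (S.γ * (1 + S.α)) 1
  have hm : 0 ≤ m := le_trans zero_le_one (le_max_right _ _)
  have h1 : ‖a.1 - b.1‖ + ‖a.2 - b.2‖ ≤ √2 * euclDist a b := by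
    refine le_of_sq_le_sq ?_ (by unfold euclDist; positivity)
    rw [mul_pow, euclDist, Real.sq_sqrt (by positivity), Real.sq_sqrt (by positivity)]
    linarith [sq_nonneg (‖a.1 - b.1‖ - ‖a.2 - b.2‖)]
  have h2 : S.γ * S.rs a b ≤ m * (‖a.1 - b.1‖ + ‖a.2 - b.2‖) := by
    have h3 : ‖dz a b + S.dp a b‖ ≤ ‖a.1 - b.1‖ + S.γ⁻¹ * ‖a.2 - b.2‖ := by
      refine (norm_add_le _ _).trans ?_
      rw [dp, norm_smul, Real.norm_eq_abs, abs_of_pos (by positivity), dz]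
    have h4 := mul_le_mul_of_nonneg_left h3 hγ.le
    have h5 : S.γ * (‖a.1 - b.1‖ + S.γ⁻¹ * ‖a.2 - b.2‖) = S.γ * ‖a.1 - b.1‖ + ‖a.2 - b.2‖ := by
      field_simp
    have h6 := mul_le_mul_of_nonneg_right (le_max_left (S.γ * (1 + S.α)) 1) (norm_nonneg (a.1 - b.1))
    have h7 := mul_le_mul_of_nonneg_right (le_max_right (S.γ * (1 + S.α)) 1)
      (norm_nonneg (a.2 - b.2))
    rw [rs_eq, dz] at *
    linarith
  calc _ ≤ _ := h2
    _ ≤ m * (√2 * euclDist a b) := mul_le_mul_of_nonneg_left h1 hm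
    _ = _ := by ring

/-! ### The radii `DK` and `R₁` -/

lemma calR_nonneg (hU : S.IsPotential U G) (hγ : 0 < S.γ) : 0 ≤ S.calR := by
  have h1 := τ_pos hU hγ
  have h2 := hU.LG_nonneg
  unfold calR; positivity

lemma mem_calK_iff (S : Data d) (a b : Phase d) : a - b ∈ S.calK ↔
    S.κs * ‖dz a b‖ ^ 2 + 1 / 2 * ‖dz a b + S.dp a b‖ ^ 2 + 1 / 2 * ‖S.dp a b‖ ^ 2 ≤ S.calR := by
  rw [calK, Set.mem_ofPred_eq, κs, dz, dp, mul_comm (S.γ⁻¹ ^ 2) S.κ]; rfl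

lemma bddAbove_Δ (hU : S.IsPotential U G) (hγ : 0 < S.γ) :
    BddAbove {t | ∃ z z' : Phase d, z - z' ∈ S.calK ∧ t = S.Δ z z'} := by
  have hα := α_pos hU hγ
  have hκ := κs_pos hU hγ
  refine ⟨S.α * √(S.calR / S.κs) + √(2 * S.calR), ?_⟩
  rintro t ⟨a, b, hab, rfl⟩
  refine (Δ_le_rs hU hγ a b).trans ?_
  rw [mem_calK_iff] at hab
  rw [rs_eq]
  gcongr
  · apply Real.le_sqrt_of_sq_le
    rw [le_div_iff₀ hκ]
    linarith [sq_nonneg ‖dz a b + S.dp a b‖, sq_nonneg ‖S.dp a b‖]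
  · apply Real.le_sqrt_of_sq_le
    have : 0 ≤ S.κs * ‖dz a b‖ ^ 2 := by positivity
    linarith [sq_nonneg ‖S.dp a b‖]

lemma Δ_le_DK (hU : S.IsPotential U G) (hγ : 0 < S.γ) {a b : Phase d} (h : a - b ∈ S.calK) :
    S.Δ a b ≤ S.DK :=
  le_csSup (bddAbove_Δ hU hγ) ⟨a, b, h, rfl⟩

lemma Δ_self (S : Data d) (a : Phase d) : S.Δ a a = 0 := by
  simp [Δ, rs, rl, act]

lemma DK_nonneg (hU : S.IsPotential U G) (hγ : 0 < S.γ) : 0 ≤ S.DK := by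
  rw [← S.Δ_self 0]
  apply Δ_le_DK hU hγ
  rw [mem_calK_iff]
  simpa [dz, dp] using calR_nonneg hU hγ

/-- Since rs ≤ 2Δ, the set defining R₁ is bounded by 2 DK. Hence pairs handled by reflection lie
where the profile is curved. -/
lemma rs_le_R₁ (hU : S.IsPotential U G) (hγ : 0 < S.γ) {a b : Phase d} (h : S.Δ a b ≤ S.DK) :
    S.rs a b ≤ S.R₁ := by
  refine le_csSup ⟨2 * S.DK, ?_⟩ ⟨a, b, h, rfl⟩
  rintro t ⟨a, b, hab, rfl⟩
  linarith [rs_half_le_Δ hU hγ a b]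

lemma R₁_nonneg (hU : S.IsPotential U G) (hγ : 0 < S.γ) : 0 ≤ S.R₁ :=
  (rs_nonneg hU hγ 0 0).trans (rs_le_R₁ hU hγ (by rw [Δ_self]; exact DK_nonneg hU hγ))

/-- The minimum commutes with adding ε rl, and Δ + ε rl = rs. In this form each of the two arguments
gives an upper bound for ρ. -/
lemma ρ_eq (S : Data d) (a b : Phase d) :
    S.ρ a b = S.f (min (S.rs a b) (S.DK + S.ε * S.rl a b)) := by
  rw [ρ, ← min_add_add_right, Δ, sub_add_cancel]

end Data

end KineticLangevin
end

noncomputable section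

namespace KineticLangevin

open scoped RealInnerProductSpace

namespace Data

variable {d : ℕ} {S : Data d} {U G : E d → ℝ}

/-! ### The concave profile -/

/-- The exponent `64 α γ²` of the profile. -/
def A (S : Data d) : ℝ := 64 * S.α * S.γ ^ 2

/-- The constant `γ ĉ / 2` of the profile. -/
def B (S : Data d) : ℝ := S.cHat / 2 * S.γ

/-- The integrand of the profile. -/
def F (S : Data d) (s : ℝ) : ℝ := S.φ s * S.ψ s

lemma A_pos (hU : S.IsPotential U G) (hγ : 0 < S.γ) : 0 < S.A := by
  have := α_pos hU hγ
  unfold A; positivity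

lemma φ_eq (S : Data d) (s : ℝ) : S.φ s = Real.exp (-(S.A * (min s S.R₁) ^ 2)) := by
  rw [φ, A]; congr 2; ring

lemma φ_pos (S : Data d) (s : ℝ) : 0 < S.φ s := Real.exp_pos _

lemma φ_le_one (hU : S.IsPotential U G) (hγ : 0 < S.γ) (s : ℝ) : S.φ s ≤ 1 := by
  rw [φ_eq, Real.exp_le_one_iff]
  have := A_pos hU hγ
  have : 0 ≤ S.A * (min s S.R₁) ^ 2 := by positivity
  linarith

lemma continuous_φ (S : Data d) : Continuous S.φ := by
  unfold φ; fun_prop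

lemma φ_anti (hU : S.IsPotential U G) (hγ : 0 < S.γ) {x y : ℝ} (hx : 0 ≤ x) (hxy : x ≤ y) :
    S.φ y ≤ S.φ x := by
  rw [φ_eq, φ_eq]
  have hA := A_pos hU hγ
  have h0 : 0 ≤ min x S.R₁ := le_min hx (R₁_nonneg hU hγ)
  have h1 : min x S.R₁ ≤ min y S.R₁ := min_le_min_right _ hxy
  gcongr

lemma continuous_Φ (S : Data d) : Continuous S.Φ :=
  intervalIntegral.continuous_primitive (fun _ _ => S.continuous_φ.intervalIntegrable _ _) 0

lemma Φ_sub (S : Data d) (x y : ℝ) : S.Φ y - S.Φ x = ∫ s in x..y, S.φ s :=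
  intervalIntegral.integral_interval_sub_left (S.continuous_φ.intervalIntegrable _ _)
    (S.continuous_φ.intervalIntegrable _ _)

lemma Φ_zero (S : Data d) : S.Φ 0 = 0 := by simp [Φ]

lemma Φ_sub_le (hU : S.IsPotential U G) (hγ : 0 < S.γ) {x y : ℝ} (hx : 0 ≤ x) (hxy : x ≤ y) :
    S.Φ y - S.Φ x ≤ (y - x) * S.φ x := by
  rw [Φ_sub]
  calc ∫ s in x..y, S.φ s ≤ ∫ _ in x..y, S.φ x :=
        intervalIntegral.integral_mono_on hxy (S.continuous_φ.intervalIntegrable _ _)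
          (by simp) fun s hs => φ_anti hU hγ hx hs.1
    _ = _ := by simp

lemma le_Φ_sub (hU : S.IsPotential U G) (hγ : 0 < S.γ) {x y : ℝ} (hx : 0 ≤ x) (hxy : x ≤ y) :
    (y - x) * S.φ y ≤ S.Φ y - S.Φ x := by
  rw [Φ_sub]
  calc (y - x) * S.φ y = ∫ _ in x..y, S.φ y := by simp
    _ ≤ _ := intervalIntegral.integral_mono_on hxy (by simp)
        (S.continuous_φ.intervalIntegrable _ _) fun s hs => φ_anti hU hγ (hx.trans hs.1) hs.2

lemma Φ_mono (hU : S.IsPotential U G) (hγ : 0 < S.γ) {x y : ℝ} (hx : 0 ≤ x) (hxy : x ≤ y) :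
    S.Φ x ≤ S.Φ y := by
  have := le_Φ_sub hU hγ hx hxy
  have : 0 ≤ (y - x) * S.φ y := mul_nonneg (by linarith) (S.φ_pos y).le
  linarith

lemma le_Φ (hU : S.IsPotential U G) (hγ : 0 < S.γ) {x : ℝ} (hx : 0 ≤ x) :
    x * S.φ x ≤ S.Φ x := by
  simpa [Φ_zero] using le_Φ_sub hU hγ le_rfl hx

lemma Φ_nonneg (hU : S.IsPotential U G) (hγ : 0 < S.γ) {x : ℝ} (hx : 0 ≤ x) : 0 ≤ S.Φ x := by
  simpa [Φ_zero] using Φ_mono hU hγ le_rfl hx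

lemma Φ_le (hU : S.IsPotential U G) (hγ : 0 < S.γ) {x : ℝ} (hx : 0 ≤ x) : S.Φ x ≤ x := by
  have h1 := Φ_sub_le hU hγ le_rfl hx
  have h2 := mul_le_mul_of_nonneg_left (φ_le_one hU hγ 0) hx
  rw [Φ_zero] at h1
  linarith

/-- Φ(x)/x is nonincreasing because φ is. -/
lemma mul_Φ_le (hU : S.IsPotential U G) (hγ : 0 < S.γ) {x y : ℝ} (hx : 0 ≤ x) (hxy : x ≤ y) :
    x * S.Φ y ≤ y * S.Φ x := by
  have h1 := mul_le_mul_of_nonneg_left (Φ_sub_le hU hγ hx hxy) hx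
  have h2 := mul_le_mul_of_nonneg_left (le_Φ hU hγ hx) (by linarith : 0 ≤ y - x)
  linarith

lemma continuous_Φ_div_φ (S : Data d) : Continuous fun x => S.Φ x * (S.φ x)⁻¹ :=
  S.continuous_Φ.mul (S.continuous_φ.inv₀ fun x => (S.φ_pos x).ne')

/-- The integral `∫ Φ / φ`. -/
def J (S : Data d) (s : ℝ) : ℝ := ∫ x in (0 : ℝ)..s, S.Φ x * (S.φ x)⁻¹

lemma continuous_J (S : Data d) : Continuous S.J :=
  intervalIntegral.continuous_primitive
    (fun _ _ => S.continuous_Φ_div_φ.intervalIntegrable _ _) 0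

lemma J_sub (S : Data d) (x y : ℝ) : S.J y - S.J x = ∫ s in x..y, S.Φ s * (S.φ s)⁻¹ :=
  intervalIntegral.integral_interval_sub_left (S.continuous_Φ_div_φ.intervalIntegrable _ _)
    (S.continuous_Φ_div_φ.intervalIntegrable _ _)

lemma J_mono (hU : S.IsPotential U G) (hγ : 0 < S.γ) {x y : ℝ} (hx : 0 ≤ x) (hxy : x ≤ y) :
    S.J x ≤ S.J y := by
  have : 0 ≤ S.J y - S.J x := by
    rw [J_sub]
    apply intervalIntegral.integral_nonneg hxy
    intro s hs
    exact mul_nonneg (Φ_nonneg hU hγ (hx.trans hs.1)) (inv_nonneg.2 (S.φ_pos s).le)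
  linarith

lemma J_nonneg (hU : S.IsPotential U G) (hγ : 0 < S.γ) {x : ℝ} (hx : 0 ≤ x) : 0 ≤ S.J x := by
  have := J_mono hU hγ le_rfl hx
  simpa [J] using this

lemma J_pos (hU : S.IsPotential U G) (hγ : 0 < S.γ) (hR : 0 < S.R₁) : 0 < S.J S.R₁ := by
  apply intervalIntegral.intervalIntegral_pos_of_pos_on
    (S.continuous_Φ_div_φ.intervalIntegrable _ _) _ hR
  intro x hx
  refine mul_pos ?_ (inv_pos.2 (S.φ_pos x))
  exact (mul_pos hx.1 (S.φ_pos x)).trans_le (le_Φ hU hγ hx.1.le)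

lemma J_le (hU : S.IsPotential U G) (hγ : 0 < S.γ) {x : ℝ} (hx : 0 ≤ x) :
    S.J x * S.φ x ≤ x ^ 2 / 2 := by
  have h1 : S.J x ≤ ∫ s in (0 : ℝ)..x, s * (S.φ x)⁻¹ := by
    apply intervalIntegral.integral_mono_on hx (S.continuous_Φ_div_φ.intervalIntegrable _ _)
      ((by fun_prop : Continuous fun s : ℝ => s * (S.φ x)⁻¹).intervalIntegrable _ _)
    intro s hs
    have h2 : (S.φ s)⁻¹ ≤ (S.φ x)⁻¹ := inv_anti₀ (S.φ_pos x) (φ_anti hU hγ hs.1 hs.2)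
    exact mul_le_mul (Φ_le hU hγ hs.1) h2 (inv_nonneg.2 (S.φ_pos s).le) hs.1
  have h3 := mul_le_mul_of_nonneg_right h1 (S.φ_pos x).le
  have h4 : (∫ s in (0 : ℝ)..x, s * (S.φ x)⁻¹) * S.φ x = x ^ 2 / 2 := by
    rw [intervalIntegral.integral_mul_const, integral_id]
    have := (S.φ_pos x).ne'
    field_simp
    ring
  linarith

lemma ψ_eq (S : Data d) (s : ℝ) : S.ψ s = 1 - S.B * S.J (min s S.R₁) := rfl

/-- The normalisation of ĉ: ψ falls from 1 to exactly 1/2 at R₁, which is the source of `half_le_ψ`.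
-/
lemma B_mul_J (hU : S.IsPotential U G) (hγ : 0 < S.γ) (hR : 0 < S.R₁) :
    S.B * S.J S.R₁ = 1 / 2 := by
  have h := (J_pos hU hγ hR).ne'
  rw [B, cHat, show (∫ s in (0 : ℝ)..S.R₁, S.Φ s * (S.φ s)⁻¹) = S.J S.R₁ from rfl]
  have := hγ.ne'
  field_simp

lemma B_nonneg (hU : S.IsPotential U G) (hγ : 0 < S.γ) : 0 ≤ S.B := by
  have := J_nonneg hU hγ (R₁_nonneg hU hγ)
  rw [B, cHat, show (∫ s in (0 : ℝ)..S.R₁, S.Φ s * (S.φ s)⁻¹) = S.J S.R₁ from rfl]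
  positivity

lemma B_mul_J_le (hU : S.IsPotential U G) (hγ : 0 < S.γ) : S.B * S.J S.R₁ ≤ 1 / 2 := by
  rcases (R₁_nonneg hU hγ).eq_or_lt with h | h
  · rw [← h]; simp [J]
  · exact (B_mul_J hU hγ h).le

lemma continuous_ψ (S : Data d) : Continuous S.ψ := by
  have : S.ψ = fun s => 1 - S.B * S.J (min s S.R₁) := rfl
  rw [this]
  have := S.continuous_J
  fun_prop

lemma ψ_le_one (hU : S.IsPotential U G) (hγ : 0 < S.γ) {x : ℝ} (hx : 0 ≤ x) : S.ψ x ≤ 1 := by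
  rw [ψ_eq]
  have := mul_nonneg (B_nonneg hU hγ) (J_nonneg hU hγ (le_min hx (R₁_nonneg hU hγ)))
  linarith

lemma ψ_anti (hU : S.IsPotential U G) (hγ : 0 < S.γ) {x y : ℝ} (hx : 0 ≤ x) (hxy : x ≤ y) :
    S.ψ y ≤ S.ψ x := by
  rw [ψ_eq, ψ_eq]
  have := mul_le_mul_of_nonneg_left (J_mono hU hγ (le_min hx (R₁_nonneg hU hγ))
    (min_le_min_right S.R₁ hxy)) (B_nonneg hU hγ)
  linarith

lemma half_le_ψ (hU : S.IsPotential U G) (hγ : 0 < S.γ) {x : ℝ} (hx : 0 ≤ x) :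
    1 / 2 ≤ S.ψ x := by
  rw [ψ_eq]
  have := mul_le_mul_of_nonneg_left (J_mono hU hγ (le_min hx (R₁_nonneg hU hγ))
    (min_le_right x S.R₁)) (B_nonneg hU hγ)
  linarith [B_mul_J_le hU hγ]

lemma continuous_F (S : Data d) : Continuous S.F := S.continuous_φ.mul S.continuous_ψ

lemma F_anti (hU : S.IsPotential U G) (hγ : 0 < S.γ) {x y : ℝ} (hx : 0 ≤ x) (hxy : x ≤ y) :
    S.F y ≤ S.F x :=
  mul_le_mul (φ_anti hU hγ hx hxy) (ψ_anti hU hγ hx hxy)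
    (by linarith [half_le_ψ hU hγ (hx.trans hxy)]) (S.φ_pos x).le

lemma F_pos (hU : S.IsPotential U G) (hγ : 0 < S.γ) {x : ℝ} (hx : 0 ≤ x) : 0 < S.F x :=
  mul_pos (S.φ_pos x) (by linarith [half_le_ψ hU hγ hx])

lemma F_le_φ (hU : S.IsPotential U G) (hγ : 0 < S.γ) {x : ℝ} (hx : 0 ≤ x) : S.F x ≤ S.φ x := by
  have := mul_le_mul_of_nonneg_left (ψ_le_one hU hγ hx) (S.φ_pos x).le
  unfold F; linarith

lemma half_φ_le_F (hU : S.IsPotential U G) (hγ : 0 < S.γ) {x : ℝ} (hx : 0 ≤ x) :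
    S.φ x / 2 ≤ S.F x := by
  have := mul_le_mul_of_nonneg_left (half_le_ψ hU hγ hx) (S.φ_pos x).le
  unfold F; linarith

lemma F_le_one (hU : S.IsPotential U G) (hγ : 0 < S.γ) {x : ℝ} (hx : 0 ≤ x) : S.F x ≤ 1 :=
  (F_le_φ hU hγ hx).trans (φ_le_one hU hγ x)

/-- Beyond R₁ the profile is affine, so `fPrime` is its smallest slope on the half line. -/
lemma F_of_le (S : Data d) {x : ℝ} (hx : S.R₁ ≤ x) : S.F x = S.F S.R₁ := by
  rw [F, F, φ_eq, φ_eq, ψ_eq, ψ_eq, min_eq_right hx, min_self]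

lemma f_sub (S : Data d) (x y : ℝ) : S.f y - S.f x = ∫ s in x..y, S.F s :=
  intervalIntegral.integral_interval_sub_left (S.continuous_F.intervalIntegrable _ _)
    (S.continuous_F.intervalIntegrable _ _)

lemma fPrime_eq (S : Data d) : S.fPrime = S.F S.R₁ :=
  (intervalIntegral.integral_hasDerivAt_right (S.continuous_F.intervalIntegrable 0 S.R₁)
    S.continuous_F.stronglyMeasurable.stronglyMeasurableAtFilter
    S.continuous_F.continuousAt).deriv

lemma continuous_f (S : Data d) : Continuous S.f :=
  intervalIntegral.continuous_primitive (fun _ _ => S.continuous_F.intervalIntegrable _ _) 0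

lemma f_zero (S : Data d) : S.f 0 = 0 := by simp [f]

lemma fPrime_pos (hU : S.IsPotential U G) (hγ : 0 < S.γ) : 0 < S.fPrime := by
  rw [fPrime_eq]; exact F_pos hU hγ (R₁_nonneg hU hγ)

lemma fPrime_le_F (hU : S.IsPotential U G) (hγ : 0 < S.γ) {x : ℝ} (hx : 0 ≤ x) :
    S.fPrime ≤ S.F x := by
  rw [fPrime_eq]
  rcases le_total x S.R₁ with h | h
  · exact F_anti hU hγ hx h
  · rw [F_of_le S h]

lemma fPrime_mul_sub_le (hU : S.IsPotential U G) (hγ : 0 < S.γ) {x y : ℝ} (hx : 0 ≤ x)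
    (hxy : x ≤ y) : S.fPrime * (y - x) ≤ S.f y - S.f x := by
  rw [f_sub]
  calc S.fPrime * (y - x) = ∫ _ in x..y, S.fPrime := by simp [mul_comm]
    _ ≤ _ := intervalIntegral.integral_mono_on hxy (by simp)
        (S.continuous_F.intervalIntegrable _ _) fun s hs => fPrime_le_F hU hγ (hx.trans hs.1)

lemma f_mono (hU : S.IsPotential U G) (hγ : 0 < S.γ) {x y : ℝ} (hx : 0 ≤ x) (hxy : x ≤ y) :
    S.f x ≤ S.f y := by
  have := fPrime_mul_sub_le hU hγ hx hxy
  have : 0 ≤ S.fPrime * (y - x) := mul_nonneg (fPrime_pos hU hγ).le (by linarith)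
  linarith

lemma f_nonneg (hU : S.IsPotential U G) (hγ : 0 < S.γ) {x : ℝ} (hx : 0 ≤ x) : 0 ≤ S.f x := by
  rw [← S.f_zero]; exact f_mono hU hγ le_rfl hx

lemma f_le_Φ (hU : S.IsPotential U G) (hγ : 0 < S.γ) {x : ℝ} (hx : 0 ≤ x) : S.f x ≤ S.Φ x :=
  intervalIntegral.integral_mono_on hx (S.continuous_F.intervalIntegrable _ _)
    (S.continuous_φ.intervalIntegrable _ _) fun _ hs => F_le_φ hU hγ hs.1

lemma f_le (hU : S.IsPotential U G) (hγ : 0 < S.γ) {x : ℝ} (hx : 0 ≤ x) : S.f x ≤ x :=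
  (f_le_Φ hU hγ hx).trans (Φ_le hU hγ hx)

/-- The profile lies below its tangents. -/
lemma f_le_tangent (hU : S.IsPotential U G) (hγ : 0 < S.γ) {x y : ℝ} (hx : 0 ≤ x) (hy : 0 ≤ y) :
    S.f y ≤ S.f x + S.F x * (y - x) := by
  rcases le_total x y with h | h
  · have : ∫ s in x..y, S.F s ≤ ∫ _ in x..y, S.F x :=
      intervalIntegral.integral_mono_on h (S.continuous_F.intervalIntegrable _ _) (by simp)
        fun s hs => F_anti hU hγ hx hs.1
    rw [← f_sub, intervalIntegral.integral_const, smul_eq_mul] at this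
    linarith
  · have : ∫ _ in y..x, S.F x ≤ ∫ s in y..x, S.F s :=
      intervalIntegral.integral_mono_on h (by simp) (S.continuous_F.intervalIntegrable _ _)
        fun s hs => F_anti hU hγ (hy.trans hs.1) hs.2
    rw [← f_sub, intervalIntegral.integral_const, smul_eq_mul] at this
    linarith

lemma F_mul_le_f (hU : S.IsPotential U G) (hγ : 0 < S.γ) {x : ℝ} (hx : 0 ≤ x) :
    S.F x * x ≤ S.f x := by
  have := f_le_tangent hU hγ hx le_rfl
  rw [f_zero] at this
  linarith

/-- Concavity together with f(0) = 0. -/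
lemma f_mul_le (hU : S.IsPotential U G) (hγ : 0 < S.γ) {x l : ℝ} (hx : 0 ≤ x) (hl : 1 ≤ l) :
    S.f (l * x) ≤ l * S.f x := by
  have h1 := f_le_tangent hU hγ hx (mul_nonneg (by linarith) hx : 0 ≤ l * x)
  have h2 := mul_le_mul_of_nonneg_left (F_mul_le_f hU hγ hx) (by linarith : 0 ≤ l - 1)
  linarith

/-- The two sources of curvature. From φ: φ(x) = φ(y) exp(A(y² - x²)), and exp u ≥ 1 + u. From ψ:
ψ(x) - ψ(y) = B∫Φ/φ, where the factor φ(x) dominates φ(s) on [x, y]. -/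
lemma F_gap (hU : S.IsPotential U G) (hγ : 0 < S.γ) {x y : ℝ} (hx : 0 ≤ x) (hxy : x ≤ y)
    (hy : y ≤ S.R₁) :
    S.F y * (S.A * (y ^ 2 - x ^ 2)) + S.B * ∫ s in x..y, S.Φ s ≤ S.F x - S.F y := by
  have hB := B_nonneg hU hγ
  have h1 : S.φ y * (1 + S.A * (y ^ 2 - x ^ 2)) ≤ S.φ x := by
    have h2 : S.φ x = S.φ y * Real.exp (S.A * (y ^ 2 - x ^ 2)) := by
      rw [φ_eq, φ_eq, min_eq_left hy, min_eq_left (hxy.trans hy), ← Real.exp_add]; congr 1; ring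
    rw [h2]
    apply mul_le_mul_of_nonneg_left _ (S.φ_pos y).le
    linarith [Real.add_one_le_exp (S.A * (y ^ 2 - x ^ 2))]
  have h3 : ∫ s in x..y, S.Φ s ≤ S.φ x * (S.J y - S.J x) := by
    rw [J_sub, ← intervalIntegral.integral_const_mul]
    apply intervalIntegral.integral_mono_on hxy (S.continuous_Φ.intervalIntegrable _ _)
      ((S.continuous_Φ_div_φ.const_smul (S.φ x)).intervalIntegrable _ _)
    intro s hs
    have h5 := S.φ_pos s
    calc S.Φ s = S.φ s * (S.Φ s * (S.φ s)⁻¹) := by field_simp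
      _ ≤ S.φ x * (S.Φ s * (S.φ s)⁻¹) := mul_le_mul_of_nonneg_right (φ_anti hU hγ hx hs.1)
        (mul_nonneg (Φ_nonneg hU hγ (hx.trans hs.1)) (inv_nonneg.2 h5.le))
  have h6 := mul_le_mul_of_nonneg_left h3 hB
  have h7 : S.ψ x - S.ψ y = S.B * (S.J y - S.J x) := by
    rw [ψ_eq, ψ_eq, min_eq_left hy, min_eq_left (hxy.trans hy)]; ring
  have h8 := mul_le_mul_of_nonneg_right h1
    (by linarith [half_le_ψ hU hγ (hx.trans hxy)] : 0 ≤ S.ψ y)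
  have h9 : S.φ x * (S.ψ x - S.ψ y) = S.B * (S.φ x * (S.J y - S.J x)) := by rw [h7]; ring
  unfold F
  linarith

/-- A downward jump gains from concavity. -/
lemma f_sub_le (hU : S.IsPotential U G) (hγ : 0 < S.γ) {r t : ℝ} (ht : 0 ≤ t) (htr : t ≤ r)
    (hr : r ≤ S.R₁) :
    S.f (r - t) ≤ S.f r - S.F r * t - (2 / 3 * S.F r * S.A * r + 1 / 3 * S.B * S.Φ r) * t ^ 2 := by
  rcases (ht.trans htr).eq_or_lt with h0 | h0
  · obtain rfl : t = 0 := by linarith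
    simp
  have hB := B_nonneg hU hγ
  -- With Φ(s) ≥ Φ(r)s/r, the gap estimate becomes F(x) ≥ F(r) + D(r² - x²), which can be integrated
  -- explicitly.
  set D := S.F r * S.A + S.B * S.Φ r / (2 * r) with hD
  have hD0 : 0 ≤ D := by
    have := (A_pos hU hγ).le
    have := (F_pos hU hγ h0.le).le
    have := Φ_nonneg hU hγ h0.le
    positivity
  have h1 : ∫ x in (r - t)..r, (S.F r + D * (r ^ 2 - x ^ 2)) ≤ ∫ x in (r - t)..r, S.F x := by
    apply intervalIntegral.integral_mono_on (by linarith)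
      ((by fun_prop : Continuous fun x : ℝ => S.F r + D * (r ^ 2 - x ^ 2)).intervalIntegrable _ _)
      (S.continuous_F.intervalIntegrable _ _)
    intro x hx
    have hx0 : 0 ≤ x := by linarith [hx.1]
    have h2 := F_gap hU hγ hx0 hx.2 hr
    have h3 : S.Φ r / (2 * r) * (r ^ 2 - x ^ 2) ≤ ∫ s in x..r, S.Φ s := by
      calc S.Φ r / (2 * r) * (r ^ 2 - x ^ 2) = ∫ s in x..r, S.Φ r / r * s := by
            rw [intervalIntegral.integral_const_mul, integral_id]; field_simp
        _ ≤ _ := by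
          apply intervalIntegral.integral_mono_on hx.2
            ((by fun_prop : Continuous fun s : ℝ => S.Φ r / r * s).intervalIntegrable _ _)
            (S.continuous_Φ.intervalIntegrable _ _)
          intro s hs
          rw [div_mul_eq_mul_div, div_le_iff₀ h0]
          have := mul_Φ_le hU hγ (hx0.trans hs.1) hs.2
          linarith
    have h4 := mul_le_mul_of_nonneg_left h3 hB
    have h5 : D * (r ^ 2 - x ^ 2) = S.F r * (S.A * (r ^ 2 - x ^ 2))
        + S.B * (S.Φ r / (2 * r) * (r ^ 2 - x ^ 2)) := by rw [hD]; ring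
    linarith
  rw [← f_sub] at h1
  have h6 : ∫ x in (r - t)..r, (S.F r + D * (r ^ 2 - x ^ 2))
      = S.F r * t + D * (r * t ^ 2 - t ^ 3 / 3) := by
    rw [intervalIntegral.integral_add (by simp) ((by fun_prop : Continuous
      fun x : ℝ => D * (r ^ 2 - x ^ 2)).intervalIntegrable _ _),
      intervalIntegral.integral_const_mul, intervalIntegral.integral_sub (by simp)
      ((by fun_prop : Continuous fun x : ℝ => x ^ 2).intervalIntegrable _ _), integral_pow]
    simp only [intervalIntegral.integral_const, smul_eq_mul]
    push_cast
    ring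
  -- Since t ≤ r, the cubic term takes away at most a third.
  have h7 : D * (2 / 3 * r * t ^ 2) ≤ D * (r * t ^ 2 - t ^ 3 / 3) := by
    apply mul_le_mul_of_nonneg_left _ hD0
    have := mul_le_mul_of_nonneg_right htr (sq_nonneg t)
    linarith
  have h8 : D * (2 / 3 * r * t ^ 2)
      = (2 / 3 * S.F r * S.A * r + 1 / 3 * S.B * S.Φ r) * t ^ 2 := by
    rw [hD]; field_simp
  linarith

/-- An upward jump gains from concavity. -/
lemma f_add_le (hU : S.IsPotential U G) (hγ : 0 < S.γ) {r t l m : ℝ} (hr : 0 ≤ r) (hl : 0 ≤ l)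
    (hlt : l ≤ t) (hrl : r + l ≤ S.R₁) (hm : 0 ≤ m) (hm2 : ∀ y ∈ Set.Icc 0 l, m * y ≤ S.Φ y) :
    S.f (r + t) ≤ S.f r + S.F r * t - (1 / 3 * S.F (r + l) * S.A + 1 / 6 * S.B * m) * (t * l ^ 2) := by
  have hB := B_nonneg hU hγ
  have hA := (A_pos hU hγ).le
  have hF := (F_pos hU hγ (by linarith : 0 ≤ r + l)).le
  obtain ⟨D, hD⟩ : ∃ D, D = S.F (r + l) * S.A + S.B * m / 2 := ⟨_, rfl⟩
  have hD0 : 0 ≤ D := by rw [hD]; positivity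
  have key : ∀ y ∈ Set.Icc 0 l, S.F (r + y) ≤ S.F r - D * y ^ 2 := by
    intro y hy
    have h2 := F_gap hU hγ hr (by linarith [hy.1] : r ≤ r + y) (by linarith [hy.2])
    have h3 : m * y ^ 2 / 2 ≤ ∫ s in r..(r + y), S.Φ s := by
      calc m * y ^ 2 / 2 = ∫ s in r..(r + y), m * (s - r) := by
            rw [intervalIntegral.integral_const_mul, intervalIntegral.integral_comp_sub_right
              (fun x => x), integral_id]; ring
        _ ≤ _ := by
          apply intervalIntegral.integral_mono_on (by linarith [hy.1])
            ((by fun_prop : Continuous fun s : ℝ => m * (s - r)).intervalIntegrable _ _)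
            (S.continuous_Φ.intervalIntegrable _ _)
          intro s hs
          have h4 : s - r ∈ Set.Icc 0 l := ⟨by linarith [hs.1], by linarith [hs.2, hy.2]⟩
          exact (hm2 _ h4).trans (Φ_mono hU hγ h4.1 (by linarith))
    have h4 := mul_le_mul_of_nonneg_left h3 hB
    have h5 : S.F (r + l) * (S.A * y ^ 2) ≤ S.F (r + y) * (S.A * ((r + y) ^ 2 - r ^ 2)) := by
      have hy0 := hy.1
      apply mul_le_mul (F_anti hU hγ (by linarith) (by linarith [hy.2])) _ (by positivity)
        (F_pos hU hγ (by linarith)).le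
      apply mul_le_mul_of_nonneg_left _ hA
      nlinarith
    rw [hD]
    linarith
  have h1 : S.f (r + l) - S.f r ≤ S.F r * l - D * l ^ 3 / 3 := by
    rw [f_sub]
    calc ∫ s in r..(r + l), S.F s ≤ ∫ s in r..(r + l), (S.F r - D * (s - r) ^ 2) := by
          apply intervalIntegral.integral_mono_on (by linarith)
            (S.continuous_F.intervalIntegrable _ _)
            ((by fun_prop : Continuous fun s : ℝ => S.F r - D * (s - r) ^ 2).intervalIntegrable _ _)
          intro s hs
          have := key (s - r) ⟨by linarith [hs.1], by linarith [hs.2]⟩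
          rwa [add_sub_cancel] at this
      _ = _ := by
        rw [intervalIntegral.integral_comp_sub_right (fun x => S.F r - D * x ^ 2),
          intervalIntegral.integral_sub (by simp) ((by fun_prop : Continuous
          fun x : ℝ => D * x ^ 2).intervalIntegrable _ _), intervalIntegral.integral_const_mul,
          integral_pow]
        simp only [intervalIntegral.integral_const, smul_eq_mul]
        push_cast
        ring
  -- The curvature is used only up to r + l ≤ R₁. Beyond that point the profile is bounded by its
  -- tangent there.
  have h2 := f_le_tangent hU hγ (by linarith : 0 ≤ r + l) (by linarith : 0 ≤ r + t)
  have h3 := mul_le_mul_of_nonneg_right (key l ⟨hl, le_rfl⟩) (by linarith : 0 ≤ t - l)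
  have h4 : D * (t * l ^ 2 / 3) ≤ D * (l ^ 3 / 3 + (t - l) * l ^ 2) := by
    apply mul_le_mul_of_nonneg_left _ hD0
    have := mul_nonneg (by linarith : 0 ≤ t - l) (sq_nonneg l)
    linarith
  have h5 : (1 / 3 * S.F (r + l) * S.A + 1 / 6 * S.B * m) * (t * l ^ 2) = D * (t * l ^ 2 / 3) := by
    rw [hD]; ring
  rw [h5]
  linarith

end Data

end KineticLangevin
end

/-! ### The gain from concavity against the drift of the kick. -/

noncomputable section

namespace KineticLangevin

open scoped RealInnerProductSpace

namespace Data

variable {d : ℕ} {S : Data d} {U G : E d → ℝ}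

/-- Bound f(Y) by its tangent at r everywhere, and better by g on the event D. The tangent only sees
the mean of Y. The majorant is a.e. nonnegative because f(Y) is, so its integral may be taken in the
reals. -/
lemma lintegral_f_le {Ω : Type*} [MeasurableSpace Ω] {P : Measure Ω} [IsProbabilityMeasure P]
    (hU : S.IsPotential U G) (hγ : 0 < S.γ) {r g y : ℝ} (hr : 0 ≤ r) {Y : Ω → ℝ}
    (hY : ∀ᵐ ω ∂P, 0 ≤ Y ω) (hYi : Integrable Y P) (hYm : ∫ ω, Y ω ∂P ≤ y) {D : Set Ω}
    (hD : MeasurableSet D) (hg : ∀ᵐ ω ∂P, ω ∈ D → S.f (Y ω) ≤ S.f r + S.F r * (Y ω - r) - g) :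
    ∫⁻ ω, ENNReal.ofReal (S.f (Y ω)) ∂P
      ≤ ENNReal.ofReal (S.f r + S.F r * (y - r) - g * P.real D) := by
  set H : Ω → ℝ := fun ω => S.f r + S.F r * (Y ω - r) - g * D.indicator (fun _ => (1 : ℝ)) ω
  have hi0 : Integrable (fun ω => S.F r * (Y ω - r)) P :=
    (hYi.sub (integrable_const r)).const_mul _
  have hi1 : Integrable (fun ω => S.f r + S.F r * (Y ω - r)) P :=
    (integrable_const (S.f r)).add hi0
  have hi2 : Integrable (fun ω => g * D.indicator (fun _ => (1 : ℝ)) ω) P :=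
    ((integrable_const (1 : ℝ)).indicator hD).const_mul g
  have hHi : Integrable H P := hi1.sub hi2
  have hle : ∀ᵐ ω ∂P, S.f (Y ω) ≤ H ω := by
    filter_upwards [hY, hg] with ω h1 h2
    by_cases hω : ω ∈ D
    · simpa [H, hω] using h2 hω
    · simpa [H, hω] using f_le_tangent hU hγ hr h1
  have hH0 : 0 ≤ᵐ[P] H := by
    filter_upwards [hY, hle] with ω h1 h2 using (f_nonneg hU hγ h1).trans h2
  have hint : ∫ ω, H ω ∂P = S.f r + S.F r * (∫ ω, Y ω ∂P - r) - g * P.real D := by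
    rw [integral_sub hi1 hi2, integral_const_mul, integral_indicator_const _ hD,
      integral_add (integrable_const _) hi0,
      integral_const_mul, integral_sub hYi (integrable_const r)]
    simp
  calc ∫⁻ ω, ENNReal.ofReal (S.f (Y ω)) ∂P ≤ ∫⁻ ω, ENNReal.ofReal (H ω) ∂P :=
        lintegral_mono_ae (hle.mono fun ω h => ENNReal.ofReal_le_ofReal h)
    _ = ENNReal.ofReal (∫ ω, H ω ∂P) := (ofReal_integral_eq_lintegral_ofReal hHi hH0).symm
    _ ≤ _ := by
      rw [hint]
      apply ENNReal.ofReal_le_ofReal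
      have := mul_le_mul_of_nonneg_left hYm (F_pos hU hγ hr).le
      linarith

/-- Numerical side conditions of a step, in scaled form: `σ` is the size of the noise, `δ` the
step in units of the friction, `e` the flight coefficient and `θ` the contraction per step. -/
structure StepBounds (S : Data d) (σ δ e θ : ℝ) : Prop where
  σ_pos : 0 < σ
  δ_pos : 0 < δ
  δ_le : δ ≤ 1 / 15
  le_e : δ - δ ^ 2 / 2 ≤ e
  e_le : e ≤ δ
  A_mul : S.A * σ ^ 2 = 128 * (S.α * δ)
  small : S.α * δ * (S.α + 1) ≤ 1 / 9600
  radius : S.A * σ * S.R₁ ≤ 64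
  θ_nonneg : 0 ≤ θ
  θ_le₁ : θ ≤ 9 / 640 * (S.B * σ ^ 2)
  θ_le₂ : θ * (32 * (4 * S.α + 1)) ≤ S.B * σ ^ 2
  θ_le₃ : θ ≤ S.fPrime * (δ / 16)
  θ_le₄ : θ ≤ S.fPrime * (δ * S.α / 4)

lemma one_sub_le_φ (hU : S.IsPotential U G) (hγ : 0 < S.γ) {x : ℝ} (hx : 0 ≤ x) :
    1 - S.A * x ^ 2 ≤ S.φ x := by
  rw [φ_eq]
  have h1 := Real.add_one_le_exp (-(S.A * (min x S.R₁) ^ 2))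
  have h2 : S.A * (min x S.R₁) ^ 2 ≤ S.A * x ^ 2 :=
    mul_le_mul_of_nonneg_left (pow_le_pow_left₀ (le_min hx (R₁_nonneg hU hγ)) (min_le_left _ _) 2)
      (A_pos hU hγ).le
  linarith

/-- If φ stays near 1 up to R₁, the curvature from φ is weak. This bound then makes B at least of
order R₁⁻², so that ψ takes over. -/
lemma le_B_mul_sq (hU : S.IsPotential U G) (hγ : 0 < S.γ) (hR : 0 < S.R₁) :
    S.φ S.R₁ ≤ S.B * S.R₁ ^ 2 := by
  have h1 := J_le hU hγ hR.le
  have h2 := B_mul_J hU hγ hR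
  have h3 := mul_le_mul_of_nonneg_left h1 (B_nonneg hU hγ)
  have h4 : S.B * (S.J S.R₁ * S.φ S.R₁) = S.φ S.R₁ / 2 := by rw [← mul_assoc, h2]; ring
  linarith

section

variable {σ δ e θ x q Q : ℝ}

lemma StepBounds.κ_bounds (h : StepBounds S σ δ e θ) (hα : 0 < S.α) :
    0 < S.α * δ ∧ S.α * δ ≤ 1 / 9600 ∧ S.α * δ * (4 * S.α + 1) ≤ 4 / 9600 := by
  have h1 : 0 < S.α * δ := mul_pos hα h.δ_pos
  have h2 := h.small
  have h3 := mul_pos h1 hα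
  refine ⟨h1, by linarith, by linarith⟩

/-- The summand 4α is paid by `θ_le₃` and the summand 1 by `θ_le₄`, each with αδ/4. -/
lemma StepBounds.θ_mul_le (h : StepBounds S σ δ e θ) (hU : S.IsPotential U G) (hγ : 0 < S.γ)
    (hq : 0 ≤ q) : θ * ((4 * S.α + 1) * q) ≤ S.fPrime * (S.α * δ / 2 * q) := by
  have hα := α_pos hU hγ
  have h3 := mul_le_mul_of_nonneg_right h.θ_le₃ (mul_nonneg (mul_nonneg zero_le_four hα.le) hq)
  have h4 := mul_le_mul_of_nonneg_right h.θ_le₄ hq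
  linarith

/-- In the reflection regime, the gain beats the drift: far from the diagonal. -/
lemma StepBounds.far (h : StepBounds S σ δ e θ) (hU : S.IsPotential U G) (hγ : 0 < S.γ)
    (hx : 0 ≤ x) (hq : 0 < q) :
    S.F (S.α * x + q) * (2 * (S.α * δ) * q) + θ * S.f (S.α * x + q)
      ≤ (2 / 3 * S.F (S.α * x + q) * S.A * (S.α * x + q)
          + 1 / 3 * S.B * S.Φ (S.α * x + q)) * (999 / 1000 * σ) ^ 2 * (1 / 20) := by
  have hα := α_pos hU hγ
  obtain ⟨hκ0, hκ1, hκ2⟩ := h.κ_bounds hα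
  set r := S.α * x + q with hrd
  have hr0 : 0 < r := by positivity
  have hF := F_pos hU hγ hr0.le
  have hΦ := Φ_nonneg hU hγ hr0.le
  have hB := B_nonneg hU hγ
  have h1 : θ * S.f r ≤ 9 / 640 * (S.B * σ ^ 2) * S.Φ r :=
    mul_le_mul h.θ_le₁ (f_le_Φ hU hγ hr0.le) (f_nonneg hU hγ hr0.le)
      (h.θ_nonneg.trans h.θ_le₁)
  have h2 : 0 ≤ S.B * σ ^ 2 * S.Φ r := by positivity
  have h3 : S.F r * (S.α * δ) * q ≤ S.F r * (S.α * δ) * r := by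
    apply mul_le_mul_of_nonneg_left _ (by positivity)
    rw [hrd]; linarith [mul_nonneg hα.le hx]
  -- In units of F(r)αδr the curvature of φ gains 128 · 0.998/30 > 4 against a drift of at most 2.
  -- The curvature of ψ gains 0.998/60 > 9/640 units of Bσ²Φ(r), which pays θ and explains the term
  -- 9ĉ/640 of the rate.
  have h4 : S.F r * S.A * r * σ ^ 2 = 128 * (S.F r * (S.α * δ) * r) := by
    have := h.A_mul
    calc S.F r * S.A * r * σ ^ 2 = S.F r * r * (S.A * σ ^ 2) := by ring
      _ = _ := by rw [this]; ring
  have h5 : 0 ≤ S.F r * (S.α * δ) * r := by positivity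
  have h6 : (2 / 3 * S.F r * S.A * r + 1 / 3 * S.B * S.Φ r) * (999 / 1000 * σ) ^ 2 * (1 / 20)
      = 998001 / 1000000 / 30 * (S.F r * S.A * r * σ ^ 2)
        + 998001 / 1000000 / 60 * (S.B * σ ^ 2 * S.Φ r) := by ring
  rw [h6, h4]
  linarith

/-- In the reflection regime, the gain beats the drift: close to the diagonal, in the outer half. -/
lemma StepBounds.near_outer (h : StepBounds S σ δ e θ) (hU : S.IsPotential U G) (hγ : 0 < S.γ)
    (hx : 0 ≤ x) (hr : S.α * x + q ≤ S.R₁) (hq : 0 < q) (hxq : x ≤ 4 * q)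
    (hr2 : S.R₁ ≤ 2 * (S.α * x + q)) :
    S.F (S.α * x + q) * (2 * (S.α * δ) * q) + θ * S.f (S.α * x + q)
      ≤ (2 / 3 * S.F (S.α * x + q) * S.A * (S.α * x + q)
          + 1 / 3 * S.B * S.Φ (S.α * x + q)) * (999 / 1000 * q) ^ 2 * (1 / 20) := by
  have hα := α_pos hU hγ
  obtain ⟨hκ0, hκ1, hκ2⟩ := h.κ_bounds hα
  have hrq : S.α * x + q ≤ (4 * S.α + 1) * q := by
    linarith [mul_le_mul_of_nonneg_left hxq hα.le]
  have hr0 : 0 < S.α * x + q := by positivity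
  generalize S.α * x + q = r at *
  have hF := F_pos hU hγ hr0.le
  have hΦ := Φ_nonneg hU hγ hr0.le
  have hB := B_nonneg hU hγ
  have hA := A_pos hU hγ
  have hR0 : 0 < S.R₁ := hr0.trans_le hr
  have h1 : θ * S.f r ≤ S.F r * (S.α * δ / 2 * q) := by
    calc θ * S.f r ≤ θ * ((4 * S.α + 1) * q) :=
          mul_le_mul_of_nonneg_left ((f_le hU hγ hr0.le).trans hrq) h.θ_nonneg
      _ ≤ S.fPrime * (S.α * δ / 2 * q) := h.θ_mul_le hU hγ hq.le
      _ ≤ _ := mul_le_mul_of_nonneg_right (fPrime_le_F hU hγ hr0.le) (by positivity)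
  suffices hs : S.F r * (5 / 2 * (S.α * δ) * q) ≤
      998001 / 1000000 / 30 * (S.F r * S.A * r * q ^ 2)
        + 998001 / 1000000 / 60 * (S.B * S.Φ r * q ^ 2) by
    have h6 : (2 / 3 * S.F r * S.A * r + 1 / 3 * S.B * S.Φ r) * (999 / 1000 * q) ^ 2 * (1 / 20)
      = 998001 / 1000000 / 30 * (S.F r * S.A * r * q ^ 2)
        + 998001 / 1000000 / 60 * (S.B * S.Φ r * q ^ 2) := by ring
    rw [h6]; linarith
  have h7 : 0 ≤ S.F r * S.A * r * q ^ 2 := by positivity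
  have h8 : 0 ≤ S.B * S.Φ r * q ^ 2 := by positivity
  -- If r² is large compared with (4α + 1)σ², then rq ≥ 0.6σ² and the curvature of φ suffices.
  -- Otherwise R₁ ≤ 2r makes A R₁² small, φ is at least 0.87 on [0, R₁], and the curvature of ψ
  -- pays.
  rcases le_total (6 / 10 * ((4 * S.α + 1) * σ ^ 2)) (r ^ 2) with hc | hc
  · have h9 : 6 / 10 * σ ^ 2 ≤ r * q := by
      have h10 : r * r ≤ r * ((4 * S.α + 1) * q) := mul_le_mul_of_nonneg_left hrq hr0.le
      have h11 : 0 < 4 * S.α + 1 := by positivity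
      have h12 : (4 * S.α + 1) * (6 / 10 * σ ^ 2) ≤ (4 * S.α + 1) * (r * q) := by linarith
      exact le_of_mul_le_mul_left h12 h11
    have h13 : S.F r * S.A * q * (6 / 10 * σ ^ 2) ≤ S.F r * S.A * q * (r * q) :=
      mul_le_mul_of_nonneg_left h9 (by positivity)
    have h14 : S.F r * S.A * q * (6 / 10 * σ ^ 2) = 6 / 10 * 128 * (S.F r * ((S.α * δ) * q)) := by
      calc _ = 6 / 10 * S.F r * q * (S.A * σ ^ 2) := by ring
        _ = _ := by rw [h.A_mul]; ring
    have h15 : 0 ≤ S.F r * ((S.α * δ) * q) := by positivity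
    linarith
  · have h9 : S.A * S.R₁ ^ 2 ≤ 13 / 100 := by
      calc S.A * S.R₁ ^ 2 ≤ S.A * (2 * r) ^ 2 :=
            mul_le_mul_of_nonneg_left (pow_le_pow_left₀ hR0.le hr2 2) hA.le
        _ = 4 * S.A * r ^ 2 := by ring
        _ ≤ 4 * S.A * (6 / 10 * ((4 * S.α + 1) * σ ^ 2)) :=
            mul_le_mul_of_nonneg_left hc (by positivity)
        _ = 24 / 10 * (4 * S.α + 1) * (S.A * σ ^ 2) := by ring
        _ = 24 / 10 * 128 * (S.α * δ * (4 * S.α + 1)) := by rw [h.A_mul]; ring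
        _ ≤ _ := by linarith
    have h10 : 87 / 100 ≤ S.φ S.R₁ := by linarith [one_sub_le_φ hU hγ hR0.le]
    have h11 := le_B_mul_sq hU hγ hR0
    have h12 : 87 / 100 ≤ 4 * (S.B * r ^ 2) := by
      have := mul_le_mul_of_nonneg_left (pow_le_pow_left₀ hR0.le hr2 2) hB
      linarith
    have h13 : 87 / 100 * r ≤ S.Φ r := by
      have := mul_le_mul_of_nonneg_left (h10.trans (φ_anti hU hγ hr0.le hr)) hr0.le
      linarith [le_Φ hU hγ hr0.le]
    have h14 : 18 / 100 * q ^ 2 ≤ r * (S.B * S.Φ r * q ^ 2) := by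
      have h15 : S.B * r * (87 / 100 * r) ≤ S.B * r * S.Φ r :=
        mul_le_mul_of_nonneg_left h13 (by positivity)
      have h16 : 18 / 100 ≤ S.B * r * S.Φ r := by linarith
      have := mul_le_mul_of_nonneg_right h16 (sq_nonneg q)
      linarith
    have h17 : r * (S.B * S.Φ r * q ^ 2) ≤ (4 * S.α + 1) * q * (S.B * S.Φ r * q ^ 2) :=
      mul_le_mul_of_nonneg_right hrq h8
    have h18 : 18 / 100 * q ≤ (4 * S.α + 1) * (S.B * S.Φ r * q ^ 2) := by
      have : q * (18 / 100 * q) ≤ q * ((4 * S.α + 1) * (S.B * S.Φ r * q ^ 2)) := by linarith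
      exact le_of_mul_le_mul_left this hq
    have h19 : S.α * δ * (18 / 100 * q) ≤ 4 / 9600 * (S.B * S.Φ r * q ^ 2) := by
      have h20 := mul_le_mul_of_nonneg_left h18 hκ0.le
      have h21 := mul_le_mul_of_nonneg_right hκ2 h8
      linarith
    have h22 : S.F r * (5 / 2 * (S.α * δ) * q) ≤ 1 * (5 / 2 * (S.α * δ) * q) :=
      mul_le_mul_of_nonneg_right (F_le_one hU hγ hr0.le) (by positivity)
    linarith

/-- In the reflection regime, the gain beats the drift: close to the diagonal, in the inner half. -/
lemma StepBounds.near_inner (h : StepBounds S σ δ e θ) (hU : S.IsPotential U G) (hγ : 0 < S.γ)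
    (hx : 0 ≤ x) (hq : 0 < q) (hxq : x ≤ 4 * q) (hqσ : q ≤ 1001 / 1000 * σ)
    (hr2 : 2 * (S.α * x + q) ≤ S.R₁) :
    ∃ l, 0 ≤ l ∧ l ≤ 1999 / 1000 * σ ∧ S.α * x + q + l ≤ S.R₁ ∧
      (∀ y ∈ Set.Icc 0 l, 94 / 100 * y ≤ S.Φ y) ∧
    S.F (S.α * x + q) * (2 * (S.α * δ) * q) + θ * S.f (S.α * x + q)
      ≤ (1 / 3 * S.F (S.α * x + q + l) * S.A + 1 / 6 * S.B * (94 / 100))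
        * (1999 / 1000 * σ * l ^ 2) * (3 / 100 * (999 / 1000 * q / σ)) := by
  have hα := α_pos hU hγ
  obtain ⟨hκ0, hκ1, hκ2⟩ := h.κ_bounds hα
  have hrq : S.α * x + q ≤ (4 * S.α + 1) * q := by
    linarith [mul_le_mul_of_nonneg_left hxq hα.le]
  have hr0 : 0 < S.α * x + q := by positivity
  generalize S.α * x + q = r at *
  have hF := F_pos hU hγ hr0.le
  have hB := B_nonneg hU hγ
  have hA := A_pos hU hγ
  have hσ := h.σ_pos
  have hR0 : 0 < S.R₁ := by linarith
  have hAσ := h.A_mul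
  -- An upward jump has size almost 2σ. Capping l at R₁/2 keeps r + l ≤ R₁, as r ≤ R₁/2 here.
  obtain ⟨l, hl⟩ : ∃ l, l = min (1999 / 1000 * σ) (S.R₁ / 2) := ⟨_, rfl⟩
  have hl0 : 0 < l := by rw [hl]; positivity
  have hl1 : l ≤ 1999 / 1000 * σ := by rw [hl]; exact min_le_left _ _
  have hl2 : l ≤ S.R₁ / 2 := by rw [hl]; exact min_le_right _ _
  have hrl : r + l ≤ S.R₁ := by linarith
  have hFl := F_pos hU hγ (by linarith : 0 ≤ r + l)
  refine ⟨l, hl0.le, hl1, hrl, ?_, ?_⟩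
  · intro y hy
    have h1 : S.A * y ^ 2 ≤ 6 / 100 := by
      calc S.A * y ^ 2 ≤ S.A * (2 * σ) ^ 2 := by
            apply mul_le_mul_of_nonneg_left _ hA.le
            exact pow_le_pow_left₀ hy.1 (by linarith [hy.2]) 2
        _ = 4 * (S.A * σ ^ 2) := by ring
        _ ≤ _ := by rw [hAσ]; linarith
    have h2 := one_sub_le_φ hU hγ hy.1
    have h3 := mul_le_mul_of_nonneg_left (by linarith : 94 / 100 ≤ S.φ y) hy.1
    linarith [le_Φ hU hγ hy.1]
  · have e1 : (1 / 3 * S.F (r + l) * S.A + 1 / 6 * S.B * (94 / 100))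
        * (1999 / 1000 * σ * l ^ 2) * (3 / 100 * (999 / 1000 * q / σ))
        = 1999 * 999 / 1000000 * (3 / 100) * q * l ^ 2 *
          (1 / 3 * (S.F (r + l) * S.A) + 94 / 600 * S.B) := by
      field_simp
      ring
    rw [e1]
    have hfr : S.f r ≤ (4 * S.α + 1) * q := (f_le hU hγ hr0.le).trans hrq
    -- If l is the full jump, F loses at most a constant factor between r and r + l; φ pays the
    -- drift, and ψ pays θ through `θ_le₂`. If R₁ < 4σ, then φ is close to 1 up to R₁, and B l² ≥
    -- 0.19 pays for everything.
    rcases le_total (1999 / 1000 * σ) (S.R₁ / 2) with hc | hc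
    · have hls : l = 1999 / 1000 * σ := by rw [hl, min_eq_left hc]
      have hl3 : l ^ 2 = 1999 ^ 2 / 1000000 * σ ^ 2 := by rw [hls]; ring
      have h1 : 57 / 100 * S.φ r ≤ S.φ (r + l) := by
        have e2 : S.φ (r + l) = S.φ r * Real.exp (-(S.A * (2 * r * l + l ^ 2))) := by
          rw [φ_eq, φ_eq, min_eq_left hrl, min_eq_left (by linarith), ← Real.exp_add]
          congr 1; ring
        have h2 := Real.add_one_le_exp (-(S.A * (2 * r * l + l ^ 2)))
        have h3 : S.A * (2 * r * l + l ^ 2) ≤ 43 / 100 := by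
          have h4 : r ≤ (4 * S.α + 1) * (1001 / 1000 * σ) :=
            hrq.trans (mul_le_mul_of_nonneg_left hqσ (by positivity))
          have h5 : 2 * r * l + l ^ 2 ≤ 801 / 100 * ((4 * S.α + 1) * σ ^ 2) := by
            have h6 : r * l ≤ (4 * S.α + 1) * (1001 / 1000 * σ) * (1999 / 1000 * σ) :=
              mul_le_mul h4 hl1 hl0.le (by positivity)
            have h7 : 0 ≤ S.α * σ ^ 2 := by positivity
            have h8 : 0 ≤ σ ^ 2 := sq_nonneg σ
            rw [hl3]
            linarith
          calc _ ≤ S.A * (801 / 100 * ((4 * S.α + 1) * σ ^ 2)) :=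
                mul_le_mul_of_nonneg_left h5 hA.le
            _ = 801 / 100 * (4 * S.α + 1) * (S.A * σ ^ 2) := by ring
            _ = 801 / 100 * 128 * (S.α * δ * (4 * S.α + 1)) := by rw [hAσ]; ring
            _ ≤ _ := by linarith
        rw [e2]
        have := mul_le_mul_of_nonneg_left (by linarith : 57 / 100 ≤
          Real.exp (-(S.A * (2 * r * l + l ^ 2)))) (S.φ_pos r).le
        linarith
      have h2 : 28 / 100 * S.F r ≤ S.F (r + l) := by
        have := half_φ_le_F hU hγ (by linarith : 0 ≤ r + l)
        have := F_le_φ hU hγ hr0.le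
        linarith
      have h3 : θ * S.f r ≤ S.B * σ ^ 2 * q / 32 := by
        have h4 := mul_le_mul_of_nonneg_left hfr h.θ_nonneg
        have h5 := mul_le_mul_of_nonneg_right h.θ_le₂ hq.le
        linarith
      have h6 : q * (S.A * σ ^ 2) * (28 / 100 * S.F r) ≤ q * (S.A * σ ^ 2) * S.F (r + l) :=
        mul_le_mul_of_nonneg_left h2 (by positivity)
      have h7 : 0 ≤ S.B * σ ^ 2 * q := by positivity
      have h8 : 0 ≤ q * (S.α * δ) * S.F r := by positivity
      have e3 : q * (S.A * σ ^ 2) * (28 / 100 * S.F r)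
          = 128 * (28 / 100) * (q * (S.α * δ) * S.F r) := by rw [hAσ]; ring
      rw [hl3]
      linarith
    · have hls : l = S.R₁ / 2 := by rw [hl, min_eq_right hc]
      have h1 : S.A * S.R₁ ^ 2 ≤ 22 / 100 := by
        calc S.A * S.R₁ ^ 2 ≤ S.A * (4 * σ) ^ 2 := by
              apply mul_le_mul_of_nonneg_left _ hA.le
              exact pow_le_pow_left₀ hR0.le (by linarith) 2
          _ = 16 * (S.A * σ ^ 2) := by ring
          _ ≤ _ := by rw [hAσ]; linarith
      have h2 := one_sub_le_φ hU hγ hR0.le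
      have h3 := le_B_mul_sq hU hγ hR0
      have h4 : 19 / 100 ≤ S.B * l ^ 2 := by
        rw [hls]; linarith
      have h5 : θ * S.f r ≤ S.α * δ / 2 * q := by
        calc θ * S.f r ≤ θ * ((4 * S.α + 1) * q) := mul_le_mul_of_nonneg_left hfr h.θ_nonneg
          _ ≤ S.fPrime * (S.α * δ / 2 * q) := h.θ_mul_le hU hγ hq.le
          _ ≤ 1 * (S.α * δ / 2 * q) := mul_le_mul_of_nonneg_right
            ((fPrime_le_F hU hγ le_rfl).trans (F_le_one hU hγ le_rfl)) (by positivity)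
          _ = _ := one_mul _
      have h6 : S.F r * (2 * (S.α * δ) * q) ≤ 1 * (2 * (S.α * δ) * q) :=
        mul_le_mul_of_nonneg_right (F_le_one hU hγ hr0.le) (by positivity)
      have h7 := mul_le_mul_of_nonneg_right h4 hq.le
      have h8 : 0 ≤ q * l ^ 2 * (S.F (r + l) * S.A) := by positivity
      have h9 := mul_le_mul_of_nonneg_right hκ1 hq.le
      linarith

end

end Data

end KineticLangevin
end

/-! ### The expected concave cost for an abstract mean-zero jump. -/

noncomputable section

namespace KineticLangevin

open scoped RealInnerProductSpace

namespace Data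

variable {d : ℕ} {S : Data d} {U G : E d → ℝ}

variable {σ δ e θ x q Q : ℝ}

/-- Only these features of the coupling enter: s ≤ 1, mean zero, an event D₁ of probability at least
1/20 on which the gap shrinks by min(Q, 2σ), and, for Q ≤ σ, an event D₂ of probability of order Q/σ
on which it grows by 2σ. The argument of f is the bound on the new `rs` from
`rs_stepQ_le_reflection`. -/
lemma StepBounds.expectation_f_le {Ω : Type*} [MeasurableSpace Ω] {P : Measure Ω}
    [IsProbabilityMeasure P] (h : StepBounds S σ δ e θ) (hU : S.IsPotential U G) (hγ : 0 < S.γ)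
    (hx : 0 ≤ x) (hq : 0 < q) (hxq : x ≤ 4 * q) (hr : S.α * x + q ≤ S.R₁)
    (hQ0 : 0 ≤ Q) (hQ1 : Q ≤ q + S.α * δ / 2 * x) (hQ2 : q ≤ Q + S.α * δ / 2 * x)
    {s : Ω → ℝ} (hs1 : ∀ᵐ ω ∂P, s ω ≤ 1) (hsi : Integrable s P) (hs0 : ∫ ω, s ω ∂P = 0)
    {D₁ D₂ : Set Ω} (hD₁ : MeasurableSet D₁) (hD₂ : MeasurableSet D₂)
    (hP₁ : 1 / 20 ≤ P.real D₁) (hP₂ : Q ≤ σ → 3 / 100 * (Q / σ) ≤ P.real D₂)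
    (h₁ : ∀ᵐ ω ∂P, ω ∈ D₁ → min Q (2 * σ) ≤ s ω * Q)
    (h₂ : ∀ᵐ ω ∂P, ω ∈ D₂ → s ω * Q ≤ -(2 * σ)) :
    ∫⁻ ω, ENNReal.ofReal (S.f (S.α * (1 - e) * x + S.α * (e + δ / 2) * Q
      + (1 + S.α * δ / 2) * ((1 - s ω) * Q))) ∂P
      ≤ ENNReal.ofReal ((1 - θ) * S.f (S.α * x + q)) := by
  have hα := α_pos hU hγ
  obtain ⟨hκ0, hκ1, hκ2⟩ := h.κ_bounds hα
  have hσ := h.σ_pos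
  have hδ := h.δ_pos
  have hδ1 := h.δ_le
  have he1 := h.e_le
  have he2 : 29 / 30 * δ ≤ e := by nlinarith [h.le_e]
  have he0 : 0 ≤ e := by linarith
  have hκx : 0 ≤ S.α * δ * x := by positivity
  have hκq : 0 ≤ S.α * δ * q := by positivity
  have hκxq : S.α * δ * x ≤ 4 * (S.α * δ * q) := by
    linarith [mul_le_mul_of_nonneg_left hxq hκ0.le]
  have hκq' : S.α * δ * q ≤ 1 / 9600 * q := mul_le_mul_of_nonneg_right hκ1 hq.le
  have hex : S.α * e * x ≤ S.α * δ * x := by gcongr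
  have hex' : 29 / 30 * (S.α * δ * x) ≤ S.α * e * x := by
    have := mul_le_mul_of_nonneg_right he2 (mul_nonneg hα.le hx)
    linarith
  have heQ : S.α * e * Q ≤ S.α * δ * Q := by gcongr
  have heQ0 : 0 ≤ S.α * e * Q := by positivity
  have hκQ0 : 0 ≤ S.α * δ * Q := by positivity
  have hκQ1 : S.α * δ * Q ≤ S.α * δ * q + 1 / 9600 * (S.α * δ * x) := by
    have h3 := mul_le_mul_of_nonneg_left hQ1 hκ0.le
    have h4 := mul_le_mul_of_nonneg_right hκ1 hκx
    linarith
  have hr0 : 0 < S.α * x + q := by positivity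
  have hR0 : 0 < S.R₁ := hr0.trans_le hr
  set Y : Ω → ℝ := fun ω => S.α * (1 - e) * x + S.α * (e + δ / 2) * Q
      + (1 + S.α * δ / 2) * ((1 - s ω) * Q) with hY
  have hYi : Integrable Y P := by
    have : Integrable (fun ω => 1 - s ω) P := (integrable_const 1).sub hsi
    exact (integrable_const _).add ((this.mul_const Q).const_mul _)
  have hY0 : ∀ᵐ ω ∂P, 0 ≤ Y ω := by
    filter_upwards [hs1] with ω hω
    have h3 : 0 ≤ 1 - s ω := by linarith
    have h4 : 0 ≤ 1 - e := by linarith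
    simp only [hY]
    positivity
  -- The mean of s vanishes, so only the drift remains. The αδx/2 contained in Q is outweighed by
  -- the relaxation -αe x of the position.
  have hYm : ∫ ω, Y ω ∂P ≤ S.α * x + q + 2 * (S.α * δ) * q := by
    have h3 : ∫ ω, Y ω ∂P = S.α * (1 - e) * x + S.α * (e + δ / 2) * Q + (1 + S.α * δ / 2) * Q := by
      have h4 : Integrable (fun ω => 1 - s ω) P := (integrable_const 1).sub hsi
      simp only [hY]
      rw [integral_add (integrable_const _) ((h4.mul_const Q).const_mul _), integral_const_mul,
        integral_mul_const, integral_sub (integrable_const _) hsi, hs0]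
      simp
    rw [h3]
    linarith
  have hYub : ∀ ω, Y ω ≤ S.α * x + q + 2 * (S.α * δ) * q
      + -((1 + S.α * δ / 2) * (s ω * Q)) := by
    intro ω
    simp only [hY]
    linarith
  have hF := F_pos hU hγ hr0.le
  have hA := A_pos hU hγ
  have hB := B_nonneg hU hγ
  have hΦ := Φ_nonneg hU hγ hr0.le
  -- a downward jump by at least `t₀` on `D₁`
  have down : ∀ t₀, 0 ≤ t₀ → (∀ᵐ ω ∂P, ω ∈ D₁ → Y ω ≤ S.α * x + q - t₀) →
      S.F (S.α * x + q) * (2 * (S.α * δ) * q) + θ * S.f (S.α * x + q)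
      ≤ (2 / 3 * S.F (S.α * x + q) * S.A * (S.α * x + q)
          + 1 / 3 * S.B * S.Φ (S.α * x + q)) * t₀ ^ 2 * (1 / 20) →
      ∫⁻ ω, ENNReal.ofReal (S.f (Y ω)) ∂P ≤ ENNReal.ofReal ((1 - θ) * S.f (S.α * x + q)) := by
    intro t₀ ht₀ hjump hgain
    have hc : 0 ≤ 2 / 3 * S.F (S.α * x + q) * S.A * (S.α * x + q)
          + 1 / 3 * S.B * S.Φ (S.α * x + q) := by positivity
    refine (lintegral_f_le (D := D₁) (g := (2 / 3 * S.F (S.α * x + q) * S.A * (S.α * x + q)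
          + 1 / 3 * S.B * S.Φ (S.α * x + q)) * t₀ ^ 2) hU hγ hr0.le hY0 hYi hYm hD₁ ?_).trans ?_
    · filter_upwards [hY0, hjump] with ω h3 h4 hω
      have h5 := h4 hω
      have h6 := f_sub_le hU hγ (r := S.α * x + q) (t := S.α * x + q - Y ω) (by linarith)
        (by linarith) hr
      rw [sub_sub_cancel] at h6
      have h7 := mul_le_mul_of_nonneg_left (pow_le_pow_left₀ ht₀ (by linarith :
        t₀ ≤ S.α * x + q - Y ω) 2) hc
      linarith
    · apply ENNReal.ofReal_le_ofReal
      have h3 := mul_le_mul_of_nonneg_left hP₁ (mul_nonneg hc (sq_nonneg t₀))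
      linarith
  have hmin : ∀ ω, min Q (2 * σ) ≤ s ω * Q →
      Y ω ≤ S.α * x + q + 2 * (S.α * δ) * q - min Q (2 * σ) := by
    intro ω hω
    have h3 : 0 ≤ min Q (2 * σ) := le_min hQ0 (by linarith)
    have h4 := hYub ω
    have h5 : 0 ≤ S.α * δ / 2 * (s ω * Q) := mul_nonneg (by linarith) (h3.trans hω)
    linarith
  -- Downward jumps are used for gaps above σ and in the outer half of [0, R₁]. For a small gap and
  -- small r a downward jump gains too little, and the rare but long upward jump is used.
  rcases le_total σ Q with hc | hc
  · refine down (999 / 1000 * σ) (by positivity) ?_ (h.far hU hγ hx hq)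
    filter_upwards [h₁] with ω h3 hω
    have h4 := hmin ω (h3 hω)
    rcases le_total Q (2 * σ) with h5 | h5
    · rw [min_eq_left h5] at h4
      have h6 : q ≤ 201 / 100 * σ := by linarith
      linarith
    · rw [min_eq_right h5] at h4
      -- The step size condition on R₁ acts here: 128αδq = Aσ²q ≤ 64σ because q ≤ R₁. Hence the
      -- drift eats at most half of the jump 2σ.
      have h6 : 2 * (S.α * δ) * q ≤ σ := by
        have h7 : S.A * σ * q ≤ 64 := by
          refine le_trans ?_ h.radius
          apply mul_le_mul_of_nonneg_left _ (by positivity)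
          linarith [mul_nonneg hα.le hx]
        have h8 := mul_le_mul_of_nonneg_left h7 hσ.le
        have h9 : σ * (S.A * σ * q) = 128 * (S.α * δ) * q := by rw [← h.A_mul]; ring
        linarith
      linarith
  · rcases le_total S.R₁ (2 * (S.α * x + q)) with hc2 | hc2
    · refine down (999 / 1000 * q) (by positivity) ?_ (h.near_outer hU hγ hx hr hq hxq hc2)
      filter_upwards [h₁] with ω h3 hω
      have h4 := h3 hω
      rw [min_eq_left (by linarith)] at h4
      have h5 : 0 ≤ S.α * δ / 2 * (s ω * Q - Q) := mul_nonneg (by linarith) (by linarith)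
      simp only [hY]
      linarith
    · have hqσ : q ≤ 1001 / 1000 * σ := by linarith
      obtain ⟨l, hl0, hl1, hl2, hm, hgain⟩ := h.near_inner hU hγ hx hq hxq hqσ hc2
      have hFl := F_pos hU hγ (by linarith : 0 ≤ S.α * x + q + l)
      have hc' : 0 ≤ 1 / 3 * S.F (S.α * x + q + l) * S.A + 1 / 6 * S.B * (94 / 100) := by
        positivity
      refine (lintegral_f_le (D := D₂) (g := (1 / 3 * S.F (S.α * x + q + l) * S.A
        + 1 / 6 * S.B * (94 / 100)) * (1999 / 1000 * σ * l ^ 2)) hU hγ hr0.le hY0 hYi hYm hD₂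
        ?_).trans ?_
      · filter_upwards [h₂] with ω h3 hω
        have h4 := h3 hω
        have h5 : 1999 / 1000 * σ ≤ Y ω - (S.α * x + q) := by
          have h6 : 0 ≤ S.α * δ / 2 * (-(s ω * Q)) := mul_nonneg (by linarith) (by linarith)
          simp only [hY]
          linarith
        have h6 := f_add_le hU hγ hr0.le hl0 (hl1.trans h5) hl2 (by norm_num : (0:ℝ) ≤ 94 / 100) hm
        rw [add_sub_cancel] at h6
        have h7 := mul_le_mul_of_nonneg_left (mul_le_mul_of_nonneg_right h5 (sq_nonneg l)) hc'
        linarith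
      · apply ENNReal.ofReal_le_ofReal
        have h3 := hP₂ hc
        have h4 : 999 / 1000 * q ≤ Q := by linarith
        have h5 : 3 / 100 * (999 / 1000 * q / σ) ≤ P.real D₂ := by
          refine le_trans ?_ h3
          gcongr
        have h6 := mul_le_mul_of_nonneg_left h5 (mul_nonneg hc' (by positivity :
          0 ≤ 1999 / 1000 * σ * l ^ 2))
        linarith

end Data

end KineticLangevin
end

/-! ### The reflection coupling of Gaussian vectors. -/

noncomputable section

namespace KineticLangevin

open scoped RealInnerProductSpace ENNReal

section GaussianCoupling

set_option linter.unusedSectionVars false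

variable {V : Type*} [NormedAddCommGroup V] [InnerProductSpace ℝ V] [FiniteDimensional ℝ V]
  [MeasurableSpace V] [BorelSpace V]

/-- The density of the standard Gaussian. -/
def gaussDensity (v : V) : ℝ :=
  ((2 * Real.pi) ^ (Module.finrank ℝ V / 2 : ℝ))⁻¹ * Real.exp (-(1 / 2) * ‖v‖ ^ 2)

lemma gaussDensity_pos (v : V) : 0 < gaussDensity v := by
  unfold gaussDensity; positivity

lemma continuous_gaussDensity : Continuous (gaussDensity : V → ℝ) := by
  unfold gaussDensity; fun_prop

lemma gaussDensity_eq_of_norm_eq {v w : V} (h : ‖v‖ = ‖w‖) : gaussDensity v = gaussDensity w := by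
  rw [gaussDensity, gaussDensity, h]

lemma integrable_gaussDensity : Integrable (gaussDensity : V → ℝ) := by
  refine Integrable.const_mul ?_ _
  by_contra h
  have h1 := GaussianFourier.integral_rexp_neg_mul_sq_norm (V := V) (b := 1 / 2) (by norm_num)
  rw [integral_undef h] at h1
  have : 0 < (Real.pi / (1 / 2)) ^ (Module.finrank ℝ V / 2 : ℝ) := by positivity
  linarith

/-- Both sides have the same characteristic function. The density is what allows the change of
variables in `map_reflNoise`. -/
lemma stdGaussian_eq_withDensity :
    stdGaussian V = volume.withDensity fun v => ENNReal.ofReal (gaussDensity v) := by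
  have hfin : IsFiniteMeasure (volume.withDensity fun v : V => ENNReal.ofReal (gaussDensity v)) :=
    isFiniteMeasure_withDensity_ofReal integrable_gaussDensity.2
  refine Measure.ext_of_charFun ?_
  ext t
  rw [charFun_stdGaussian, charFun_apply, integral_withDensity_eq_integral_toReal_smul
    (continuous_gaussDensity.measurable.ennreal_ofReal) (by simp)]
  have h1 := GaussianFourier.integral_cexp_neg_mul_sq_norm_add (V := V) (b := 1 / 2) (by norm_num)
    Complex.I t
  have h2 : ∀ v : V, (ENNReal.ofReal (gaussDensity v)).toReal • Complex.exp (⟪v, t⟫ * Complex.I)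
      = ((2 * Real.pi : ℂ) ^ (Module.finrank ℝ V / 2 : ℂ))⁻¹
        * Complex.exp (-(1 / 2) * ‖v‖ ^ 2 + Complex.I * ⟪t, v⟫) := by
    intro v
    rw [ENNReal.toReal_ofReal (gaussDensity_pos v).le, gaussDensity, Complex.exp_add,
      Complex.real_smul, real_inner_comm, mul_comm Complex.I]
    push_cast
    rw [Complex.ofReal_cpow (by positivity)]
    push_cast
    ring
  simp_rw [h2]
  rw [integral_const_mul, h1]
  have h3 : (Real.pi / (1 / 2) : ℂ) = 2 * Real.pi := by ring
  have h4 : (2 * Real.pi : ℂ) ^ (Module.finrank ℝ V / 2 : ℂ) ≠ 0 := by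
    rw [Ne, Complex.cpow_eq_zero_iff]
    simp [Real.pi_ne_zero]
  rw [h3, ← mul_assoc, inv_mul_cancel₀ h4, one_mul, Complex.I_sq]
  congr 1
  ring

/-- The probability to shift by `w` in the reflection coupling, before truncation at `1`. -/
def shiftRatio (w n : V) : ℝ := Real.exp (-⟪n, w⟫ - ‖w‖ ^ 2 / 2)

lemma shiftRatio_mul (w n : V) : shiftRatio w n * gaussDensity n = gaussDensity (n + w) := by
  rw [shiftRatio, gaussDensity, gaussDensity, norm_add_sq_real, mul_left_comm, ← Real.exp_add]
  congr 2; ring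

/-- The multiple of `w` by which the noise is displaced in the reflection coupling. -/
def reflCoeff (w n : V) (u : ℝ) : ℝ :=
  if u ≤ shiftRatio w n then 1 else -(2 * ⟪n, w⟫ / ‖w‖ ^ 2)

/-- The coupled noise: with maximal probability the shift of `n` by `w`, otherwise the reflection
of `n` in the hyperplane orthogonal to `w`. -/
def reflNoise (w n : V) (u : ℝ) : V := n + reflCoeff w n u • w

lemma measurable_reflCoeff : Measurable fun p : V × V × ℝ => reflCoeff p.1 p.2.1 p.2.2 := by
  unfold reflCoeff shiftRatio
  refine Measurable.ite (measurableSet_le (by fun_prop) (by fun_prop)) (by fun_prop) ?_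
  exact ((Measurable.const_mul (by fun_prop) _).div (by fun_prop)).neg

lemma measurable_reflNoise : Measurable fun p : V × V × ℝ => reflNoise p.1 p.2.1 p.2.2 := by
  unfold reflNoise
  have := measurable_reflCoeff (V := V)
  fun_prop

/-- Reflection in the hyperplane orthogonal to `w`. -/
lemma reflection_eq (w n : V) :
    (ℝ ∙ w)ᗮ.reflection n = n + (-(2 * ⟪n, w⟫ / ‖w‖ ^ 2)) • w := by
  rw [Submodule.reflection_orthogonal_apply, Submodule.reflection_singleton_apply,
    real_inner_comm]
  simp only [RCLike.ofReal_real_eq_id, id]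
  module

/-- The uniform law on `[0, 1]`. -/
def unif : Measure ℝ := volume.restrict (Set.Icc 0 1)

instance : IsProbabilityMeasure unif := ⟨by simp [unif]⟩

lemma ae_unif : ∀ᵐ u ∂unif, u ∈ Set.Icc (0 : ℝ) 1 := ae_restrict_mem measurableSet_Icc

lemma unif_Iic (a : ℝ) : unif (Set.Iic a) = ENNReal.ofReal (min a 1) := by
  rw [unif, Measure.restrict_apply measurableSet_Iic]
  have : Set.Iic a ∩ Set.Icc 0 1 = Set.Icc 0 (min a 1) := by
    ext x; simp only [Set.mem_inter_iff, Set.mem_Iic, Set.mem_Icc, le_min_iff]; tauto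
  rw [this, Real.volume_Icc, sub_zero]

lemma unif_Ioi (a : ℝ) : unif (Set.Ioi a) = 1 - ENNReal.ofReal (min a 1) := by
  rw [← Set.compl_Iic, prob_compl_eq_one_sub measurableSet_Iic, unif_Iic]

lemma lintegral_reflNoise (w n : V) (s : V → ℝ≥0∞) :
    ∫⁻ u, s (reflNoise w n u) ∂unif = ENNReal.ofReal (min (shiftRatio w n) 1) * s (n + w)
      + (1 - ENNReal.ofReal (min (shiftRatio w n) 1)) * s ((ℝ ∙ w)ᗮ.reflection n) := by
  rw [← lintegral_add_compl _ (measurableSet_Iic (a := shiftRatio w n)), Set.compl_Iic]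
  congr 1
  · rw [setLIntegral_congr_fun measurableSet_Iic (g := fun _ => s (n + w))]
    · rw [setLIntegral_const, unif_Iic, mul_comm]
    · intro u hu
      simp only [reflNoise, reflCoeff, if_pos (Set.mem_Iic.1 hu), one_smul]
  · rw [setLIntegral_congr_fun measurableSet_Ioi (g := fun _ => s ((ℝ ∙ w)ᗮ.reflection n))]
    · rw [setLIntegral_const, unif_Ioi, mul_comm]
    · intro u hu
      simp only [reflNoise, reflCoeff, if_neg (not_le.2 (Set.mem_Ioi.1 hu)), reflection_eq]

/-- The coupled noise is again a standard Gaussian. -/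
lemma map_reflNoise (w : V) :
    ((stdGaussian V).prod unif).map (fun p => reflNoise w p.1 p.2) = stdGaussian V := by
  have hm : Measurable fun p : V × ℝ => reflNoise w p.1 p.2 :=
    measurable_reflNoise.comp (by fun_prop : Measurable fun p : V × ℝ => (w, p.1, p.2))
  set D : V → ℝ≥0∞ := fun v => ENNReal.ofReal (gaussDensity v) with hDdef
  have hD : Measurable D := continuous_gaussDensity.measurable.ennreal_ofReal
  set R : V ≃ₗᵢ[ℝ] V := (ℝ ∙ w)ᗮ.reflection with hR
  have hRw : R w = -w := Submodule.reflection_orthogonalComplement_singleton_eq_neg w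
  have hRR : ∀ n, R (R n) = n := fun n => Submodule.reflection_reflection _ n
  ext A hA
  set s : V → ℝ≥0∞ := A.indicator 1 with hs
  have hsm : Measurable s := measurable_one.indicator hA
  have e1 : ((stdGaussian V).prod unif).map (fun p => reflNoise w p.1 p.2) A
      = ∫⁻ n, ∫⁻ u, s (reflNoise w n u) ∂unif ∂(stdGaussian V) := by
    rw [← lintegral_indicator_one hA, lintegral_map hsm hm, lintegral_prod]
    exact (hsm.comp hm).aemeasurable
  have hp : Measurable fun n : V => shiftRatio w n := by unfold shiftRatio; fun_prop
  -- The acceptance probability times the density is min(D(n + w), D(n)): the overlap of the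
  -- Gaussian with its translate is shifted, the rest is reflected.
  have e2 : ∀ n, D n * (ENNReal.ofReal (min (shiftRatio w n) 1) * s (n + w)
      + (1 - ENNReal.ofReal (min (shiftRatio w n) 1)) * s (R n))
      = min (D (n + w)) (D n) * s (n + w) + (D n - min (D (n + w)) (D n)) * s (R n) := by
    intro n
    have h1 : D n * ENNReal.ofReal (min (shiftRatio w n) 1) = min (D (n + w)) (D n) := by
      rw [hDdef, ← ENNReal.ofReal_mul (gaussDensity_pos n).le,
        mul_min_of_nonneg _ _ (gaussDensity_pos n).le, mul_comm, shiftRatio_mul, mul_one,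
        (ENNReal.ofReal_mono).map_min]
    rw [mul_add, ← mul_assoc, ← mul_assoc, ENNReal.mul_sub (by simp [hDdef]), h1, mul_one]
  have hmin : Measurable fun n => min (D (n + w)) (D n) :=
    (hD.comp (measurable_add_const w)).min hD
  rw [e1]
  simp_rw [lintegral_reflNoise]
  rw [stdGaussian_eq_withDensity, lintegral_withDensity_eq_lintegral_mul _ hD]
  swap
  · refine Measurable.add ?_ ?_
    · exact ((hp.min measurable_const).ennreal_ofReal).mul (hsm.comp (measurable_add_const w))
    · exact (measurable_const.sub (hp.min measurable_const).ennreal_ofReal).mul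
        (hsm.comp R.continuous.measurable)
  simp only [Pi.mul_apply]
  simp_rw [← hR, e2]
  have hadd : ∫⁻ n, (min (D (n + w)) (D n) * s (n + w) + (D n - min (D (n + w)) (D n)) * s (R n))
      = (∫⁻ n, min (D (n + w)) (D n) * s (n + w))
        + ∫⁻ n, (D n - min (D (n + w)) (D n)) * s (R n) :=
    lintegral_add_left (show Measurable fun n => min (D (n + w)) (D n) * s (n + w) from
      hmin.mul (hsm.comp (measurable_add_const w))) _
  have e3 : ∫⁻ n, min (D (n + w)) (D n) * s (n + w) = ∫⁻ n, min (D n) (D (n - w)) * s n := by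
    rw [← lintegral_add_right_eq_self (fun n => min (D n) (D (n - w)) * s n) w]
    simp
  -- The reflection R preserves volume and D, and ‖R n - w‖ = ‖R(n + w)‖ = ‖n + w‖. So the reflected
  -- rest fills exactly what the shifted overlap leaves free.
  have e4 : ∫⁻ n, (D n - min (D (n + w)) (D n)) * s (R n)
      = ∫⁻ n, (D n - min (D (n - w)) (D n)) * s n := by
    have h0 := R.measurePreserving.lintegral_comp
      (show Measurable fun n => (D n - min (D (n - w)) (D n)) * s n from
        (hD.sub ((hD.comp (measurable_sub_const w)).min hD)).mul hsm)
    rw [← h0]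
    · refine lintegral_congr fun n => ?_
      have h1 : D (R n) = D n := by
        rw [hDdef]; exact congrArg _ (gaussDensity_eq_of_norm_eq (R.norm_map n))
      have h2 : D (R n - w) = D (n + w) := by
        rw [hDdef]
        refine congrArg _ (gaussDensity_eq_of_norm_eq ?_)
        rw [← R.norm_map (n + w), map_add, hRw, sub_eq_add_neg]
      rw [h1, h2]
  have e5 : (∫⁻ n, min (D n) (D (n - w)) * s n) + ∫⁻ n, (D n - min (D (n - w)) (D n)) * s n
      = ∫⁻ n, D n * s n := by
    rw [← lintegral_add_left (show Measurable fun n => min (D n) (D (n - w)) * s n from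
      (hD.min (hD.comp (measurable_sub_const w))).mul hsm)]
    refine lintegral_congr fun n => ?_
    rw [← add_mul, min_comm (D (n - w)), add_tsub_cancel_of_le (min_le_left _ _)]
  rw [hadd, e3, e4, e5, withDensity_apply _ hA, ← lintegral_indicator hA]
  refine lintegral_congr fun n => ?_
  by_cases hn : n ∈ A <;> simp [hs, hn, hDdef]

lemma integrable_inner_stdGaussian (w : V) : Integrable (fun n => ⟪n, w⟫) (stdGaussian V) := by
  have h1 := (IsGaussian.integrable_dual (stdGaussian V) (innerSL ℝ w))
  simpa [real_inner_comm] using h1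

lemma integral_inner_stdGaussian (w : V) : ∫ n, ⟪n, w⟫ ∂(stdGaussian V) = 0 := by
  have h1 := integral_strongDual_stdGaussian (E := V) (innerSL ℝ w)
  simpa [real_inner_comm] using h1

lemma map_inner_stdGaussian {w : V} (hw : ‖w‖ = 1) :
    (stdGaussian V).map (fun n => ⟪n, w⟫) = gaussianReal 0 1 := by
  have h1 := IsGaussian.map_eq_gaussianReal (μ := stdGaussian V) (innerSL ℝ w)
  rw [integral_strongDual_stdGaussian, variance_dual_stdGaussian, innerSL_apply_norm, hw] at h1
  simpa [real_inner_comm] using h1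

/-- The law of the pair driving the reflection coupling. -/
abbrev reflLaw (V : Type*) [NormedAddCommGroup V] [InnerProductSpace ℝ V] [FiniteDimensional ℝ V]
    [MeasurableSpace V] [BorelSpace V] : Measure (V × ℝ) := (stdGaussian V).prod unif

lemma reflCoeff_eq {w : V} (hw : w ≠ 0) (n : V) (u : ℝ) :
    reflCoeff w n u = (⟪reflNoise w n u, w⟫ - ⟪n, w⟫) / ‖w‖ ^ 2 := by
  have : ‖w‖ ^ 2 ≠ 0 := by simpa using hw
  rw [reflNoise, inner_add_left, real_inner_smul_left, real_inner_self_eq_norm_sq]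
  field_simp
  ring

lemma measurable_reflNoise_right (w : V) : Measurable fun p : V × ℝ => reflNoise w p.1 p.2 :=
  measurable_reflNoise.comp (by fun_prop : Measurable fun p : V × ℝ => (w, p.1, p.2))

lemma integrable_inner_reflNoise (w : V) :
    Integrable (fun p : V × ℝ => ⟪reflNoise w p.1 p.2, w⟫) (reflLaw V) := by
  have h1 := integrable_inner_stdGaussian w
  rw [← map_reflNoise w] at h1
  exact h1.comp_measurable (measurable_reflNoise_right w)

lemma integrable_inner_fst (w : V) :
    Integrable (fun p : V × ℝ => ⟪p.1, w⟫) (reflLaw V) :=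
  (integrable_inner_stdGaussian w).comp_fst _

lemma integrable_reflCoeff {w : V} (hw : w ≠ 0) :
    Integrable (fun p : V × ℝ => reflCoeff w p.1 p.2) (reflLaw V) := by
  simp_rw [reflCoeff_eq hw]
  exact ((integrable_inner_reflNoise w).sub (integrable_inner_fst w)).div_const _

/-- The noise and its coupled copy have the same law, so their components along w have the same
mean. -/
lemma integral_reflCoeff {w : V} (hw : w ≠ 0) :
    ∫ p : V × ℝ, reflCoeff w p.1 p.2 ∂(reflLaw V) = 0 := by
  simp_rw [reflCoeff_eq hw]
  rw [integral_div, integral_sub (integrable_inner_reflNoise w) (integrable_inner_fst w)]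
  have h1 : ∫ p : V × ℝ, ⟪reflNoise w p.1 p.2, w⟫ ∂(reflLaw V) = 0 := by
    rw [← integral_map (measurable_reflNoise_right w).aemeasurable (f := fun n => ⟪n, w⟫)
      (by fun_prop), map_reflNoise, integral_inner_stdGaussian]
  have h2 : ∫ p : V × ℝ, ⟪p.1, w⟫ ∂(reflLaw V) = 0 := by
    rw [integral_fun_fst (fun n => ⟪n, w⟫), integral_inner_stdGaussian, smul_zero]
  rw [h1, h2]; simp

/-- A rejection needs `shiftRatio` < u ≤ 1, that is -⟪n, w⟫ < ‖w‖²/2. This bounds the coefficient of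
the reflection, so the gap never changes direction. -/
lemma reflCoeff_le_one (w n : V) {u : ℝ} (hu : u ≤ 1) : reflCoeff w n u ≤ 1 := by
  unfold reflCoeff
  split_ifs with h
  · exact le_rfl
  · rcases eq_or_ne w 0 with rfl | hw
    · simp
    have hw' : 0 < ‖w‖ ^ 2 := by positivity
    have h1 : shiftRatio w n < Real.exp 0 := by rw [Real.exp_zero]; linarith [not_le.1 h]
    have h2 := Real.exp_lt_exp.1 h1
    rw [neg_le, le_div_iff₀ hw']
    linarith

lemma ae_reflCoeff_le_one (w : V) : ∀ᵐ p ∂(reflLaw V), reflCoeff w p.1 p.2 ≤ 1 := by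
  have h1 : ∀ᵐ p ∂(reflLaw V), p.2 ∈ Set.Icc (0 : ℝ) 1 :=
    Measure.quasiMeasurePreserving_snd.ae ae_unif
  filter_upwards [h1] with p hp
  exact reflCoeff_le_one _ _ hp.2

/-- Integrate over [1, 2], where the density is at least its value at 2. -/
lemma one_twentieth_le_gaussianReal : (1 / 20 : ℝ) ≤ (gaussianReal 0 1).real (Set.Ici 1) := by
  have h0 : (gaussianReal 0 1).real (Set.Icc 1 2) ≤ (gaussianReal 0 1).real (Set.Ici 1) :=
    measureReal_mono Set.Icc_subset_Ici_self
  refine le_trans ?_ h0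
  rw [measureReal_def, gaussianReal_apply_eq_integral _ one_ne_zero, ENNReal.toReal_ofReal
    (integral_nonneg fun x => gaussianPDFReal_nonneg _ _ _)]
  have h1 : ∀ x ∈ Set.Icc (1 : ℝ) 2, (1 / 20 : ℝ) ≤ gaussianPDFReal 0 1 x := by
    intro x hx
    rw [gaussianPDFReal]
    have hpi : √(2 * Real.pi * ((1 : NNReal) : ℝ)) ≤ 2.55 := by
      rw [Real.sqrt_le_left (by norm_num)]
      have := Real.pi_lt_d2
      norm_num at *
      linarith
    have hpos : 0 < √(2 * Real.pi * ((1 : NNReal) : ℝ)) := by positivity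
    have hexp : Real.exp (-2) ≤ Real.exp (-(x - 0) ^ 2 / (2 * ((1 : NNReal) : ℝ))) := by
      apply Real.exp_le_exp.2
      have : x ^ 2 ≤ 4 := by nlinarith [hx.1, hx.2]
      simp only [NNReal.coe_one]
      linarith
    have h2 : (1 / 7.5 : ℝ) ≤ Real.exp (-2) := by
      have h3 := Real.exp_one_lt_d9
      have h4 : Real.exp 2 ≤ 7.5 := by
        have : Real.exp 2 = Real.exp 1 * Real.exp 1 := by rw [← Real.exp_add]; norm_num
        rw [this]
        nlinarith [Real.exp_pos 1]
      rw [Real.exp_neg, one_div]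
      exact inv_anti₀ (Real.exp_pos _) h4
    have h5 : (1 / 2.55 : ℝ) ≤ (√(2 * Real.pi * ((1 : NNReal) : ℝ)))⁻¹ := by
      rw [one_div]; exact inv_anti₀ hpos hpi
    calc (1 / 20 : ℝ) ≤ 1 / 2.55 * (1 / 7.5) := by norm_num
      _ ≤ _ := mul_le_mul h5 (h2.trans hexp) (by norm_num) (by positivity)
  have h2 := setIntegral_mono_on (μ := volume) (s := Set.Icc (1 : ℝ) 2) (f := fun _ => (1 / 20 : ℝ))
    (g := gaussianPDFReal 0 1) (by simp) (integrable_gaussianPDFReal 0 1).integrableOn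
    measurableSet_Icc h1
  refine le_trans (le_of_eq ?_) h2
  simp
  norm_num

lemma one_twentieth_le_stdGaussian {w : V} (hw : w ≠ 0) :
    (1 / 20 : ℝ) ≤ (stdGaussian V).real {n | ‖w‖ ≤ ⟪n, w⟫} := by
  have hw' : 0 < ‖w‖ := norm_pos_iff.2 hw
  have h1 := map_inner_stdGaussian (w := ‖w‖⁻¹ • w) (by
    rw [norm_smul, norm_inv, norm_norm, inv_mul_cancel₀ hw'.ne'])
  have h2 := one_twentieth_le_gaussianReal
  rw [← h1, measureReal_def, Measure.map_apply (by fun_prop) measurableSet_Ici] at h2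
  refine h2.trans_eq ?_
  rw [measureReal_def]
  congr 2
  ext n
  simp only [Set.mem_preimage, Set.mem_Ici, Set.mem_ofPred_eq, real_inner_smul_right]
  rw [inv_mul_eq_div, le_div_iff₀ hw', one_mul]

lemma one_twentieth_le_reflLaw {w : V} (hw : w ≠ 0) :
    (1 / 20 : ℝ) ≤ (reflLaw V).real {p | ⟪p.1, w⟫ ≤ -‖w‖} := by
  have h1 := one_twentieth_le_stdGaussian (neg_ne_zero.2 hw)
  have h2 : {p : V × ℝ | ⟪p.1, w⟫ ≤ -‖w‖} = {n : V | ‖-w‖ ≤ ⟪n, -w⟫} ×ˢ Set.univ := by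
    ext p; simp [le_neg]
  rw [h2, measureReal_prod_prod]
  simpa using h1

lemma one_sub_exp_ge {a : ℝ} (ha : 0 ≤ a) (ha1 : a ≤ 1) :
    3 / 5 * a ≤ 1 - Real.exp (-a - a ^ 2 / 2) := by
  have h1 : 1 + a + a ^ 2 / 2 ≤ Real.exp (a + a ^ 2 / 2) := by
    linarith [Real.add_one_le_exp (a + a ^ 2 / 2)]
  have h2 : Real.exp (-a - a ^ 2 / 2) = (Real.exp (a + a ^ 2 / 2))⁻¹ := by
    rw [← Real.exp_neg]; congr 1; ring
  have h3 : (Real.exp (a + a ^ 2 / 2))⁻¹ ≤ (1 + a + a ^ 2 / 2)⁻¹ :=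
    inv_anti₀ (by positivity) h1
  have h4 : (1 + a + a ^ 2 / 2)⁻¹ ≤ 1 - 3 / 5 * a := by
    rw [inv_le_iff_one_le_mul₀ (by positivity)]
    nlinarith [mul_nonneg ha (sub_nonneg.2 ha1), mul_nonneg (sq_nonneg a) (sub_nonneg.2 ha1)]
  rw [h2]; linarith

/-- A product of independent events with probabilities at least 1/20 and 3/5‖w‖. On it `shiftRatio`
is at most exp(-‖w‖ - ‖w‖²/2), so the shift is rejected. -/
lemma reflLaw_reject_ge {w : V} (hw : w ≠ 0) (hw1 : ‖w‖ ≤ 1) :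
    3 / 100 * ‖w‖ ≤ (reflLaw V).real
      {p | ‖w‖ ≤ ⟪p.1, w⟫ ∧ Real.exp (-‖w‖ - ‖w‖ ^ 2 / 2) < p.2} := by
  have h2 : {p : V × ℝ | ‖w‖ ≤ ⟪p.1, w⟫ ∧ Real.exp (-‖w‖ - ‖w‖ ^ 2 / 2) < p.2}
      = {n : V | ‖w‖ ≤ ⟪n, w⟫} ×ˢ Set.Ioi (Real.exp (-‖w‖ - ‖w‖ ^ 2 / 2)) := by
    ext p; simp
  have h3 : Real.exp (-‖w‖ - ‖w‖ ^ 2 / 2) ≤ 1 :=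
    Real.exp_le_one_iff.2 (by nlinarith [norm_nonneg w])
  have h4 : unif.real (Set.Ioi (Real.exp (-‖w‖ - ‖w‖ ^ 2 / 2)))
      = 1 - Real.exp (-‖w‖ - ‖w‖ ^ 2 / 2) := by
    rw [measureReal_def, unif_Ioi, min_eq_left h3, ENNReal.toReal_sub_of_le (by simpa using h3)
      (by simp), ENNReal.toReal_ofReal (Real.exp_pos _).le, ENNReal.toReal_one]
  rw [h2, measureReal_prod_prod, h4]
  have h5 := one_twentieth_le_stdGaussian hw
  have h6 := one_sub_exp_ge (norm_nonneg w) hw1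
  calc 3 / 100 * ‖w‖ = 1 / 20 * (3 / 5 * ‖w‖) := by ring
    _ ≤ _ := mul_le_mul h5 h6 (by positivity) measureReal_nonneg

/-- On the event where the noise points far against `w`, the gap closes. -/
lemma min_le_reflCoeff {w n : V} (hw : w ≠ 0) (hn : ⟪n, w⟫ ≤ -‖w‖) (u : ℝ) :
    min ‖w‖ 2 ≤ reflCoeff w n u * ‖w‖ := by
  have hw' : 0 < ‖w‖ := norm_pos_iff.2 hw
  unfold reflCoeff
  split_ifs
  · simp
  · refine (min_le_right _ _).trans ?_
    have : -(2 * ⟪n, w⟫ / ‖w‖ ^ 2) * ‖w‖ = 2 * (-⟪n, w⟫) / ‖w‖ := by field_simp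
    rw [this, le_div_iff₀ hw']
    linarith

/-- On the event of a rejected shift and noise far along `w`, the gap opens. -/
lemma reflCoeff_le {w n : V} {u : ℝ} (hw : w ≠ 0) (hn : ‖w‖ ≤ ⟪n, w⟫)
    (hu : Real.exp (-‖w‖ - ‖w‖ ^ 2 / 2) < u) : reflCoeff w n u * ‖w‖ ≤ -2 := by
  have hw' : 0 < ‖w‖ := norm_pos_iff.2 hw
  have h1 : shiftRatio w n < u := by
    refine lt_of_le_of_lt (Real.exp_le_exp.2 ?_) hu
    linarith
  unfold reflCoeff
  rw [if_neg (not_le.2 h1)]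
  have : -(2 * ⟪n, w⟫ / ‖w‖ ^ 2) * ‖w‖ = -(2 * ⟪n, w⟫ / ‖w‖) := by field_simp
  rw [this, neg_le_neg_iff, le_div_iff₀ hw']
  linarith

end GaussianCoupling

end KineticLangevin
end

/-! ### Coupled steps in the coordinates z and z + p. -/

noncomputable section

namespace KineticLangevin

open scoped RealInnerProductSpace ENNReal

/-- Four vectors in `ℝ^d`, as a Euclidean space. -/
abbrev Noise (d : ℕ) := PiLp 2 fun _ : Fin 4 => E d

lemma map_toLp_noiseLaw (d : ℕ) :
    (noiseLaw d).map (WithLp.toLp 2) = stdGaussian (Noise d) := by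
  have : IsFiniteMeasure (noiseLaw d) := by unfold noiseLaw; infer_instance
  refine Measure.ext_of_charFun ?_
  ext t
  rw [noiseLaw, charFun_pi, charFun_stdGaussian]
  simp_rw [charFun_stdGaussian]
  rw [← Complex.exp_sum, ← Complex.ofReal_pow, PiLp.norm_sq_eq_of_L2]
  congr 1
  push_cast
  rw [← Finset.sum_div, Finset.sum_neg_distrib]

lemma map_ofLp_stdGaussian (d : ℕ) :
    (stdGaussian (Noise d)).map WithLp.ofLp = noiseLaw d := by
  rw [← map_toLp_noiseLaw, Measure.map_map (by fun_prop) (by fun_prop)]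
  exact Measure.map_id

/-! ### Differences of two coupled steps -/

section Step

variable {d : ℕ} {U : E d → ℝ} {γ h t : ℝ}

lemma eta_lt_one (hγ : 0 < γ) (ht : 0 < t) : eta γ t < 1 := by
  rw [eta, Real.exp_lt_one_iff]; nlinarith [mul_pos hγ ht]

lemma eta_pos (γ t : ℝ) : 0 < eta γ t := Real.exp_pos _

/-- The second Gaussian is shared and drops out. The product of the two square roots is the root of
a perfect square. -/
lemma noise2_sub (hγ : 0 < γ) (ht : 0 < t) (ξ ξ' ζ : E d) :
    noise2 γ t ξ ζ - noise2 γ t ξ' ζ = ((1 - eta γ t) / (γ * √t)) • (ξ - ξ') := by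
  have h1 := eta_lt_one hγ ht
  have h2 := eta_pos γ t
  have h3 : √((1 - eta γ t ^ 2) / (2 * γ)) * √((1 - eta γ t) / (1 + eta γ t) * (2 / (γ * t)))
      = (1 - eta γ t) / (γ * √t) := by
    rw [← Real.sqrt_mul (by
      have : eta γ t ^ 2 ≤ 1 := by nlinarith
      exact div_nonneg (by linarith) (by linarith))]
    rw [Real.sqrt_eq_iff_mul_self_eq
      (mul_nonneg (div_nonneg (by nlinarith) (by linarith))
        (mul_nonneg (div_nonneg (by linarith) (by linarith)) (by positivity)))
      (div_nonneg (by linarith) (by positivity))]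
    have h4 : √t * √t = t := Real.mul_self_sqrt ht.le
    have h5 : (1 - eta γ t) / (γ * √t) * ((1 - eta γ t) / (γ * √t))
      = (1 - eta γ t) ^ 2 / (γ ^ 2 * (√t * √t)) := by ring
    rw [h5, h4]
    have : 1 + eta γ t ≠ 0 := by positivity
    field_simp
    ring
  rw [noise2, noise2, ← h3]
  module

lemma sqrt_two_div (hγ : 0 < γ) : γ⁻¹ * √(2 * γ) = √(2 / γ) := by
  rw [eq_comm, Real.sqrt_eq_iff_mul_self_eq (by positivity) (by positivity)]
  have : √(2 * γ) * √(2 * γ) = 2 * γ := Real.mul_self_sqrt (by positivity)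
  have h2 : γ⁻¹ * √(2 * γ) * (γ⁻¹ * √(2 * γ)) = γ⁻¹ ^ 2 * (√(2 * γ) * √(2 * γ)) := by ring
  rw [h2, this]
  field_simp

end Step

namespace Data

variable {d : ℕ} {S : Data d} {U G : E d → ℝ} {h t : ℝ}

lemma dp_stepU (hγ : 0 < S.γ) (ht : 0 < t) (ξ ξ' ζ : E d) (a b : Phase d) :
    S.dp (stepU S.γ t ξ ζ a) (stepU S.γ t ξ' ζ b) = eta S.γ t • S.dp a b
      + (√(2 / S.γ) * ((1 - eta S.γ t) / (S.γ * √t))) • (ξ - ξ') := by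
  have h1 := noise2_sub hγ ht ξ ξ' ζ
  have h2 : S.dp (stepU S.γ t ξ ζ a) (stepU S.γ t ξ' ζ b) = eta S.γ t • S.dp a b
      + (S.γ⁻¹ * √(2 * S.γ)) • (noise2 S.γ t ξ ζ - noise2 S.γ t ξ' ζ) := by
    simp only [dp, stepU]; module
  rw [h2, h1, sqrt_two_div hγ, smul_smul]

/-- Under the flow x + v/γ is a Brownian motion without friction: both the damping and the second
increment cancel in this sum. -/
lemma dz_add_dp_stepU (hγ : 0 < S.γ) (ξ ξ' ζ : E d) (a b : Phase d) :
    dz (stepU S.γ t ξ ζ a) (stepU S.γ t ξ' ζ b)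
      + S.dp (stepU S.γ t ξ ζ a) (stepU S.γ t ξ' ζ b)
      = dz a b + S.dp a b + (√(2 / S.γ) * √t) • (ξ - ξ') := by
  have h1 := sqrt_two_div hγ
  have h2 : dz (stepU S.γ t ξ ζ a) (stepU S.γ t ξ' ζ b)
      + S.dp (stepU S.γ t ξ ζ a) (stepU S.γ t ξ' ζ b)
      = dz a b + ((1 - eta S.γ t) / S.γ + S.γ⁻¹ * eta S.γ t) • (a.2 - b.2)
        + (√(2 / S.γ) * √t) • (ξ - ξ')
        + (S.γ⁻¹ * √(2 * S.γ) - √(2 / S.γ)) • (noise2 S.γ t ξ ζ - noise2 S.γ t ξ' ζ) := by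
    simp only [dz, dp, stepU, noise1]; module
  rw [h2, h1, sub_self, zero_smul, add_zero]
  have h3 : (1 - eta S.γ t) / S.γ + S.γ⁻¹ * eta S.γ t = S.γ⁻¹ := by field_simp; ring
  rw [h3]
  simp only [dp]

/-- The step `𝓑` followed by two half steps `𝓤`. -/
def stepQ (S : Data d) (U : E d → ℝ) (h : ℝ) (z : Phase d) (ξ : Fin 4 → E d) : Phase d :=
  stepU S.γ (h / 2) (ξ 2) (ξ 3) (stepU S.γ (h / 2) (ξ 0) (ξ 1) (stepB U h z))

/-- The scale of the noise. -/
def σ (S : Data d) (h : ℝ) : ℝ := √(2 * h / S.γ)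

lemma σ_pos (hγ : 0 < S.γ) (hh : 0 < h) : 0 < S.σ h := Real.sqrt_pos.2 (by positivity)

lemma σ_sq (hγ : 0 < S.γ) (hh : 0 < h) : S.σ h ^ 2 = 2 * h / S.γ := Real.sq_sqrt (by positivity)

/-- The displacement of the noise that closes the gap `y` in the coordinate `z + p`. -/
def shiftVec (S : Data d) (h : ℝ) (y : E d) : Noise d :=
  WithLp.toLp 2 ![(√2 * S.σ h)⁻¹ • y, 0, (√2 * S.σ h)⁻¹ • y, 0]

lemma norm_shiftVec (hγ : 0 < S.γ) (hh : 0 < h) (y : E d) :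
    ‖S.shiftVec h y‖ = ‖y‖ / S.σ h := by
  have hσ := σ_pos hγ hh
  rw [← sq_eq_sq₀ (norm_nonneg _) (by positivity), PiLp.norm_sq_eq_of_L2, Fin.sum_univ_four]
  simp only [shiftVec, Matrix.cons_val, norm_smul, norm_zero, norm_inv, norm_mul, Real.norm_eq_abs,
    abs_of_pos hσ, abs_of_nonneg (Real.sqrt_nonneg 2)]
  have : (√2 : ℝ) ^ 2 = 2 := Real.sq_sqrt (by norm_num)
  rw [mul_pow, inv_pow, mul_pow, this]
  field_simp
  ring

lemma sqrt_mul_sqrt_half (hγ : 0 < S.γ) (hh : 0 < h) :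
    √(2 / S.γ) * √(h / 2) = S.σ h * √2 / 2 := by
  have h2 : (√2 : ℝ) * √2 = 2 := Real.mul_self_sqrt (by norm_num)
  rw [← Real.sqrt_mul (by positivity), Real.sqrt_eq_iff_mul_self_eq (by positivity)
    (by have := σ_pos hγ hh; positivity)]
  have h3 := σ_sq hγ hh
  have h4 : S.σ h * √2 / 2 * (S.σ h * √2 / 2) = S.σ h ^ 2 * (√2 * √2) / 4 := by ring
  rw [h4, h2, h3]
  field_simp
  ring

lemma dz_add_dp_stepQ (hγ : 0 < S.γ) (hh : 0 < h) (n : Noise d) (s : ℝ) (y : E d)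
    (a b : Phase d) :
    dz (S.stepQ U h a n.ofLp) (S.stepQ U h b (n + s • S.shiftVec h y).ofLp)
      + S.dp (S.stepQ U h a n.ofLp) (S.stepQ U h b (n + s • S.shiftVec h y).ofLp)
      = dz (stepB U h a) (stepB U h b) + S.dp (stepB U h a) (stepB U h b) - s • y := by
  have hσ := σ_pos hγ hh
  have e1 : (n + s • S.shiftVec h y).ofLp 1 = n.ofLp 1 := by simp [shiftVec]
  have e3 : (n + s • S.shiftVec h y).ofLp 3 = n.ofLp 3 := by simp [shiftVec]
  have e0 : n.ofLp 0 - (n + s • S.shiftVec h y).ofLp 0 = -(s * (√2 * S.σ h)⁻¹) • y := by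
    simp [shiftVec, smul_smul]
  have e2 : n.ofLp 2 - (n + s • S.shiftVec h y).ofLp 2 = -(s * (√2 * S.σ h)⁻¹) • y := by
    simp [shiftVec, smul_smul]
  rw [stepQ, stepQ, e1, e3, dz_add_dp_stepU hγ, dz_add_dp_stepU hγ,
    e0, e2, sqrt_mul_sqrt_half hγ hh, smul_smul, add_assoc, ← add_smul, sub_eq_add_neg, ← neg_smul]
  congr 2
  field_simp
  ring

/-- Two half flights with the same displacement act like one flight over h, since (1 + η)(1 - η)
with η at h/2 equals 1 minus the value at h. -/
lemma dp_stepQ (hγ : 0 < S.γ) (hh : 0 < h) (n : Noise d) (s : ℝ) (y : E d) (a b : Phase d) :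
    S.dp (S.stepQ U h a n.ofLp) (S.stepQ U h b (n + s • S.shiftVec h y).ofLp)
      = eta S.γ h • S.dp (stepB U h a) (stepB U h b)
        - (s * ((1 - eta S.γ h) / (S.γ * h))) • y := by
  have hσ := σ_pos hγ hh
  have e1 : (n + s • S.shiftVec h y).ofLp 1 = n.ofLp 1 := by simp [shiftVec]
  have e3 : (n + s • S.shiftVec h y).ofLp 3 = n.ofLp 3 := by simp [shiftVec]
  have e0 : n.ofLp 0 - (n + s • S.shiftVec h y).ofLp 0 = -(s * (√2 * S.σ h)⁻¹) • y := by
    simp [shiftVec, smul_smul]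
  have e2 : n.ofLp 2 - (n + s • S.shiftVec h y).ofLp 2 = -(s * (√2 * S.σ h)⁻¹) • y := by
    simp [shiftVec, smul_smul]
  have hη : eta S.γ h = eta S.γ (h / 2) * eta S.γ (h / 2) := by
    rw [eta, eta, ← Real.exp_add]; congr 1; ring
  have hk : √(2 / S.γ) * ((1 - eta S.γ (h / 2)) / (S.γ * √(h / 2)))
      = (1 - eta S.γ (h / 2)) * (S.σ h * √2) / (S.γ * h) := by
    have h1 := sqrt_mul_sqrt_half hγ hh
    have h2 : √(h / 2) * √(h / 2) = h / 2 := Real.mul_self_sqrt (by positivity)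
    have h3 : 0 < √(h / 2) := Real.sqrt_pos.2 (by positivity)
    have h4 : √(2 / S.γ) = S.σ h * √2 / 2 / √(h / 2) := by rw [eq_div_iff h3.ne', h1]
    rw [h4, div_mul_div_comm, mul_left_comm, h2]
    field_simp
  rw [stepQ, stepQ, e1, e3, dp_stepU hγ (half_pos hh), dp_stepU hγ (half_pos hh),
    e0, e2, hk, hη]
  set η := eta S.γ (h / 2)
  have h5 : (1 - η) * (S.σ h * √2) / (S.γ * h) * -(s * (√2 * S.σ h)⁻¹)
      = -(s * ((1 - η) / (S.γ * h))) := by field_simp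
  have h6 : s * ((1 - η * η) / (S.γ * h)) = (1 + η) * (s * ((1 - η) / (S.γ * h))) := by ring
  rw [smul_smul, h5, h6]
  module

lemma dz_stepB (a b : Phase d) : dz (stepB U h a) (stepB U h b) = dz a b := rfl

lemma dp_stepB (a b : Phase d) : S.dp (stepB U h a) (stepB U h b)
    = S.dp a b - (S.γ⁻¹ * h) • (gradient U a.1 - gradient U b.1) := by
  simp only [dp, stepB]; module

/-- The expected value of the concave function after a reflection coupled step. -/
lemma StepBounds.reflCoeff_expectation_le {δ e θ x q : ℝ} (H : StepBounds S (S.σ h) δ e θ)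
    (hU : S.IsPotential U G) (hγ : 0 < S.γ) (hh : 0 < h)
    (hx : 0 ≤ x) (hq : 0 < q) (hxq : x ≤ 4 * q) (hr : S.α * x + q ≤ S.R₁) (y : E d)
    (hQ1 : ‖y‖ ≤ q + S.α * δ / 2 * x) (hQ2 : q ≤ ‖y‖ + S.α * δ / 2 * x) :
    ∫⁻ ω, ENNReal.ofReal (S.f (S.α * (1 - e) * x + S.α * (e + δ / 2) * ‖y‖
      + (1 + S.α * δ / 2) * ((1 - reflCoeff (S.shiftVec h y) ω.1 ω.2) * ‖y‖)))
        ∂(reflLaw (Noise d))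
      ≤ ENNReal.ofReal ((1 - θ) * S.f (S.α * x + q)) := by
  have hσ := H.σ_pos
  -- For y = 0 there is nothing to shift and s is multiplied by ‖y‖ = 0, so s = 0 may be taken.
  rcases eq_or_ne y 0 with rfl | hy
  · have := H.expectation_f_le (P := reflLaw (Noise d)) hU hγ hx hq hxq hr (norm_nonneg (0 : E d))
      hQ1 hQ2 (s := fun _ => 0) (by simp) (integrable_const _) (by simp)
      (D₁ := Set.univ) (D₂ := ∅) MeasurableSet.univ MeasurableSet.empty (by simp; norm_num)
      (by simp) (by simp [hσ.le]) (by simp)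
    simpa using this
  · have hw := norm_shiftVec hγ hh y
    have hyn : 0 < ‖y‖ := norm_pos_iff.2 hy
    have hw0 : S.shiftVec h y ≠ 0 := by
      rw [← norm_pos_iff, hw]; positivity
    have hyw : ‖y‖ = ‖S.shiftVec h y‖ * S.σ h := by rw [hw]; field_simp
    refine H.expectation_f_le (P := reflLaw (Noise d)) hU hγ hx hq hxq hr (norm_nonneg y)
      hQ1 hQ2 (ae_reflCoeff_le_one _) (integrable_reflCoeff hw0) (integral_reflCoeff hw0)
      ?_ ?_ (one_twentieth_le_reflLaw hw0) ?_ ?_ ?_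
      (D₂ := {p | ‖S.shiftVec h y‖ ≤ ⟪p.1, S.shiftVec h y⟫ ∧
        Real.exp (-‖S.shiftVec h y‖ - ‖S.shiftVec h y‖ ^ 2 / 2) < p.2})
    · exact measurableSet_le (by fun_prop) (by fun_prop)
    · have h1 : MeasurableSet {p : Noise d × ℝ | ‖S.shiftVec h y‖ ≤ ⟪p.1, S.shiftVec h y⟫} :=
        measurableSet_le (by fun_prop) (by fun_prop)
      have h2 : MeasurableSet {p : Noise d × ℝ |
          Real.exp (-‖S.shiftVec h y‖ - ‖S.shiftVec h y‖ ^ 2 / 2) < p.2} :=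
        measurableSet_lt (by fun_prop) (by fun_prop)
      exact h1.inter h2
    · intro hyσ
      rw [← hw]
      exact reflLaw_reject_ge hw0 (by rw [hw, div_le_one hσ]; exact hyσ)
    · refine .of_forall fun ω hω => ?_
      have := mul_le_mul_of_nonneg_right (min_le_reflCoeff hw0 hω ω.2) hσ.le
      rw [min_mul_of_nonneg _ _ hσ.le] at this
      rw [hyw, ← mul_assoc]
      exact this
    · refine .of_forall fun ω hω => ?_
      have := mul_le_mul_of_nonneg_right (reflCoeff_le hw0 hω.1 hω.2) hσ.le
      rw [hyw, ← mul_assoc]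
      linarith

end Data

end KineticLangevin
end

/-! ### Verification of the constants, and contraction of ρ by one coupled step. -/

noncomputable section

namespace KineticLangevin

open scoped RealInnerProductSpace ENNReal

namespace Data

variable {d : ℕ} {S : Data d} {U G : E d → ℝ} {h : ℝ}

/-- Because (1 - x + x²/2)(1 + x + x²/2) = 1 + x⁴/4 ≥ 1. -/
lemma exp_neg_le {x : ℝ} (hx : 0 ≤ x) : Real.exp (-x) ≤ 1 - x + x ^ 2 / 2 := by
  have h1 := Real.quadratic_le_exp_of_nonneg hx
  rw [Real.exp_neg, inv_le_iff_one_le_mul₀ (Real.exp_pos x)]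
  have h2 : 0 ≤ 1 - x + x ^ 2 / 2 := by nlinarith [sq_nonneg (x - 1)]
  have h3 := mul_le_mul_of_nonneg_left h1 h2
  have h4 : (1 - x + x ^ 2 / 2) * (1 + x + x ^ 2 / 2) = 1 + x ^ 4 / 4 := by ring
  have h5 : 0 ≤ x ^ 4 := by positivity
  linarith

lemma one_sub_eta_le (γ h : ℝ) : 1 - eta γ h ≤ γ * h := by
  have := Real.add_one_le_exp (-(γ * h))
  rw [eta]; linarith

/-- The standing assumptions on the potential, the friction and the step size. -/
structure Admissible (S : Data d) (U G : E d → ℝ) (h : ℝ) : Prop where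
  potential : S.IsPotential U G
  γ_pos : 0 < S.γ
  h_pos : 0 < h
  friction : S.LargeFriction
  step : S.SmallStep h

namespace Admissible

lemma δ_pos (H : S.Admissible U G h) : 0 < S.γ * h := mul_pos H.γ_pos H.h_pos

lemma δ_le (H : S.Admissible U G h) : S.γ * h ≤ 1 / 15 := by
  have h1 := H.step.2.2.1
  have hL := H.potential.L_pos
  have hγ := H.γ_pos
  have h2 : S.L * S.γ⁻¹ * h = S.L * S.γ⁻¹ ^ 2 * (S.γ * h) := by field_simp
  have h3 : S.L * S.γ⁻¹ ^ 2 / 15 = S.L * S.γ⁻¹ ^ 2 * (1 / 15) := by ring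
  rw [h2, h3] at h1
  exact le_of_mul_le_mul_left h1 (by positivity)

lemma δ_mul_Λ_le (H : S.Admissible U G h) : S.γ * h * S.Λ ≤ 1 / 55 := by
  have h1 := H.step.2.2.2
  have hL := H.potential.L_pos
  have hLK := H.potential.LK_pos
  have hγ := H.γ_pos
  rw [le_div_iff₀ (by positivity)] at h1
  have h2 : S.L * S.γ⁻¹ * h * (55 * S.LK) = S.L * (55 * (S.γ * h * S.Λ)) := by
    rw [Λ]; field_simp
  rw [h2] at h1
  have := le_of_mul_le_mul_left (h1.trans_eq (mul_one _).symm) hL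
  linarith

lemma small (H : S.Admissible U G h) : S.α * (S.γ * h) * (S.α + 1) ≤ 1 / 9600 := by
  have h1 := H.step.2.1
  have hL := H.potential.L_pos
  have hγ := H.γ_pos
  rw [le_div_iff₀ (by positivity)] at h1
  have h2 : S.α * (S.γ * h) * (S.α + 1)
      = S.L * S.γ⁻¹ * h * (256 * 75 * (2 * S.L * S.γ⁻¹ ^ 2 + 1)) / 9600 := by
    rw [α]; field_simp; ring
  rw [h2]
  linarith

lemma A_mul_σ_sq (H : S.Admissible U G h) : S.A * S.σ h ^ 2 = 128 * (S.α * (S.γ * h)) := by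
  have hγ := H.γ_pos
  rw [σ_sq hγ H.h_pos, A]
  field_simp
  ring

lemma B_mul_σ_sq (H : S.Admissible U G h) : S.B * S.σ h ^ 2 = S.cHat * h := by
  have hγ := H.γ_pos
  rw [σ_sq hγ H.h_pos, B]
  field_simp

lemma radius (H : S.Admissible U G h) : S.A * S.σ h * S.R₁ ≤ 64 := by
  have h1 := H.step.1
  have hγ := H.γ_pos
  have h2 : (S.A * S.σ h * S.R₁) ^ 2
      = 64 ^ 2 * (S.L * S.γ⁻¹ * h * (8 * S.L * S.R₁ ^ 2)) := by
    rw [mul_pow, mul_pow, σ_sq hγ H.h_pos, A, α]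
    field_simp
    ring
  refine abs_le_of_sq_le_sq' ?_ (by norm_num) |>.2
  rw [h2]
  linarith

lemma le_one_sub_eta (H : S.Admissible U G h) :
    S.γ * h - (S.γ * h) ^ 2 / 2 ≤ 1 - eta S.γ h := by
  have := exp_neg_le H.δ_pos.le
  rw [eta]; linarith

lemma cHat_pos (H : S.Admissible U G h) (hR : 0 < S.R₁) : 0 < S.cHat :=
  one_div_pos.2 (mul_pos H.γ_pos (J_pos H.potential H.γ_pos hR))

lemma rateBase_pos (H : S.Admissible U G h) : 0 < S.rateBase h := by
  have h1 := fPrime_pos H.potential H.γ_pos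
  have h2 := ε_pos H.potential H.γ_pos
  have h3 := calE_nonneg H.potential H.γ_pos
  have h4 := α_pos H.potential H.γ_pos
  have h5 := H.γ_pos
  have h6 := H.potential.kappa_pos
  refine lt_min ?_ (lt_min ?_ (lt_min ?_ ?_)) <;> positivity

lemma rate_pos (H : S.Admissible U G h) : 0 < S.rate h := by
  have h1 := H.rateBase_pos
  have h4 := α_pos H.potential H.γ_pos
  rw [rate]
  split_ifs with hR
  · exact h1
  · have h2 := H.cHat_pos (lt_of_le_of_ne (R₁_nonneg H.potential H.γ_pos) (Ne.symm hR))
    refine lt_min h1 (lt_min ?_ ?_) <;> positivity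

lemma rate_le_rateBase (S : Data d) (h : ℝ) : S.rate h ≤ S.rateBase h := by
  rw [rate]
  split_ifs
  · exact le_rfl
  · exact min_le_left _ _

/-- The first two terms of the rate answer to the two values that the minimum in τ can take. -/
lemma rate_le_energy (H : S.Admissible U G h) :
    S.rate h ≤ S.fPrime * S.ε * (7 / 24 * S.τ * S.γ) * S.calE := by
  have h0 := rate_le_rateBase S h
  have hγ := H.γ_pos
  have h1 : S.rate h ≤ S.fPrime * (7 * S.ε * S.κ * S.γ⁻¹ / 96) * S.calE :=
    h0.trans (min_le_left _ _)
  have h2 : S.rate h ≤ S.fPrime * (7 * S.ε * S.γ / 256) * S.calE :=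
    h0.trans ((min_le_right _ _).trans (min_le_left _ _))
  have h3 := fPrime_pos H.potential H.γ_pos
  have h4 := ε_pos H.potential H.γ_pos
  have h5 := calE_nonneg H.potential H.γ_pos
  rw [τ]
  rcases min_cases (1 / 8) (S.γ⁻¹ ^ 2 * S.κ / 4) with ⟨h6, -⟩ | ⟨h6, -⟩
  · rw [h6]
    refine h2.trans ?_
    have : 0 ≤ S.fPrime * S.ε * S.γ * S.calE := by positivity
    linarith
  · rw [h6]
    refine h1.trans (le_of_eq ?_)
    field_simp
    ring

lemma rate_le_flow (S : Data d) (h : ℝ) :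
    S.rate h ≤ S.fPrime * Real.exp (-(S.γ * h)) * (S.γ / 16) ∧
    S.rate h ≤ S.fPrime * Real.exp (-(S.γ * h)) * (S.γ * S.α / 4) := by
  have h0 := rate_le_rateBase S h
  exact ⟨h0.trans ((min_le_right _ _).trans ((min_le_right _ _).trans (min_le_left _ _))),
    h0.trans ((min_le_right _ _).trans ((min_le_right _ _).trans (min_le_right _ _)))⟩

lemma rate_mul_le (H : S.Admissible U G h) :
    S.rate h * h ≤ S.fPrime * (S.γ * h / 16) ∧ S.rate h * h ≤ S.fPrime * (S.γ * h * S.α / 4) := by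
  obtain ⟨h1, h2⟩ := rate_le_flow S h
  have h3 := fPrime_pos H.potential H.γ_pos
  have h4 := α_pos H.potential H.γ_pos
  have h5 := H.γ_pos
  have h6 := H.h_pos
  have he : Real.exp (-(S.γ * h)) ≤ 1 := Real.exp_le_one_iff.2 (by linarith [H.δ_pos])
  constructor
  · calc S.rate h * h ≤ S.fPrime * Real.exp (-(S.γ * h)) * (S.γ / 16) * h := by gcongr
      _ ≤ S.fPrime * 1 * (S.γ / 16) * h := by gcongr
      _ = _ := by ring
  · calc S.rate h * h ≤ S.fPrime * Real.exp (-(S.γ * h)) * (S.γ * S.α / 4) * h := by gcongr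
      _ ≤ S.fPrime * 1 * (S.γ * S.α / 4) * h := by gcongr
      _ = _ := by ring

lemma fPrime_le_one (H : S.Admissible U G h) : S.fPrime ≤ 1 := by
  rw [fPrime_eq]
  exact F_le_one H.potential H.γ_pos (R₁_nonneg H.potential H.γ_pos)

lemma rate_mul_le_one (H : S.Admissible U G h) : S.rate h * h ≤ 1 := by
  have h1 := H.rate_mul_le.1
  have h2 := H.δ_le
  have h3 := H.fPrime_le_one
  have h4 := fPrime_pos H.potential H.γ_pos
  nlinarith [H.δ_pos]

lemma stepBounds (H : S.Admissible U G h) (hR : 0 < S.R₁) :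
    StepBounds S (S.σ h) (S.γ * h) (1 - eta S.γ h) (S.rate h * h) := by
  have hα := α_pos H.potential H.γ_pos
  have h1 : S.rate h ≤ 9 * S.cHat / 640 ∧ S.rate h ≤ S.cHat / (32 * (4 * S.α + 1)) := by
    rw [rate, if_neg hR.ne']
    exact ⟨(min_le_right _ _).trans (min_le_left _ _), (min_le_right _ _).trans (min_le_right _ _)⟩
  have hh := H.h_pos
  exact
    { σ_pos := Data.σ_pos H.γ_pos H.h_pos
      δ_pos := H.δ_pos
      δ_le := H.δ_le
      le_e := H.le_one_sub_eta
      e_le := (one_sub_eta_le S.γ h)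
      A_mul := H.A_mul_σ_sq
      small := H.small
      radius := H.radius
      θ_nonneg := (mul_pos H.rate_pos H.h_pos).le
      θ_le₁ := by
        rw [H.B_mul_σ_sq]
        linarith [mul_le_mul_of_nonneg_right h1.1 hh.le]
      θ_le₂ := by
        rw [H.B_mul_σ_sq]
        have h2 := h1.2
        rw [le_div_iff₀ (by positivity)] at h2
        linarith [mul_le_mul_of_nonneg_right h2 hh.le]
      θ_le₃ := H.rate_mul_le.1
      θ_le₄ := H.rate_mul_le.2 }

end Admissible

/-- The scaled difference of the gradients of `G`. -/
def dG (S : Data d) (G : E d → ℝ) (a b : Phase d) : E d :=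
  S.γ⁻¹ ^ 2 • (gradient G a.1 - gradient G b.1)

lemma gradient_sub (hU : S.IsPotential U G) (a b : Phase d) :
    S.γ⁻¹ ^ 2 • (gradient U a.1 - gradient U b.1) = S.T (dz a b) + S.dG G a b := by
  have h1 : act S.K (a.1 - b.1) = act S.K a.1 - act S.K b.1 := by simp [act]
  rw [hU.gradient_eq, hU.gradient_eq, T_apply, dG, dz, h1]
  module

lemma norm_gradient_sub_le (hU : S.IsPotential U G) (hγ : 0 < S.γ) (a b : Phase d) :
    ‖S.T (dz a b) + S.dG G a b‖ ≤ S.α / 2 * ‖dz a b‖ := by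
  rw [← gradient_sub hU, norm_smul, Real.norm_of_nonneg (by positivity), α]
  have := mul_le_mul_of_nonneg_left (hU.lipschitz a.1 b.1) (by positivity : 0 ≤ S.γ⁻¹ ^ 2)
  refine this.trans (le_of_eq ?_)
  rw [dz]; ring

lemma dp_kick (hU : S.IsPotential U G) (hγ : 0 < S.γ) (h : ℝ) (a b : Phase d) :
    S.dp (stepB U h a) (stepB U h b)
      = S.dp a b - (S.γ * h) • (S.T (dz a b) + S.dG G a b) := by
  rw [dp_stepB, ← gradient_sub hU, smul_smul]
  congr 2
  field_simp

lemma norm_dG_sq_le (H : S.Admissible U G h) (a b : Phase d) :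
    13 * ‖S.dG G a b‖ ^ 2 ≤ S.κs * ‖dz a b‖ ^ 2 := by
  have hγ := H.γ_pos
  have hκ := H.potential.kappa_pos
  have h1 : 13 * S.LG ^ 2 ≤ S.κ * S.γ ^ 2 := by
    have h2 := H.friction
    rw [LargeFriction, Real.sqrt_le_left hγ.le, div_le_iff₀ hκ] at h2
    linarith
  have h3 : ‖gradient G a.1 - gradient G b.1‖ ^ 2 ≤ S.LG ^ 2 * ‖dz a b‖ ^ 2 := by
    rw [← mul_pow]
    exact pow_le_pow_left₀ (norm_nonneg _) (H.potential.G_lipschitz a.1 b.1) 2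
  rw [dG, norm_smul, mul_pow, Real.norm_of_nonneg (by positivity), κs]
  have h4 : S.γ⁻¹ ^ 2 * S.κ = (S.γ⁻¹ ^ 2) ^ 2 * (S.κ * S.γ ^ 2) := by field_simp
  rw [h4]
  calc 13 * ((S.γ⁻¹ ^ 2) ^ 2 * ‖gradient G a.1 - gradient G b.1‖ ^ 2)
      ≤ 13 * ((S.γ⁻¹ ^ 2) ^ 2 * (S.LG ^ 2 * ‖dz a b‖ ^ 2)) := by gcongr
    _ = (S.γ⁻¹ ^ 2) ^ 2 * (13 * S.LG ^ 2) * ‖dz a b‖ ^ 2 := by ring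
    _ ≤ _ := by gcongr

/-- If ‖z‖ > R, then G is monotone along z. Otherwise |⟪z, ∇G difference⟫| ≤ L_G R², and `calR` is
chosen so that τ times the form defining `calK` exceeds γ⁻² L_G R² off that set. -/
lemma neg_inner_dG_le (H : S.Admissible U G h) {a b : Phase d} (hab : a - b ∉ S.calK) :
    -⟪dz a b, S.dG G a b⟫ ≤ S.τ * (S.κs * ‖dz a b‖ ^ 2 + 1 / 2 * ‖dz a b + S.dp a b‖ ^ 2
      + 1 / 2 * ‖S.dp a b‖ ^ 2) := by
  have hγ := H.γ_pos
  have hτ := τ_pos H.potential hγ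
  have hκ := κs_pos H.potential hγ
  rw [mem_calK_iff, not_le] at hab
  rw [dG, real_inner_smul_right, real_inner_comm]
  rcases lt_or_ge S.R ‖dz a b‖ with hR | hR
  · have h1 : 0 ≤ ⟪gradient G a.1 - gradient G b.1, dz a b⟫ := H.potential.G_convex a.1 b.1 hR
    have h2 : 0 ≤ S.γ⁻¹ ^ 2 * ⟪gradient G a.1 - gradient G b.1, dz a b⟫ := by positivity
    have h3 : 0 ≤ S.τ * (S.κs * ‖dz a b‖ ^ 2 + 1 / 2 * ‖dz a b + S.dp a b‖ ^ 2
      + 1 / 2 * ‖S.dp a b‖ ^ 2) := by positivity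
    linarith
  · have h1 : |⟪gradient G a.1 - gradient G b.1, dz a b⟫| ≤ S.LG * S.R ^ 2 := by
      refine (abs_real_inner_le_norm _ _).trans ?_
      have h2 := H.potential.G_lipschitz a.1 b.1
      have h3 := H.potential.LG_nonneg
      calc _ ≤ S.LG * ‖dz a b‖ * ‖dz a b‖ := mul_le_mul_of_nonneg_right h2 (norm_nonneg _)
        _ = S.LG * ‖dz a b‖ ^ 2 := by ring
        _ ≤ _ := by gcongr
    have h4 := mul_le_mul_of_nonneg_left ((neg_le_abs _).trans h1)
      (by positivity : 0 ≤ S.γ⁻¹ ^ 2)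
    have h5 : S.τ * S.calR = S.γ⁻¹ ^ 2 * (S.LG * S.R ^ 2) := by
      rw [calR]; field_simp
    have h6 := mul_le_mul_of_nonneg_left hab.le hτ.le
    linarith

/-- The displacement of the noise in the coupling of two steps: the reflection coupling is used
at small distances unless the positions are much further apart than the sums `z + p`. -/
def noiseShift (S : Data d) (U : E d → ℝ) (h : ℝ) (a b : Phase d) : Noise d :=
  open Classical in
  if S.Δ a b ≤ S.DK ∧ ‖dz a b‖ < 4 * ‖dz a b + S.dp a b‖ then
    S.shiftVec h (dz (stepB U h a) (stepB U h b) + S.dp (stepB U h a) (stepB U h b))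
  else 0

lemma reflNoise_zero {V : Type*} [NormedAddCommGroup V] [InnerProductSpace ℝ V]
    [FiniteDimensional ℝ V] [MeasurableSpace V] [BorelSpace V] (n : V) (u : ℝ) :
    reflNoise 0 n u = n := by simp [reflNoise]

lemma dp_stepQ_self (H : S.Admissible U G h) (n : Noise d) (a b : Phase d) :
    S.dp (S.stepQ U h a n.ofLp) (S.stepQ U h b n.ofLp)
      = (1 - (1 - eta S.γ h)) • (S.dp a b - (S.γ * h) • (S.T (dz a b) + S.dG G a b)) := by
  have h1 := dp_stepQ (U := U) H.γ_pos H.h_pos n 0 0 a b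
  rw [zero_smul, add_zero, smul_zero, sub_zero, dp_kick H.potential H.γ_pos] at h1
  rw [h1, sub_sub_cancel]

lemma dz_add_dp_stepQ_self (H : S.Admissible U G h) (n : Noise d) (a b : Phase d) :
    dz (S.stepQ U h a n.ofLp) (S.stepQ U h b n.ofLp)
      + S.dp (S.stepQ U h a n.ofLp) (S.stepQ U h b n.ofLp)
      = dz a b + (S.dp a b - (S.γ * h) • (S.T (dz a b) + S.dG G a b)) := by
  have h1 := dz_add_dp_stepQ (U := U) H.γ_pos H.h_pos n 0 0 a b
  rwa [zero_smul, add_zero, zero_smul, sub_zero, dp_kick H.potential H.γ_pos, dz_stepB] at h1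

lemma dz_stepQ_self (H : S.Admissible U G h) (n : Noise d) (a b : Phase d) :
    dz (S.stepQ U h a n.ofLp) (S.stepQ U h b n.ofLp)
      = dz a b + (1 - eta S.γ h) • (S.dp a b - (S.γ * h) • (S.T (dz a b) + S.dG G a b)) := by
  have h1 := dz_add_dp_stepQ_self H n a b
  rw [dp_stepQ_self H] at h1
  rw [eq_sub_of_add_eq h1]
  module

/-- The square root halves the rate: 1 - 7/12 t ≤ (1 - 7/24 t)². -/
lemma rl_stepQ_le (H : S.Admissible U G h) (n : Noise d) {a b : Phase d} (hab : a - b ∉ S.calK) :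
    S.rl (S.stepQ U h a n.ofLp) (S.stepQ U h b n.ofLp)
      ≤ (1 - 7 / 24 * S.τ * (S.γ * h)) * S.rl a b := by
  have hU := H.potential
  have hγ := H.γ_pos
  have hτ := τ_pos hU hγ
  have hδ := H.δ_pos
  have h1 := energy_contraction (T_symmetric hU) (κs_pos hU hγ) (κs_le_inner hU) (inner_T_le hU)
    (norm_T_sq_le hU hγ) (Λ_pos hU hγ) hτ S.τ_le S.τ_le' hδ H.δ_le H.δ_mul_Λ_le
    H.le_one_sub_eta (one_sub_eta_le S.γ h) (dz a b) (S.dp a b) (S.dG G a b) (norm_dG_sq_le H a b)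
    (neg_inner_dG_le H hab)
  rw [← dz_stepQ_self H n, ← dp_stepQ_self H n, ← rl_sq hU, ← rl_sq hU] at h1
  have h2 : S.τ * (S.γ * h) ≤ 1 / 8 * (1 / 15) :=
    mul_le_mul S.τ_le H.δ_le hδ.le (by norm_num)
  have h3 : 0 ≤ 1 - 7 / 24 * S.τ * (S.γ * h) := by linarith
  refine abs_le_of_sq_le_sq' ?_ (mul_nonneg h3 (rl_nonneg S a b)) |>.2
  refine h1.trans ?_
  rw [mul_pow]
  refine mul_le_mul_of_nonneg_right ?_ (sq_nonneg _)
  nlinarith [sq_nonneg (7 / 24 * S.τ * (S.γ * h))]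

lemma ρ_le_f_rs (H : S.Admissible U G h) (a b : Phase d) : S.ρ a b ≤ S.f (S.rs a b) := by
  rw [ρ_eq]
  exact f_mono H.potential H.γ_pos (le_min (rs_nonneg H.potential H.γ_pos a b)
    (add_nonneg (DK_nonneg H.potential H.γ_pos)
      (mul_nonneg (ε_pos H.potential H.γ_pos).le (rl_nonneg S a b)))) (min_le_left _ _)

lemma ρ_le_f_rl (H : S.Admissible U G h) (a b : Phase d) :
    S.ρ a b ≤ S.f (S.DK + S.ε * S.rl a b) := by
  rw [ρ_eq]
  exact f_mono H.potential H.γ_pos (le_min (rs_nonneg H.potential H.γ_pos a b)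
    (add_nonneg (DK_nonneg H.potential H.γ_pos)
      (mul_nonneg (ε_pos H.potential H.γ_pos).le (rl_nonneg S a b)))) (min_le_right _ _)

lemma ρ_of_Δ_le {a b : Phase d} (hab : S.Δ a b ≤ S.DK) : S.ρ a b = S.f (S.rs a b) := by
  rw [ρ_eq, min_eq_left]
  rw [Δ] at hab; linarith

lemma ρ_of_lt_Δ {a b : Phase d} (hab : S.DK < S.Δ a b) :
    S.ρ a b = S.f (S.DK + S.ε * S.rl a b) := by
  rw [ρ_eq, min_eq_right]
  rw [Δ] at hab; linarith

/-- The slope of f is at least `fPrime` and f(x) ≤ x, so an absolute decrease becomes a relative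
one. -/
lemma f_sub_le_mul (H : S.Admissible U G h) {x y θ : ℝ} (hy : 0 ≤ y) (hyx : y ≤ x)
    (hθ : 0 ≤ θ) (hd : θ * x ≤ S.fPrime * (x - y)) : S.f y ≤ (1 - θ) * S.f x := by
  have h1 := fPrime_mul_sub_le H.potential H.γ_pos hy hyx
  have h2 := mul_le_mul_of_nonneg_left (f_le H.potential H.γ_pos (hy.trans hyx)) hθ
  linarith

/-- By the choice of DK the difference lies outside `calK`, so `rl` contracts. The constant DK does
not, but DK + ε rl ≤ rs here and calE · rs ≤ rl, so the decrease of ε rl is a fixed fraction of the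
whole argument. -/
lemma ρ_stepQ_le_far (H : S.Admissible U G h) (n : Noise d) {a b : Phase d}
    (hab : S.DK < S.Δ a b) :
    S.ρ (S.stepQ U h a n.ofLp) (S.stepQ U h b n.ofLp) ≤ (1 - S.rate h * h) * S.ρ a b := by
  have hU := H.potential
  have hγ := H.γ_pos
  have hK : a - b ∉ S.calK := fun hmem => absurd (Δ_le_DK hU hγ hmem) (not_le.2 hab)
  have hε := ε_pos hU hγ
  have hl := rl_nonneg S a b
  have hl' := rl_nonneg S (S.stepQ U h a n.ofLp) (S.stepQ U h b n.ofLp)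
  have h1 := rl_stepQ_le H n hK
  have hD := DK_nonneg hU hγ
  have hτ := τ_pos hU hγ
  have hδ := H.δ_pos
  have hf := fPrime_pos hU hγ
  have hg : 0 ≤ 7 / 24 * S.τ * (S.γ * h) * S.rl a b := by positivity
  refine (ρ_le_f_rl H _ _).trans ?_
  rw [ρ_of_lt_Δ hab]
  have h2 := mul_le_mul_of_nonneg_left h1 hε.le
  refine f_sub_le_mul H (by positivity) ?_ (mul_pos H.rate_pos H.h_pos).le ?_
  · have := mul_nonneg hε.le hg
    linarith
  · have h3 : S.DK + S.ε * S.rl a b ≤ S.rs a b := by rw [Δ] at hab; linarith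
    have h4 := calE_mul_rs_le hU hγ a b
    have hr := rs_nonneg hU hγ a b
    have h5 := mul_le_mul_of_nonneg_right (H.rate_le_energy) (mul_nonneg H.h_pos.le hr)
    have h6 : 0 ≤ S.fPrime * S.ε * (7 / 24 * S.τ * (S.γ * h)) := by positivity
    have h7 := mul_le_mul_of_nonneg_left h4 h6
    have h8 := mul_le_mul_of_nonneg_left h3 (mul_pos H.rate_pos H.h_pos).le
    have h9 := mul_le_mul_of_nonneg_left h2 hf.le
    linarith

lemma gap_bounds (H : S.Admissible U G h) (a b : Phase d) :
    ‖dz a b + (S.dp a b - (S.γ * h) • (S.T (dz a b) + S.dG G a b))‖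
      ≤ ‖dz a b + S.dp a b‖ + S.α * (S.γ * h) / 2 * ‖dz a b‖ ∧
    ‖dz a b + S.dp a b‖ ≤ ‖dz a b + (S.dp a b - (S.γ * h) • (S.T (dz a b) + S.dG G a b))‖
      + S.α * (S.γ * h) / 2 * ‖dz a b‖ := by
  have h1 := norm_gradient_sub_le H.potential H.γ_pos a b
  have h2 : ‖(S.γ * h) • (S.T (dz a b) + S.dG G a b)‖ ≤ S.α * (S.γ * h) / 2 * ‖dz a b‖ := by
    rw [norm_smul, Real.norm_of_nonneg H.δ_pos.le]
    have := mul_le_mul_of_nonneg_left h1 H.δ_pos.le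
    linarith
  set g := (S.γ * h) • (S.T (dz a b) + S.dG G a b)
  have e1 : dz a b + (S.dp a b - g) = (dz a b + S.dp a b) - g := by abel
  have e2 : dz a b + S.dp a b = (dz a b + (S.dp a b - g)) + g := by abel
  constructor
  · rw [e1]; exact (norm_sub_le _ _).trans (by linarith)
  · nth_rewrite 1 [e2]; exact (norm_add_le _ _).trans (by linarith)

/-- The new z is the convex combination (1 - e)z + e(z + P) with P the kicked velocity, and z + P is
short compared with z. -/
lemma ρ_stepQ_le_position (H : S.Admissible U G h) (n : Noise d) {a b : Phase d}
    (hab : S.Δ a b ≤ S.DK) (hq : 4 * ‖dz a b + S.dp a b‖ ≤ ‖dz a b‖) :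
    S.ρ (S.stepQ U h a n.ofLp) (S.stepQ U h b n.ofLp) ≤ (1 - S.rate h * h) * S.ρ a b := by
  have hU := H.potential
  have hγ := H.γ_pos
  have hα := α_pos hU hγ
  have hδ := H.δ_pos
  have hδ1 := H.δ_le
  refine (ρ_le_f_rs H _ _).trans ?_
  rw [ρ_of_Δ_le hab]
  obtain ⟨hQ, -⟩ := gap_bounds H a b
  have hrs : S.rs (S.stepQ U h a n.ofLp) (S.stepQ U h b n.ofLp)
      ≤ S.α * ((1 - (1 - eta S.γ h)) * ‖dz a b‖ + (1 - eta S.γ h)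
        * ‖dz a b + (S.dp a b - (S.γ * h) • (S.T (dz a b) + S.dG G a b))‖)
        + ‖dz a b + (S.dp a b - (S.γ * h) • (S.T (dz a b) + S.dG G a b))‖ := by
    rw [rs_eq, dz_add_dp_stepQ_self H, dz_stepQ_self H]
    set P := S.dp a b - (S.γ * h) • (S.T (dz a b) + S.dG G a b)
    have he0 : 0 ≤ 1 - eta S.γ h := by linarith [eta_lt_one hγ H.h_pos]
    have he1 : 0 ≤ 1 - (1 - eta S.γ h) := by linarith [eta_pos S.γ h]
    have e1 : dz a b + (1 - eta S.γ h) • P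
        = (1 - (1 - eta S.γ h)) • dz a b + (1 - eta S.γ h) • (dz a b + P) := by module
    have : ‖dz a b + (1 - eta S.γ h) • P‖ ≤ (1 - (1 - eta S.γ h)) * ‖dz a b‖
        + (1 - eta S.γ h) * ‖dz a b + P‖ := by
      rw [e1]
      refine (norm_add_le _ _).trans (le_of_eq ?_)
      rw [norm_smul, norm_smul, Real.norm_of_nonneg he0, Real.norm_of_nonneg he1]
    gcongr
  rw [rs_eq S a b]
  rw [rs_eq S (S.stepQ U h a n.ofLp)] at hrs ⊢
  have hge := H.le_one_sub_eta
  have hle := (one_sub_eta_le S.γ h)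
  obtain ⟨hr1, hr2⟩ := H.rate_mul_le
  have hf := fPrime_pos hU hγ
  have hsm := H.small
  set e := 1 - eta S.γ h
  set δ := S.γ * h
  set x := ‖dz a b‖
  set q := ‖dz a b + S.dp a b‖
  set Q := ‖dz a b + (S.dp a b - δ • (S.T (dz a b) + S.dG G a b))‖
  have hx : 0 ≤ x := norm_nonneg _
  have hq0 : 0 ≤ q := norm_nonneg _
  have he : 29 / 30 * δ ≤ e := by nlinarith
  have hαδ : S.α * δ ≤ 1 / 9600 := by nlinarith [mul_pos hα hδ]
  have hαe : S.α * e ≤ 1 / 9600 := (mul_le_mul_of_nonneg_left hle hα.le).trans hαδ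
  have hαe0 : 0 ≤ S.α * e := mul_nonneg hα.le (by linarith)
  have hαe' : 29 / 30 * (S.α * δ) ≤ S.α * e := by
    have := mul_le_mul_of_nonneg_left he hα.le
    linarith
  have k1 : S.α * e * Q ≤ S.α * e * (q + S.α * δ / 2 * x) := mul_le_mul_of_nonneg_left hQ hαe0
  have k2 : S.α * e * q ≤ S.α * e * (x / 4) := mul_le_mul_of_nonneg_left (by linarith) hαe0
  have k3 : S.α * e * (S.α * δ / 2 * x) ≤ 1 / 9600 * (S.α * δ / 2 * x) :=
    mul_le_mul_of_nonneg_right hαe (by positivity)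
  have k4 := mul_le_mul_of_nonneg_right hαe' hx
  -- In units of αδx: the relaxation gains 29/30 · 3/4 and the kick costs 1/2, up to a negligible
  -- term, so more than 1/8 remains.
  have key : S.α * ((1 - e) * x + e * Q) + Q ≤ S.α * x + q - 1 / 8 * (S.α * δ * x) := by
    have : 0 ≤ S.α * δ * x := by positivity
    linarith
  refine f_sub_le_mul H (by positivity) ?_ (mul_pos H.rate_pos H.h_pos).le ?_
  · have : 0 ≤ S.α * δ * x := by positivity
    linarith
  · have hm : S.rate h * h * (S.α * x + q) ≤ S.fPrime * (1 / 8 * (S.α * δ * x)) := by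
      have hqx : S.α * x + q ≤ (S.α + 1 / 4) * x := by linarith
      have hθ := (mul_pos H.rate_pos H.h_pos).le
      refine (mul_le_mul_of_nonneg_left hqx hθ).trans ?_
      -- The γ/16 and γα/4 terms of the rate cover α ≥ 1/4 and α ≤ 1/4 respectively.
      rcases le_total (1 / 4) S.α with h1 | h1
      · calc _ ≤ S.fPrime * (δ / 16) * ((S.α + 1 / 4) * x) :=
              mul_le_mul_of_nonneg_right hr1 (by positivity)
          _ ≤ S.fPrime * (δ / 16) * ((S.α + S.α) * x) := by gcongr
          _ = _ := by ring
      · calc _ ≤ S.fPrime * (δ * S.α / 4) * ((S.α + 1 / 4) * x) :=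
              mul_le_mul_of_nonneg_right hr2 (by positivity)
          _ ≤ S.fPrime * (δ * S.α / 4) * ((1 / 4 + 1 / 4) * x) := by gcongr
          _ = _ := by ring
    refine hm.trans (mul_le_mul_of_nonneg_left ?_ hf.le)
    linarith

/-- The gap in z + p becomes (1 - s)y exactly. The velocity is displaced slightly less than z + p,
by the factor e/δ with 1 - e/δ ≤ δ/2, so a remainder of order δ|s| reaches the position. -/
lemma rs_stepQ_le_reflection (H : S.Admissible U G h) (n : Noise d) {s : ℝ} (hs : s ≤ 1)
    (a b : Phase d) (y : E d)
    (hy : dz (stepB U h a) (stepB U h b) + S.dp (stepB U h a) (stepB U h b) = y) :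
    S.rs (S.stepQ U h a n.ofLp) (S.stepQ U h b (n + s • S.shiftVec h y).ofLp)
      ≤ S.α * (1 - (1 - eta S.γ h)) * ‖dz a b‖
        + S.α * ((1 - eta S.γ h) + S.γ * h / 2) * ‖y‖
        + (1 + S.α * (S.γ * h) / 2) * ((1 - s) * ‖y‖) := by
  have hγ := H.γ_pos
  have hδ := H.δ_pos
  have hα := α_pos H.potential hγ
  have h1 := dz_add_dp_stepQ (U := U) hγ H.h_pos n s y a b
  have h2 := dp_stepQ (U := U) hγ H.h_pos n s y a b
  rw [hy] at h1
  rw [dz_stepB] at hy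
  have hge := H.le_one_sub_eta
  have hle := (one_sub_eta_le S.γ h)
  have he1 : 0 ≤ 1 - (1 - eta S.γ h) := by linarith [eta_pos S.γ h]
  have hη : eta S.γ h = 1 - (1 - eta S.γ h) := by ring
  set e := 1 - eta S.γ h
  have he0 : 0 ≤ e := by nlinarith [H.δ_le]
  have h3 : dz (S.stepQ U h a n.ofLp) (S.stepQ U h b (n + s • S.shiftVec h y).ofLp)
      = (1 - e) • dz a b + (e - (1 - e / (S.γ * h)) * s) • y := by
    rw [h2, hη] at h1
    rw [eq_sub_of_add_eq h1, eq_sub_of_add_eq' hy]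
    module
  have h4 : 0 ≤ 1 - e / (S.γ * h) := by
    rw [sub_nonneg, div_le_one hδ]; exact hle
  have h5 : 1 - e / (S.γ * h) ≤ S.γ * h / 2 := by
    rw [sub_le_comm, le_div_iff₀ hδ]; linarith
  have h6 : |e - (1 - e / (S.γ * h)) * s| ≤ e + S.γ * h / 2 * (2 - s) := by
    -- This uses s ≤ 1. It makes the remainder linear in s, so that the mean of the bound can be
    -- computed.
    have h7 : |s| ≤ 2 - s := abs_le.2 ⟨by linarith, by linarith⟩
    calc _ ≤ |e| + |(1 - e / (S.γ * h)) * s| := abs_sub _ _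
      _ = e + (1 - e / (S.γ * h)) * |s| := by rw [abs_mul, abs_of_nonneg he0, abs_of_nonneg h4]
      _ ≤ e + S.γ * h / 2 * (2 - s) := by gcongr
  have h8 : y - s • y = (1 - s) • y := by module
  rw [rs_eq, h1, h3, h8, norm_smul (1 - s), Real.norm_of_nonneg (by linarith : 0 ≤ 1 - s)]
  have h9 : ‖(1 - e) • dz a b + (e - (1 - e / (S.γ * h)) * s) • y‖
      ≤ (1 - e) * ‖dz a b‖ + (e + S.γ * h / 2 * (2 - s)) * ‖y‖ := by
    refine (norm_add_le _ _).trans ?_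
    rw [norm_smul, norm_smul, Real.norm_of_nonneg he1, Real.norm_eq_abs]
    gcongr
  have h10 := mul_le_mul_of_nonneg_left h9 hα.le
  linarith

/-- The coupled step contracts the distance `ρ` in expectation. -/
theorem lintegral_ρ_stepQ_le (H : S.Admissible U G h) (a b : Phase d) :
    ∫⁻ ω, ENNReal.ofReal (S.ρ (S.stepQ U h a ω.1.ofLp)
      (S.stepQ U h b (reflNoise (S.noiseShift U h a b) ω.1 ω.2).ofLp)) ∂(reflLaw (Noise d))
      ≤ ENNReal.ofReal (1 - S.rate h * h) * ENNReal.ofReal (S.ρ a b) := by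
  have hU := H.potential
  have hγ := H.γ_pos
  have hθ1 := H.rate_mul_le_one
  rw [← ENNReal.ofReal_mul (by linarith)]
  have hsync : S.noiseShift U h a b = 0 → (∀ n : Noise d,
      S.ρ (S.stepQ U h a n.ofLp) (S.stepQ U h b n.ofLp) ≤ (1 - S.rate h * h) * S.ρ a b) →
      ∫⁻ ω, ENNReal.ofReal (S.ρ (S.stepQ U h a ω.1.ofLp)
        (S.stepQ U h b (reflNoise (S.noiseShift U h a b) ω.1 ω.2).ofLp)) ∂(reflLaw (Noise d))
        ≤ ENNReal.ofReal ((1 - S.rate h * h) * S.ρ a b) := by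
    intro h0 h1
    calc _ ≤ ∫⁻ _, ENNReal.ofReal ((1 - S.rate h * h) * S.ρ a b) ∂(reflLaw (Noise d)) := by
          refine lintegral_mono fun ω => ENNReal.ofReal_le_ofReal ?_
          rw [h0, reflNoise_zero]
          exact h1 _
      _ = _ := by simp
  by_cases hab : S.Δ a b ≤ S.DK
  swap
  · exact hsync (if_neg fun hh => hab hh.1) fun n => ρ_stepQ_le_far H n (not_le.1 hab)
  by_cases hq : ‖dz a b‖ < 4 * ‖dz a b + S.dp a b‖
  swap
  · exact hsync (if_neg fun hh => hq hh.2) fun n => ρ_stepQ_le_position H n hab (not_lt.1 hq)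
  have hw : S.noiseShift U h a b = S.shiftVec h
      (dz (stepB U h a) (stepB U h b) + S.dp (stepB U h a) (stepB U h b)) := if_pos ⟨hab, hq⟩
  have hq0 : 0 < ‖dz a b + S.dp a b‖ := by linarith [norm_nonneg (dz a b)]
  have hR := rs_le_R₁ hU hγ hab
  rw [ρ_of_Δ_le hab]
  rw [rs_eq] at hR ⊢
  have hα := α_pos hU hγ
  have hR0 : 0 < S.R₁ := lt_of_lt_of_le (by positivity) hR
  obtain ⟨hQ1, hQ2⟩ := gap_bounds H a b
  rw [← dp_kick hU hγ, ← dz_stepB (U := U) (h := h) a b] at hQ1 hQ2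
  refine le_trans ?_ ((H.stepBounds hR0).reflCoeff_expectation_le hU hγ H.h_pos (norm_nonneg _) hq0
    hq.le hR _ hQ1 hQ2)
  refine lintegral_mono_ae ((ae_reflCoeff_le_one (S.shiftVec h (dz (stepB U h a) (stepB U h b)
    + S.dp (stepB U h a) (stepB U h b)))).mono fun ω hω => ENNReal.ofReal_le_ofReal ?_)
  rw [hw]
  refine (ρ_le_f_rs H _ _).trans (f_mono hU hγ (rs_nonneg hU hγ _ _) ?_)
  exact rs_stepQ_le_reflection H ω.1 hω a b _ rfl

end Data

end KineticLangevin
end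

/-! ### Losses at the two ends of the chain, and the constants C and M. -/

noncomputable section

namespace KineticLangevin

open scoped RealInnerProductSpace ENNReal

namespace Data

variable {d : ℕ} {S : Data d} {U G : E d → ℝ} {h : ℝ}

/-- The kick followed by half a flight. -/
def stepBU (S : Data d) (U : E d → ℝ) (h : ℝ) (z : Phase d) (ξ ζ : E d) : Phase d :=
  stepU S.γ (h / 2) ξ ζ (stepB U h z)

/-- The largest factor by which `ρ` may grow under one of the two halves of a step. -/
def lossFactor (S : Data d) (h : ℝ) : ℝ :=
  max (1 + S.α * (S.γ * h) / 2) (√(1 + S.γ * h * max 1 S.Λ))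

lemma dp_stepU_self (hγ : 0 < S.γ) (hh : 0 < h) (ξ ζ : E d) (a b : Phase d) :
    S.dp (stepU S.γ (h / 2) ξ ζ a) (stepU S.γ (h / 2) ξ ζ b)
      = (1 - (1 - eta S.γ (h / 2))) • S.dp a b := by
  rw [dp_stepU hγ (half_pos hh), sub_self, smul_zero, add_zero, sub_sub_cancel]

lemma dz_add_dp_stepU_self (hγ : 0 < S.γ) (ξ ζ : E d) (a b : Phase d) :
    dz (stepU S.γ (h / 2) ξ ζ a) (stepU S.γ (h / 2) ξ ζ b)
      + S.dp (stepU S.γ (h / 2) ξ ζ a) (stepU S.γ (h / 2) ξ ζ b) = dz a b + S.dp a b := by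
  rw [dz_add_dp_stepU hγ, sub_self, smul_zero, add_zero]

lemma dz_stepU_self (hγ : 0 < S.γ) (hh : 0 < h) (ξ ζ : E d) (a b : Phase d) :
    dz (stepU S.γ (h / 2) ξ ζ a) (stepU S.γ (h / 2) ξ ζ b)
      = dz a b + (1 - eta S.γ (h / 2)) • S.dp a b := by
  have h1 := dz_add_dp_stepU_self (h := h) hγ ξ ζ a b
  rw [dp_stepU_self hγ hh] at h1
  rw [eq_sub_of_add_eq h1]
  module

lemma half_flight_bounds (H : S.Admissible U G h) :
    S.γ * h / 2 - (S.γ * h) ^ 2 / 8 ≤ 1 - eta S.γ (h / 2) ∧ 1 - eta S.γ (h / 2) ≤ S.γ * h / 2 ∧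
      0 ≤ 1 - eta S.γ (h / 2) ∧ 0 ≤ 1 - (1 - eta S.γ (h / 2)) := by
  have h1 := exp_neg_le (x := S.γ * (h / 2)) (by linarith [H.δ_pos])
  have h2 := one_sub_eta_le S.γ (h / 2)
  have h3 := eta_lt_one H.γ_pos (half_pos H.h_pos)
  have h4 := eta_pos S.γ (h / 2)
  rw [eta] at *
  exact ⟨by linarith, by linarith, by linarith, by linarith⟩

lemma one_le_lossFactor (H : S.Admissible U G h) : 1 ≤ S.lossFactor h := by
  have := α_pos H.potential H.γ_pos
  have := H.δ_pos
  refine le_trans ?_ (le_max_left _ _)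
  have : 0 ≤ S.α * (S.γ * h) / 2 := by positivity
  linarith

lemma rl_le_of_energy_le (H : S.Admissible U G h) {a b a' b' : Phase d}
    (hE : energy S.T (1 - 2 * S.τ) (dz a' b') (S.dp a' b')
      ≤ (1 + S.γ * h * max 1 S.Λ) * energy S.T (1 - 2 * S.τ) (dz a b) (S.dp a b)) :
    S.rl a' b' ≤ S.lossFactor h * S.rl a b := by
  have hδ := H.δ_pos
  have h0 : 0 ≤ 1 + S.γ * h * max 1 S.Λ := by positivity
  refine le_trans ?_ (mul_le_mul_of_nonneg_right (le_max_right _ _) (rl_nonneg S a b))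
  rw [rl_eq, rl_eq, ← Real.sqrt_mul h0]
  exact Real.sqrt_le_sqrt hE

/-- A common factor l ≥ 1 passes through the minimum, and concavity takes it out of f. -/
lemma ρ_le_lossFactor_mul (H : S.Admissible U G h) {a b a' b' : Phase d}
    (hs : S.rs a' b' ≤ S.lossFactor h * S.rs a b) (hl : S.rl a' b' ≤ S.lossFactor h * S.rl a b) :
    S.ρ a' b' ≤ S.lossFactor h * S.ρ a b := by
  have hU := H.potential
  have hγ := H.γ_pos
  have h1 := one_le_lossFactor H
  have hε := ε_pos hU hγ
  have hD := DK_nonneg hU hγ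
  have h0 : ∀ a b, 0 ≤ min (S.rs a b) (S.DK + S.ε * S.rl a b) := fun a b =>
    le_min (rs_nonneg hU hγ a b) (add_nonneg hD (mul_nonneg hε.le (rl_nonneg S a b)))
  rw [ρ_eq, ρ_eq]
  refine le_trans (f_mono hU hγ (h0 _ _) ?_) (f_mul_le hU hγ (h0 _ _) h1)
  rw [mul_min_of_nonneg _ _ (zero_le_one.trans h1)]
  refine min_le_min hs ?_
  have h2 := mul_le_mul_of_nonneg_left hl hε.le
  have h3 := mul_le_mul_of_nonneg_right h1 hD
  linarith

lemma ρ_stepU_le (H : S.Admissible U G h) (ξ ζ : E d) (a b : Phase d) :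
    S.ρ (stepU S.γ (h / 2) ξ ζ a) (stepU S.γ (h / 2) ξ ζ b) ≤ S.lossFactor h * S.ρ a b := by
  have hU := H.potential
  have hγ := H.γ_pos
  obtain ⟨-, he1, he2, he3⟩ := half_flight_bounds H
  have hα := α_pos hU hγ
  refine ρ_le_lossFactor_mul H ?_ (rl_le_of_energy_le H ?_)
  · refine le_trans ?_ (mul_le_mul_of_nonneg_right (le_max_left _ _) (rs_nonneg hU hγ a b))
    rw [rs_eq, rs_eq, dz_add_dp_stepU_self hγ, dz_stepU_self hγ H.h_pos]
    set e := 1 - eta S.γ (h / 2)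
    have e1 : dz a b + e • S.dp a b = (1 - e) • dz a b + e • (dz a b + S.dp a b) := by module
    have h2 : ‖dz a b + e • S.dp a b‖ ≤ (1 - e) * ‖dz a b‖ + e * ‖dz a b + S.dp a b‖ := by
      rw [e1]
      refine (norm_add_le _ _).trans (le_of_eq ?_)
      rw [norm_smul, norm_smul, Real.norm_of_nonneg he2, Real.norm_of_nonneg he3]
    have h3 := mul_le_mul_of_nonneg_left h2 hα.le
    have h4 : S.α * e * ‖dz a b + S.dp a b‖ ≤ S.α * (S.γ * h / 2) * ‖dz a b + S.dp a b‖ := by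
      gcongr
    have h5 : 0 ≤ S.α * e * ‖dz a b‖ := by positivity
    have h6 : 0 ≤ S.α * (S.γ * h) / 2 * (S.α * ‖dz a b‖) := by have := H.δ_pos; positivity
    linarith
  · rw [dz_stepU_self hγ H.h_pos, dp_stepU_self hγ H.h_pos]
    exact energy_flight_le (T_symmetric hU) (inner_T_nonneg hU) (inner_T_le hU)
      (norm_T_sq_le hU hγ) (Λ_pos hU hγ) (le_max_left _ _) (le_max_right _ _) (τ_pos hU hγ)
      S.τ_le H.δ_pos H.δ_le H.δ_mul_Λ_le he2 he1 _ _

lemma ρ_stepBU_le (H : S.Admissible U G h) (ξ ζ : E d) (a b : Phase d) :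
    S.ρ (S.stepBU U h a ξ ζ) (S.stepBU U h b ξ ζ) ≤ S.lossFactor h * S.ρ a b := by
  have hU := H.potential
  have hγ := H.γ_pos
  obtain ⟨he0, he1, he2, he3⟩ := half_flight_bounds H
  have hα := α_pos hU hγ
  have hδ := H.δ_pos
  have hδ1 := H.δ_le
  obtain ⟨hQ, -⟩ := gap_bounds H a b
  refine ρ_le_lossFactor_mul H ?_ (rl_le_of_energy_le H ?_)
  · rw [stepBU, stepBU, rs_eq, rs_eq, dz_add_dp_stepU_self hγ, dz_stepU_self hγ H.h_pos,
      dp_kick hU hγ, dz_stepB]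
    -- The position coefficient exceeds 1 by about δ²/8, since the kick's δ/2 cancels the flight's
    -- -δ/2. When α is small, this excess needs the square root term of `lossFactor`.
    have hM : 1 + S.γ * h / 100 ≤ S.lossFactor h := by
      refine le_trans ?_ (le_max_right _ _)
      refine Real.le_sqrt_of_sq_le ?_
      have : S.γ * h ≤ S.γ * h * max 1 S.Λ := le_mul_of_one_le_right hδ.le (le_max_left _ _)
      nlinarith
    have hM' : 1 + S.α * (S.γ * h) / 2 ≤ S.lossFactor h := le_max_left _ _
    have hsm := H.small
    set l := S.lossFactor h
    set e := 1 - eta S.γ (h / 2)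
    set δ := S.γ * h
    set P := S.dp a b - δ • (S.T (dz a b) + S.dG G a b)
    have e1 : dz a b + e • P = (1 - e) • dz a b + e • (dz a b + P) := by module
    have h2 : ‖dz a b + e • P‖ ≤ (1 - e) * ‖dz a b‖ + e * ‖dz a b + P‖ := by
      rw [e1]
      refine (norm_add_le _ _).trans (le_of_eq ?_)
      rw [norm_smul, norm_smul, Real.norm_of_nonneg he2, Real.norm_of_nonneg he3]
    have h3 := mul_le_mul_of_nonneg_left h2 hα.le
    set x := ‖dz a b‖
    set q := ‖dz a b + S.dp a b‖
    have hx : 0 ≤ x := norm_nonneg _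
    have hq : 0 ≤ q := norm_nonneg _
    have hαe : 0 ≤ S.α * e := mul_nonneg hα.le he2
    have hαe1 : S.α * e ≤ S.α * δ / 2 := by
      have := mul_le_mul_of_nonneg_left he1 hα.le
      linarith
    have hαδ : S.α * δ ≤ 1 / 9600 := by nlinarith [mul_pos hα hδ]
    have h4 := mul_le_mul_of_nonneg_left hQ (by linarith : 0 ≤ 1 + S.α * e)
    have h5 : (1 + S.α * e) * q ≤ l * q :=
      mul_le_mul_of_nonneg_right (by linarith) hq
    have h6 : δ ^ 2 ≤ 1 / 15 * δ := by
      rw [sq]; exact mul_le_mul_of_nonneg_right hδ1 hδ.le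
    have h7 : S.α * e * (δ / 2) ≤ 1 / 19200 * (δ / 2) :=
      mul_le_mul_of_nonneg_right (by linarith) (by linarith)
    have h8 : (1 - e) + (1 + S.α * e) * (δ / 2) ≤ l := by linarith
    have h9 := mul_le_mul_of_nonneg_right h8 (mul_nonneg hα.le hx)
    linarith
  · rw [stepBU, stepBU, dz_stepU_self hγ H.h_pos, dp_stepU_self hγ H.h_pos, dp_kick hU hγ, dz_stepB]
    exact energy_kick_flight_le (T_symmetric hU) (inner_T_nonneg hU) (inner_T_le hU)
      (norm_T_sq_le hU hγ) (Λ_pos hU hγ) (le_max_left _ _) (le_max_right _ _) (τ_pos hU hγ)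
      S.τ_le hδ hδ1 H.δ_mul_Λ_le he0 he1 _ _ _
      ((norm_dG_sq_le H a b).trans (κs_le_inner hU _))

lemma C_eq (H : S.Admissible U G h) : S.C h = (1 + S.γ * h / 16) * S.lossFactor h ^ 2 := by
  have hδ := H.δ_pos
  have hα := α_pos H.potential H.γ_pos
  have h0 : 0 ≤ 1 + S.γ * h * max 1 S.Λ := by positivity
  have h1 : 0 ≤ 1 + S.α * (S.γ * h) / 2 := by positivity
  rw [C, lossFactor, ← mul_assoc S.α, mul_comm S.LK, ← Λ]
  congr 1
  rw [← mul_assoc] at h1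
  rcases le_total (1 + S.α * S.γ * h / 2) √(1 + S.γ * h * max 1 S.Λ) with h2 | h2
  · rw [max_eq_right h2, max_eq_right, Real.sq_sqrt h0]
    rw [← Real.sq_sqrt h0]
    exact pow_le_pow_left₀ h1 h2 2
  · rw [max_eq_left h2, max_eq_left]
    rw [← Real.sq_sqrt h0]
    exact pow_le_pow_left₀ (Real.sqrt_nonneg _) h2 2

lemma C_pos (H : S.Admissible U G h) : 0 < S.C h := by
  have h1 := one_le_lossFactor H
  have h2 := H.δ_pos
  rw [C_eq H]
  positivity

/-- A chain of k + 1 steps contains only k contracting ones, and the factor 1 + γh/16 of C makes up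
for the missing one. The exponential exp(-γh) in the rate is used here. -/
lemma exp_rate_le (H : S.Admissible U G h) :
    Real.exp (S.rate h * h) ≤ 1 + S.γ * h / 16 := by
  have hδ := H.δ_pos
  have h0 : S.rate h * h ≤ Real.exp (-(S.γ * h)) * (S.γ * h / 16) := by
    calc S.rate h * h ≤ S.fPrime * Real.exp (-(S.γ * h)) * (S.γ / 16) * h :=
          mul_le_mul_of_nonneg_right (Admissible.rate_le_flow S h).1 H.h_pos.le
      _ ≤ 1 * Real.exp (-(S.γ * h)) * (S.γ / 16) * h := by
          have := H.fPrime_le_one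
          have := H.γ_pos
          have := H.h_pos
          gcongr
      _ = _ := by ring
  have h1 : Real.exp (-(S.γ * h)) * (1 + S.γ * h / 16) ≤ 1 := by
    have h2 := Real.add_one_le_exp (S.γ * h)
    have h3 : Real.exp (-(S.γ * h)) * Real.exp (S.γ * h) = 1 := by
      rw [← Real.exp_add]; simp
    have h4 := mul_le_mul_of_nonneg_left (show 1 + S.γ * h / 16 ≤ Real.exp (S.γ * h) by linarith)
      (Real.exp_pos (-(S.γ * h))).le
    linarith
  have h5 := Real.add_one_le_exp (-(S.rate h * h))
  have h6 : Real.exp (-(S.rate h * h)) * Real.exp (S.rate h * h) = 1 := by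
    rw [← Real.exp_add]; simp
  have h7 : 1 ≤ (1 + S.γ * h / 16) * (1 - S.rate h * h) := by
    have h8 := mul_le_mul_of_nonneg_right h1 (by positivity : 0 ≤ S.γ * h / 16)
    have h9 := mul_le_mul_of_nonneg_left h0 (by positivity : 0 ≤ 1 + S.γ * h / 16)
    linarith
  have h8 : 1 ≤ (1 + S.γ * h / 16) * Real.exp (-(S.rate h * h)) :=
    h7.trans (mul_le_mul_of_nonneg_left (by linarith) (by positivity))
  calc Real.exp (S.rate h * h) = 1 * Real.exp (S.rate h * h) := (one_mul _).symm
    _ ≤ (1 + S.γ * h / 16) * Real.exp (-(S.rate h * h)) * Real.exp (S.rate h * h) := by gcongr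
    _ = _ := by rw [mul_assoc, h6, mul_one]

/-- The losses in the first and the last half step are absorbed by the prefactor. -/
lemma lossFactor_mul_pow_le (H : S.Admissible U G h) (k : ℕ) :
    S.lossFactor h * ((1 - S.rate h * h) ^ k * S.lossFactor h)
      ≤ S.C h * Real.exp (-(S.rate h * (k + 1 : ℕ) * h)) := by
  have h1 := one_le_lossFactor H
  have h2 : (1 - S.rate h * h) ^ k ≤ Real.exp (-(S.rate h * k * h)) := by
    have h3 : 1 - S.rate h * h ≤ Real.exp (-(S.rate h * h)) := by
      linarith [Real.add_one_le_exp (-(S.rate h * h))]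
    have h4 := pow_le_pow_left₀ (by linarith [H.rate_mul_le_one]) h3 k
    rw [← Real.exp_nat_mul] at h4
    refine h4.trans_eq ?_
    congr 1; ring
  have h5 : Real.exp (-(S.rate h * k * h))
      = Real.exp (S.rate h * h) * Real.exp (-(S.rate h * (k + 1 : ℕ) * h)) := by
    rw [← Real.exp_add]; congr 1; push_cast; ring
  have h6 := exp_rate_le H
  rw [C_eq H]
  calc S.lossFactor h * ((1 - S.rate h * h) ^ k * S.lossFactor h)
      = (1 - S.rate h * h) ^ k * S.lossFactor h ^ 2 := by ring
    _ ≤ Real.exp (S.rate h * h) * Real.exp (-(S.rate h * (k + 1 : ℕ) * h))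
        * S.lossFactor h ^ 2 := by rw [← h5]; gcongr
    _ ≤ (1 + S.γ * h / 16) * Real.exp (-(S.rate h * (k + 1 : ℕ) * h))
        * S.lossFactor h ^ 2 := by gcongr
    _ = _ := by ring

lemma one_le_C (H : S.Admissible U G h) : 1 ≤ S.C h := by
  have h1 := one_le_lossFactor H
  have h2 := H.δ_pos
  rw [C_eq H]
  have h3 : 1 ≤ S.lossFactor h ^ 2 := one_le_pow₀ h1
  have h4 : 0 ≤ S.γ * h / 16 * S.lossFactor h ^ 2 := by positivity
  linarith

lemma min_pos (H : S.Admissible U G h) : 0 < min (√(2 * S.κ)) 1 := by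
  have := H.potential.kappa_pos
  exact lt_min (Real.sqrt_pos.2 (by positivity)) one_pos

/-- The quantity ε rl lies below both arguments of the minimum, and f has slope at least `fPrime`.
-/
lemma euclDist_le_ρ (H : S.Admissible U G h) (a b : Phase d) :
    euclDist a b ≤ √2 * S.γ / (S.fPrime * S.ε * min (√(2 * S.κ)) 1) * S.ρ a b := by
  have hU := H.potential
  have hγ := H.γ_pos
  have hm := min_pos H
  have hf := fPrime_pos hU hγ
  have hε := ε_pos hU hγ
  have h1 : S.fPrime * (S.ε * S.rl a b) ≤ S.ρ a b := by
    rw [ρ_eq]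
    have h2 : S.ε * S.rl a b ≤ min (S.rs a b) (S.DK + S.ε * S.rl a b) := by
      refine le_min ?_ ?_
      · linarith [ε_mul_rl_le hU hγ a b, rs_nonneg hU hγ a b]
      · linarith [DK_nonneg hU hγ]
    have h0 : 0 ≤ S.ε * S.rl a b := mul_nonneg hε.le (rl_nonneg S a b)
    have h3 := fPrime_mul_sub_le hU hγ le_rfl (h0.trans h2)
    rw [f_zero, sub_zero, sub_zero] at h3
    exact (mul_le_mul_of_nonneg_left h2 hf.le).trans h3
  have h2 := min_mul_euclDist_le hU hγ a b
  rw [div_mul_eq_mul_div, le_div_iff₀ (by positivity)]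
  have h3 := mul_le_mul_of_nonneg_left h1 (by positivity : 0 ≤ √2 * S.γ)
  have h4 := mul_le_mul_of_nonneg_left h2 (by positivity : 0 ≤ S.fPrime * S.ε)
  linarith

lemma ρ_le_euclDist (H : S.Admissible U G h) (a b : Phase d) :
    S.ρ a b ≤ √2 * max (S.γ * (1 + S.α)) 1 / S.γ * euclDist a b := by
  have hU := H.potential
  have hγ := H.γ_pos
  refine (ρ_le_f_rs H a b).trans ((f_le hU hγ (rs_nonneg hU hγ a b)).trans ?_)
  rw [div_mul_eq_mul_div, le_div_iff₀ hγ, mul_comm]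
  exact γ_mul_rs_le hU hγ a b

lemma M_eq (H : S.Admissible U G h) : S.M = √2 * S.γ / (S.fPrime * S.ε * min (√(2 * S.κ)) 1)
    * (√2 * max (S.γ * (1 + S.α)) 1 / S.γ) := by
  have hγ := H.γ_pos
  have h2 : (√2 : ℝ) * √2 = 2 := Real.mul_self_sqrt (by norm_num)
  have hm := (min_pos H).ne'
  have hf := (fPrime_pos H.potential hγ).ne'
  have hε := (ε_pos H.potential hγ).ne'
  rw [M, div_mul_div_comm, show √2 * S.γ * (√2 * max (S.γ * (1 + S.α)) 1)
    = S.γ * ((√2 * √2) * max (S.γ * (1 + S.α)) 1) by ring, h2]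
  field_simp

end Data

end KineticLangevin
end

noncomputable section

namespace KineticLangevin

open scoped RealInnerProductSpace ENNReal

/-! ### Wasserstein distances and random maps -/

section RandomMap

variable {d : ℕ} {N Ω : Type*} [MeasurableSpace N] [MeasurableSpace Ω]

lemma isProbabilityMeasure_of_fst {α β : Type*} [MeasurableSpace α] [MeasurableSpace β]
    {μ : Measure α} [IsProbabilityMeasure μ] {ω : Measure (α × β)} (h : ω.fst = μ) :
    IsProbabilityMeasure ω := by
  constructor
  rw [← Measure.fst_univ, h, measure_univ]

/-- The coupled noise may depend on the pair of states, but for every fixed pair it has law ν.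
Fubini therefore gives each marginal of the coupled step the correct law. -/
lemma map_coupled_eq {α β : Type*} [MeasurableSpace α] [MeasurableSpace β] {F : α × N → α}
    (hF : Measurable F) {ν : Measure N} [IsProbabilityMeasure ν] {P : Measure Ω}
    [IsProbabilityMeasure P] {ω : Measure β} [SFinite ω] {π : β → α} (hπ : Measurable π)
    {n : β × Ω → N} (hn : Measurable n) (hlaw : ∀ p, P.map (fun o => n (p, o)) = ν) :
    (ω.prod P).map (fun q => F (π q.1, n q)) = ((ω.map π).prod ν).map F := by
  refine Measure.ext_of_lintegral _ fun g hg => ?_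
  have hg₁ : Measurable fun q : β × Ω => g (F (π q.1, n q)) := by fun_prop
  have hg₂ : Measurable fun q : α × N => g (F q) := hg.comp hF
  rw [lintegral_map hg (by fun_prop), lintegral_map hg hF, lintegral_prod _ hg₁.aemeasurable,
    lintegral_prod _ hg₂.aemeasurable, lintegral_map hg₂.lintegral_prod_right' hπ]
  refine lintegral_congr fun p => ?_
  rw [← hlaw p, lintegral_map (by fun_prop) (by fun_prop)]

/-- A coupling of the noises that contracts the cost in expectation, uniformly in the starting
points, contracts the transport cost. -/
lemma wasserstein_map_le {F : Phase d × N → Phase d} (hF : Measurable F) {ν : Measure N}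
    [IsProbabilityMeasure ν] {P : Measure Ω} [IsProbabilityMeasure P]
    {n₁ n₂ : (Phase d × Phase d) × Ω → N} (hn₁ : Measurable n₁) (hn₂ : Measurable n₂)
    (h₁ : ∀ p, P.map (fun o => n₁ (p, o)) = ν) (h₂ : ∀ p, P.map (fun o => n₂ (p, o)) = ν)
    {ρ : Phase d → Phase d → ℝ} (hρ : Measurable fun p : Phase d × Phase d => ρ p.1 p.2)
    {K : ℝ≥0∞} (hK0 : K ≠ 0) (hK : K ≠ ∞)
    (hle : ∀ a b, ∫⁻ o, ENNReal.ofReal (ρ (F (a, n₁ ((a, b), o))) (F (b, n₂ ((a, b), o)))) ∂P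
      ≤ K * ENNReal.ofReal (ρ a b))
    (μ μ' : Measure (Phase d)) [IsProbabilityMeasure μ] :
    wasserstein ρ ((μ.prod ν).map F) ((μ'.prod ν).map F) ≤ K * wasserstein ρ μ μ' := by
  unfold wasserstein
  -- With the constant inside the infimum every coupling can be treated separately, and no optimal
  -- coupling is needed.
  simp_rw [ENNReal.mul_iInf_of_ne hK0 hK]
  refine le_iInf₂ fun ω hω => ?_
  have := isProbabilityMeasure_of_fst hω.1
  have hm : Measurable fun q : (Phase d × Phase d) × Ω =>
      (F (q.1.1, n₁ q), F (q.1.2, n₂ q)) := by fun_prop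
  refine (iInf₂_le ((ω.prod P).map fun q => (F (q.1.1, n₁ q), F (q.1.2, n₂ q))) ⟨?_, ?_⟩).trans ?_
  · have hρ' : Measurable fun p : Phase d × Phase d => ENNReal.ofReal (ρ p.1 p.2) :=
      hρ.ennreal_ofReal
    have hρm : Measurable fun q : (Phase d × Phase d) × Ω =>
        ENNReal.ofReal (ρ (F (q.1.1, n₁ q)) (F (q.1.2, n₂ q))) := hρ'.comp hm
    rw [lintegral_map hρ' hm, lintegral_prod _ (hρm).aemeasurable,
      ← lintegral_const_mul _ hρ']
    exact lintegral_mono fun p => hle p.1 p.2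
  · rw [Measure.fst, Measure.map_map measurable_fst hm, ← hω.1, Measure.fst]
    exact map_coupled_eq hF measurable_fst hn₁ h₁
  · rw [Measure.snd, Measure.map_map measurable_snd hm, ← hω.2, Measure.snd]
    exact map_coupled_eq hF measurable_snd hn₂ h₂

lemma wasserstein_le_mul {ρ ρ' : Phase d → Phase d → ℝ} {c : ℝ} (hc : 0 < c)
    (h : ∀ a b, ρ a b ≤ c * ρ' a b) (μ ν : Measure (Phase d)) :
    wasserstein ρ μ ν ≤ ENNReal.ofReal c * wasserstein ρ' μ ν := by
  unfold wasserstein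
  simp_rw [ENNReal.mul_iInf_of_ne (ENNReal.ofReal_pos.2 hc).ne' ENNReal.ofReal_ne_top]
  refine iInf₂_mono fun ω _ => ?_
  rw [← lintegral_const_mul' _ _ ENNReal.ofReal_ne_top]
  refine lintegral_mono fun p => ?_
  rw [← ENNReal.ofReal_mul hc.le]
  exact ENNReal.ofReal_le_ofReal (h _ _)

end RandomMap

section Push

variable {d : ℕ} {U : E d → ℝ} {γ h : ℝ}

/-- The law of two independent standard Gaussian vectors. -/
abbrev noisePair (d : ℕ) : Measure (E d × E d) := (stdGaussian (E d)).prod (stdGaussian (E d))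

instance (d : ℕ) : IsProbabilityMeasure (noiseLaw d) := by unfold noiseLaw; infer_instance

lemma map_vec_noisePair (d : ℕ) :
    ((noisePair d).prod (noisePair d)).map (fun p => ![p.1.1, p.1.2, p.2.1, p.2.2])
      = noiseLaw d := by
  have hm : Measurable fun p : (E d × E d) × (E d × E d) =>
      (![p.1.1, p.1.2, p.2.1, p.2.2] : Fin 4 → E d) := by
    refine measurable_pi_lambda _ fun i => ?_
    fin_cases i <;> simp <;> fun_prop
  symm
  refine Measure.pi_eq fun s hs => ?_
  rw [Measure.map_apply hm (MeasurableSet.univ_pi hs)]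
  have h1 : (fun p : (E d × E d) × (E d × E d) =>
      (![p.1.1, p.1.2, p.2.1, p.2.2] : Fin 4 → E d)) ⁻¹' (Set.univ.pi s)
      = (s 0 ×ˢ s 1) ×ˢ (s 2 ×ˢ s 3) := by
    ext p
    simp [Set.mem_pi, Fin.forall_fin_succ]
    tauto
  rw [h1, Measure.prod_prod, Measure.prod_prod, Measure.prod_prod, Fin.prod_univ_four]
  ring

/-- The law of `F (Z, ξ, ζ)` for `Z ∼ μ` and independent Gaussian vectors `ξ`, `ζ`. -/
def push (F : Phase d → E d → E d → Phase d) (μ : Measure (Phase d)) : Measure (Phase d) :=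
  (μ.prod (noisePair d)).map fun p => F p.1 p.2.1 p.2.2

/-- Independence of the noises of the two stages lets them be collected into one vector of four. -/
lemma push_push {F₁ F₂ : Phase d → E d → E d → Phase d}
    (h₁ : Measurable fun p : Phase d × (E d × E d) => F₁ p.1 p.2.1 p.2.2)
    (h₂ : Measurable fun p : Phase d × (E d × E d) => F₂ p.1 p.2.1 p.2.2)
    (μ : Measure (Phase d)) [IsProbabilityMeasure μ] :
    push F₂ (push F₁ μ) = (μ.prod (noiseLaw d)).map
      fun p => F₂ (F₁ p.1 (p.2 0) (p.2 1)) (p.2 2) (p.2 3) := by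
  have h₁' : ∀ {α : Type} [MeasurableSpace α] {a : α → Phase d} {b c : α → E d}, Measurable a →
      Measurable b → Measurable c → Measurable fun x => F₁ (a x) (b x) (c x) :=
    fun ha hb hc => h₁.comp (ha.prodMk (hb.prodMk hc))
  have h₂' : ∀ {α : Type} [MeasurableSpace α] {a : α → Phase d} {b c : α → E d}, Measurable a →
      Measurable b → Measurable c → Measurable fun x => F₂ (a x) (b x) (c x) :=
    fun ha hb hc => h₂.comp (ha.prodMk (hb.prodMk hc))
  have hm : Measurable fun p : (E d × E d) × (E d × E d) =>
      (![p.1.1, p.1.2, p.2.1, p.2.2] : Fin 4 → E d) := by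
    refine measurable_pi_lambda _ fun i => ?_
    fin_cases i <;> simp <;> fun_prop
  refine Measure.ext_of_lintegral _ fun g hg => ?_
  have hgF₂ : Measurable fun p : Phase d × (E d × E d) => g (F₂ p.1 p.2.1 p.2.2) := hg.comp h₂
  have hin : Measurable fun a => ∫⁻ n : E d × E d, g (F₂ a n.1 n.2) ∂(noisePair d) :=
    hgF₂.lintegral_prod_right'
  have hin' : Measurable fun p : Phase d × (E d × E d) =>
      ∫⁻ n : E d × E d, g (F₂ (F₁ p.1 p.2.1 p.2.2) n.1 n.2) ∂(noisePair d) := hin.comp h₁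
  rw [push, lintegral_map hg h₂, lintegral_prod _ hgF₂.aemeasurable, push, lintegral_map hin h₁,
    lintegral_prod _ hin'.aemeasurable, lintegral_map hg]
  swap
  · exact h₂' (h₁' (by fun_prop) (by fun_prop) (by fun_prop)) (by fun_prop) (by fun_prop)
  have hg4 : Measurable fun p : Phase d × (Fin 4 → E d) =>
      g (F₂ (F₁ p.1 (p.2 0) (p.2 1)) (p.2 2) (p.2 3)) :=
    hg.comp (h₂' (h₁' (by fun_prop) (by fun_prop) (by fun_prop)) (by fun_prop) (by fun_prop))
  rw [lintegral_prod _ hg4.aemeasurable]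
  refine lintegral_congr fun a => ?_
  have hg5 : Measurable fun y : Fin 4 → E d => g (F₂ (F₁ a (y 0) (y 1)) (y 2) (y 3)) :=
    hg4.comp measurable_prodMk_left
  have h6 := lintegral_prod (μ := noisePair d) (ν := noisePair d) _ (hg5.comp hm).aemeasurable
  rw [← map_vec_noisePair, lintegral_map hg5 hm]
  exact h6.symm

lemma isProbabilityMeasure_push {F : Phase d → E d → E d → Phase d}
    (hF : Measurable fun p : Phase d × (E d × E d) => F p.1 p.2.1 p.2.2)
    {μ : Measure (Phase d)} (hμ : IsProbabilityMeasure μ) : IsProbabilityMeasure (push F μ) :=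
  Measure.isProbabilityMeasure_map hF.aemeasurable

/-- If the map expands the cost by at most `K` for every value of the noise, then it expands the
transport cost by at most `K`. -/
lemma wasserstein_push_le {F : Phase d → E d → E d → Phase d}
    (hF : Measurable fun p : Phase d × (E d × E d) => F p.1 p.2.1 p.2.2)
    {ρ : Phase d → Phase d → ℝ} (hρ : Measurable fun p : Phase d × Phase d => ρ p.1 p.2)
    {K : ℝ} (hK : 0 < K) (hle : ∀ ξ ζ a b, ρ (F a ξ ζ) (F b ξ ζ) ≤ K * ρ a b)
    (μ μ' : Measure (Phase d)) [IsProbabilityMeasure μ] :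
    wasserstein ρ (push F μ) (push F μ') ≤ ENNReal.ofReal K * wasserstein ρ μ μ' := by
  refine wasserstein_map_le (n₁ := Prod.snd) (n₂ := Prod.snd) (P := noisePair d) hF measurable_snd
    measurable_snd (fun _ => Measure.map_id) (fun _ => Measure.map_id) hρ
    (ENNReal.ofReal_pos.2 hK).ne' ENNReal.ofReal_ne_top (fun a b => ?_) μ μ'
  calc _ ≤ ∫⁻ _, ENNReal.ofReal (K * ρ a b) ∂(noisePair d) :=
        lintegral_mono fun n => ENNReal.ofReal_le_ofReal (hle _ _ _ _)
    _ = _ := by rw [lintegral_const, measure_univ, mul_one, ENNReal.ofReal_mul hK.le]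

@[fun_prop]
lemma continuous_stepU (γ h : ℝ) :
    Continuous fun p : Phase d × (E d × E d) => stepU γ h p.2.1 p.2.2 p.1 := by
  unfold stepU noise1 noise2; fun_prop

lemma continuous_stepB (hU : Continuous (gradient U)) (h : ℝ) : Continuous (stepB U h) := by
  unfold stepB; fun_prop

lemma continuous_stepUBU (hU : Continuous (gradient U)) (γ h : ℝ) :
    Continuous fun p : Phase d × (Fin 4 → E d) => stepUBU U γ h p.1 p.2 := by
  have h1 : Continuous fun p : Phase d × (Fin 4 → E d) =>
      stepU γ (h / 2) (p.2 0) (p.2 1) p.1 := (continuous_stepU γ (h / 2)).comp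
    (by fun_prop : Continuous fun p : Phase d × (Fin 4 → E d) => (p.1, (p.2 0, p.2 1)))
  have h2 : Continuous fun p : Phase d × (Fin 4 → E d) =>
      (stepB U h (stepU γ (h / 2) (p.2 0) (p.2 1) p.1), (p.2 2, p.2 3)) :=
    ((continuous_stepB hU h).comp h1).prodMk (by fun_prop)
  exact (continuous_stepU γ (h / 2)).comp h2

lemma isProbabilityMeasure_ubuPush (hU : Continuous (gradient U)) {μ : Measure (Phase d)}
    (hμ : IsProbabilityMeasure μ) : IsProbabilityMeasure (ubuPush U γ h μ) :=
  Measure.isProbabilityMeasure_map (continuous_stepUBU hU γ h).measurable.aemeasurable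

lemma isProbabilityMeasure_ubuLaw (hU : Continuous (gradient U)) {μ : Measure (Phase d)}
    (hμ : IsProbabilityMeasure μ) (k : ℕ) : IsProbabilityMeasure (ubuLaw U γ h μ k) := by
  induction k with
  | zero => exact hμ
  | succ k ih => exact isProbabilityMeasure_ubuPush hU ih

end Push

namespace Data

variable {d : ℕ} {S : Data d} {U G : E d → ℝ} {h : ℝ}

lemma continuous_rl (S : Data d) : Continuous fun p : Phase d × Phase d => S.rl p.1 p.2 := by
  have h1 : Continuous fun x : E d => act S.K x :=
    LinearMap.continuous_of_finiteDimensional (Matrix.toEuclideanLin S.K)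
  unfold rl; fun_prop

lemma continuous_rs (S : Data d) : Continuous fun p : Phase d × Phase d => S.rs p.1 p.2 := by
  unfold rs; fun_prop

lemma continuous_Δ (S : Data d) : Continuous fun p : Phase d × Phase d => S.Δ p.1 p.2 := by
  have h1 := continuous_rl S
  have h2 := continuous_rs S
  unfold Δ; fun_prop

lemma continuous_ρ (S : Data d) : Continuous fun p : Phase d × Phase d => S.ρ p.1 p.2 := by
  have h1 := continuous_rl S
  have h2 := continuous_Δ S
  have h3 := continuous_f S
  unfold ρ; fun_prop

lemma measurable_stepU' (S : Data d) (h : ℝ) : Measurable fun p : Phase d × (E d × E d) =>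
    stepU S.γ (h / 2) p.2.1 p.2.2 p.1 := (continuous_stepU _ _).measurable

lemma continuous_stepBU (hU : S.IsPotential U G) (h : ℝ) :
    Continuous fun p : Phase d × (E d × E d) => S.stepBU U h p.1 p.2.1 p.2.2 := by
  have h1 := continuous_stepB hU.continuous_gradient h
  exact (continuous_stepU S.γ (h / 2)).comp (by fun_prop :
    Continuous fun p : Phase d × (E d × E d) => (stepB U h p.1, p.2))

/-- The first half flight of a step. -/
def pushU (S : Data d) (h : ℝ) (μ : Measure (Phase d)) : Measure (Phase d) :=
  push (fun z ξ ζ => stepU S.γ (h / 2) ξ ζ z) μ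

/-- The kick and the second half flight of a step. -/
def pushBU (S : Data d) (U : E d → ℝ) (h : ℝ) (μ : Measure (Phase d)) : Measure (Phase d) :=
  push (S.stepBU U h) μ

lemma ubuPush_eq (hU : S.IsPotential U G) (h : ℝ) (μ : Measure (Phase d))
    [IsProbabilityMeasure μ] : ubuPush U S.γ h μ = S.pushBU U h (S.pushU h μ) := by
  rw [pushBU, pushU, push_push (measurable_stepU' S h) (continuous_stepBU hU h).measurable]
  rfl

lemma pushU_pushBU_eq (hU : S.IsPotential U G) (h : ℝ) (μ : Measure (Phase d))
    [IsProbabilityMeasure μ] : S.pushU h (S.pushBU U h μ)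
      = (μ.prod (noiseLaw d)).map (fun p => S.stepQ U h p.1 p.2) := by
  rw [pushBU, pushU, push_push (continuous_stepBU hU h).measurable (measurable_stepU' S h)]
  rfl

lemma isProbabilityMeasure_pushU (h : ℝ) {μ : Measure (Phase d)}
    (hμ : IsProbabilityMeasure μ) : IsProbabilityMeasure (S.pushU h μ) :=
  isProbabilityMeasure_push (measurable_stepU' S h) hμ

lemma isProbabilityMeasure_pushBU (hU : S.IsPotential U G) (h : ℝ) {μ : Measure (Phase d)}
    (hμ : IsProbabilityMeasure μ) : IsProbabilityMeasure (S.pushBU U h μ) :=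
  isProbabilityMeasure_push (continuous_stepBU hU h).measurable hμ

lemma measurable_shiftVec (S : Data d) (h : ℝ) : Measurable (S.shiftVec h) := by
  unfold shiftVec
  refine (PiLp.continuous_toLp 2 _).measurable.comp (measurable_pi_lambda _ fun i => ?_)
  fin_cases i <;> simp <;> fun_prop

lemma measurable_noiseShift (hU : S.IsPotential U G) (h : ℝ) :
    Measurable fun p : Phase d × Phase d => S.noiseShift U h p.1 p.2 := by
  have h1 := (continuous_Δ S).measurable
  have h2 := (continuous_stepB hU.continuous_gradient h).measurable
  have h3 : MeasurableSet {p : Phase d × Phase d | S.Δ p.1 p.2 ≤ S.DK} :=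
    measurableSet_le h1 measurable_const
  have h4 : MeasurableSet {p : Phase d × Phase d |
      ‖dz p.1 p.2‖ < 4 * ‖dz p.1 p.2 + S.dp p.1 p.2‖} := by
    unfold dz dp; exact measurableSet_lt (by fun_prop) (by fun_prop)
  unfold noiseShift
  refine Measurable.ite (h3.inter h4) ?_ measurable_const
  · refine (measurable_shiftVec S h).comp ?_
    have h5 : Measurable fun p : Phase d × Phase d => stepB U h p.1 := h2.comp measurable_fst
    have h6 : Measurable fun p : Phase d × Phase d => stepB U h p.2 := h2.comp measurable_snd
    have h7 : Measurable fun p : Phase d × Phase d =>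
        S.γ⁻¹ • ((stepB U h p.1).2 - (stepB U h p.2).2) :=
      (h5.snd.sub h6.snd).const_smul S.γ⁻¹
    exact (h5.fst.sub h6.fst).add h7

lemma measurable_stepU_comp (S : Data d) (h : ℝ) {F : Phase d × (Fin 4 → E d) → Phase d}
    (hF : Measurable F) :
    Measurable fun p : Phase d × (Fin 4 → E d) => stepU S.γ (h / 2) (p.2 2) (p.2 3) (F p) := by
  have h3 : Measurable fun p : Phase d × (Fin 4 → E d) =>
      (F p, (p.2 2, p.2 3)) := hF.prodMk (by fun_prop)
  exact (measurable_stepU' S h).comp h3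

lemma measurable_stepQ (hU : S.IsPotential U G) (h : ℝ) :
    Measurable fun p : Phase d × (Fin 4 → E d) => S.stepQ U h p.1 p.2 := by
  have h1 : Measurable fun p : Phase d × (Fin 4 → E d) => S.stepBU U h p.1 (p.2 0) (p.2 1) :=
    (continuous_stepBU hU h).measurable.comp
      (by fun_prop : Measurable fun p : Phase d × (Fin 4 → E d) => (p.1, (p.2 0, p.2 1)))
  exact measurable_stepU_comp S h h1

lemma rate_mul_lt_one (H : S.Admissible U G h) : S.rate h * h < 1 := by
  have h1 := H.rate_mul_le.1
  have h2 := H.δ_le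
  have h3 := H.fPrime_le_one
  have h5 : S.fPrime * (S.γ * h / 16) ≤ 1 * (S.γ * h / 16) :=
    mul_le_mul_of_nonneg_right h3 (by linarith [H.δ_pos])
  linarith

/-- The kick followed by two half flights contracts the transport cost. -/
lemma wasserstein_pushU_pushBU_le (H : S.Admissible U G h) (μ μ' : Measure (Phase d))
    [IsProbabilityMeasure μ] [IsProbabilityMeasure μ'] :
    wasserstein S.ρ (S.pushU h (S.pushBU U h μ)) (S.pushU h (S.pushBU U h μ'))
      ≤ ENNReal.ofReal (1 - S.rate h * h) * wasserstein S.ρ μ μ' := by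
  have hU := H.potential
  rw [pushU_pushBU_eq hU, pushU_pushBU_eq hU]
  have hpos : 0 < 1 - S.rate h * h := by linarith [rate_mul_lt_one H]
  refine wasserstein_map_le (P := reflLaw (Noise d)) (n₁ := fun q => q.2.1.ofLp)
    (n₂ := fun q => (reflNoise (S.noiseShift U h q.1.1 q.1.2) q.2.1 q.2.2).ofLp)
    (measurable_stepQ hU h) ?_ ?_ ?_ ?_ (continuous_ρ S).measurable
    (ENNReal.ofReal_pos.2 hpos).ne' ENNReal.ofReal_ne_top (lintegral_ρ_stepQ_le H) μ μ'
  · fun_prop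
  · have h1 := measurable_noiseShift hU h
    have h2 := measurable_reflNoise (V := Noise d)
    have h3 : Measurable fun q : (Phase d × Phase d) × (Noise d × ℝ) =>
        (S.noiseShift U h q.1.1 q.1.2, q.2) := (h1.comp measurable_fst).prodMk measurable_snd
    have h4 : Measurable fun q : (Phase d × Phase d) × (Noise d × ℝ) =>
        reflNoise (S.noiseShift U h q.1.1 q.1.2) q.2.1 q.2.2 := h2.comp h3
    fun_prop
  · intro p
    change (reflLaw (Noise d)).map (WithLp.ofLp ∘ Prod.fst) = _
    rw [← map_ofLp_stdGaussian, ← Measure.map_map (by fun_prop) measurable_fst,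
      Measure.map_fst_prod, measure_univ, one_smul]
  · intro p
    rw [← map_ofLp_stdGaussian, ← map_reflNoise (S.noiseShift U h p.1 p.2),
      Measure.map_map (by fun_prop) (measurable_reflNoise_right _)]
    rfl

/-- Regrouping of (UBU)…(UBU): the last half flight of each step joins the first one of the next. -/
lemma ubuLaw_succ_eq (hU : S.IsPotential U G) (h : ℝ) {μ : Measure (Phase d)}
    (hμ : IsProbabilityMeasure μ) (k : ℕ) : ubuLaw U S.γ h μ (k + 1)
      = S.pushBU U h ((fun ν => S.pushU h (S.pushBU U h ν))^[k] (S.pushU h μ)) := by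
  induction k with
  | zero => exact ubuPush_eq hU h μ
  | succ k ih =>
    have := isProbabilityMeasure_ubuLaw (γ := S.γ) (h := h) hU.continuous_gradient hμ (k + 1)
    rw [ubuLaw, ubuPush_eq hU, ih, Function.iterate_succ_apply']

lemma isProbabilityMeasure_iterate (hU : S.IsPotential U G) (h : ℝ) {μ : Measure (Phase d)}
    (hμ : IsProbabilityMeasure μ) (k : ℕ) :
    IsProbabilityMeasure ((fun ν => S.pushU h (S.pushBU U h ν))^[k] μ) := by
  induction k with
  | zero => exact hμ
  | succ k ih =>
    rw [Function.iterate_succ_apply']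
    exact isProbabilityMeasure_pushU h (isProbabilityMeasure_pushBU hU h ih)

lemma wasserstein_iterate_le (H : S.Admissible U G h) {μ μ' : Measure (Phase d)}
    (hμ : IsProbabilityMeasure μ) (hμ' : IsProbabilityMeasure μ') (k : ℕ) :
    wasserstein S.ρ ((fun ν => S.pushU h (S.pushBU U h ν))^[k] μ)
      ((fun ν => S.pushU h (S.pushBU U h ν))^[k] μ')
      ≤ ENNReal.ofReal ((1 - S.rate h * h) ^ k) * wasserstein S.ρ μ μ' := by
  have hpos : 0 < 1 - S.rate h * h := by linarith [rate_mul_lt_one H]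
  induction k with
  | zero => simp
  | succ k ih =>
    have h1 := isProbabilityMeasure_iterate H.potential h hμ k
    have h2 := isProbabilityMeasure_iterate H.potential h hμ' k
    rw [Function.iterate_succ_apply', Function.iterate_succ_apply']
    refine (wasserstein_pushU_pushBU_le H _ _).trans ((mul_le_mul_right ih _).trans_eq ?_)
    rw [← mul_assoc, ← ENNReal.ofReal_mul hpos.le, pow_succ']

/-- Convergence in the transport distance with cost `ρ`. -/
theorem wasserstein_ρ_ubuLaw_le (H : S.Admissible U G h) {μ μ' : Measure (Phase d)}
    (hμ : IsProbabilityMeasure μ) (hμ' : IsProbabilityMeasure μ') (k : ℕ) :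
    wasserstein S.ρ (ubuLaw U S.γ h μ k) (ubuLaw U S.γ h μ' k)
      ≤ ENNReal.ofReal (S.C h * Real.exp (-(S.rate h * k * h))) * wasserstein S.ρ μ μ' := by
  have hU := H.potential
  cases k with
  | zero =>
    have h1 : (1 : ℝ≥0∞) ≤ ENNReal.ofReal (S.C h * Real.exp (-(S.rate h * (0 : ℕ) * h))) := by
      rw [← ENNReal.ofReal_one]
      refine ENNReal.ofReal_le_ofReal ?_
      simpa using one_le_C H
    exact le_mul_of_one_le_left (zero_le) h1
  | succ k =>
    have hl : 0 < S.lossFactor h := zero_lt_one.trans_le (one_le_lossFactor H)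
    have hpos : 0 < 1 - S.rate h * h := by linarith [rate_mul_lt_one H]
    have h1 := isProbabilityMeasure_pushU (S := S) h hμ
    have h1' := isProbabilityMeasure_pushU (S := S) h hμ'
    have h2 := isProbabilityMeasure_iterate hU h h1 k
    have e1 : wasserstein S.ρ (S.pushU h μ) (S.pushU h μ')
        ≤ ENNReal.ofReal (S.lossFactor h) * wasserstein S.ρ μ μ' :=
      wasserstein_push_le (measurable_stepU' S h) (continuous_ρ S).measurable hl
        (ρ_stepU_le H) μ μ'
    have e2 := wasserstein_iterate_le H h1 h1' k
    rw [ubuLaw_succ_eq hU h hμ, ubuLaw_succ_eq hU h hμ']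
    -- Both ends use synchronous noise and cost `lossFactor`; only the k inner steps contract.
    refine (wasserstein_push_le (continuous_stepBU hU h).measurable (continuous_ρ S).measurable hl
      (ρ_stepBU_le H) _ _).trans ?_
    refine (mul_le_mul_right (e2.trans (mul_le_mul_right e1 _)) _).trans ?_
    rw [← mul_assoc, ← mul_assoc, ← ENNReal.ofReal_mul hl.le, ← ENNReal.ofReal_mul (by positivity),
      mul_assoc]
    exact mul_le_mul_left (ENNReal.ofReal_le_ofReal (lossFactor_mul_pow_le H k)) _

/-- Convergence in the `L¹`-Wasserstein distance. -/
theorem wasserstein_euclDist_ubuLaw_le (H : S.Admissible U G h) {μ μ' : Measure (Phase d)}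
    (hμ : IsProbabilityMeasure μ) (hμ' : IsProbabilityMeasure μ') (k : ℕ) :
    wasserstein euclDist (ubuLaw U S.γ h μ k) (ubuLaw U S.γ h μ' k)
      ≤ ENNReal.ofReal (S.C h * S.M * Real.exp (-(S.rate h * k * h)))
        * wasserstein euclDist μ μ' := by
  have hγ := H.γ_pos
  have hm := min_pos H
  have hf := fPrime_pos H.potential hγ
  have hε := ε_pos H.potential hγ
  have hC := C_pos H
  have h1 : 0 < √2 * S.γ / (S.fPrime * S.ε * min (√(2 * S.κ)) 1) := by positivity
  have h2 : 0 < √2 * max (S.γ * (1 + S.α)) 1 / S.γ := by positivity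
  refine (wasserstein_le_mul h1 (euclDist_le_ρ H) _ _).trans ?_
  refine (mul_le_mul_right ((wasserstein_ρ_ubuLaw_le H hμ hμ' k).trans
    (mul_le_mul_right (wasserstein_le_mul h2 (ρ_le_euclDist H) _ _) _)) _).trans_eq ?_
  rw [M_eq H, ← mul_assoc, ← mul_assoc, ← ENNReal.ofReal_mul h1.le,
    ← ENNReal.ofReal_mul (by positivity)]
  congr 2
  ring

end Data

end KineticLangevin
end

/-! ### Test functions against W₁, and the Markov operator. -/

noncomputable section

namespace KineticLangevin

open Filter Topology
open scoped RealInnerProductSpace ENNReal NNReal BoundedContinuousFunction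

section Dist

variable {d : ℕ}

lemma euclDist_eq (a b : Phase d) : euclDist a b = ‖WithLp.toLp 2 (a - b)‖ := by
  rw [WithLp.prod_norm_eq_of_L2]; rfl

lemma euclDist_nonneg (a b : Phase d) : 0 ≤ euclDist a b := Real.sqrt_nonneg _

lemma euclDist_comm (a b : Phase d) : euclDist a b = euclDist b a := by
  rw [euclDist, euclDist, norm_sub_rev a.1, norm_sub_rev a.2]

lemma euclDist_triangle (a b c : Phase d) : euclDist a c ≤ euclDist a b + euclDist b c := by
  rw [euclDist_eq, euclDist_eq, euclDist_eq]
  have : WithLp.toLp 2 (a - c) = WithLp.toLp 2 (a - b) + WithLp.toLp 2 (b - c) := by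
    rw [← WithLp.toLp_add]; congr 1; abel
  rw [this]
  exact norm_add_le _ _

lemma dist_le_euclDist (a b : Phase d) : dist a b ≤ euclDist a b := by
  rw [dist_eq_norm, Prod.norm_def, euclDist]
  refine max_le ?_ ?_
  · exact Real.le_sqrt_of_sq_le (by rw [Prod.fst_sub]; linarith [sq_nonneg ‖a.2 - b.2‖])
  · exact Real.le_sqrt_of_sq_le (by rw [Prod.snd_sub]; linarith [sq_nonneg ‖a.1 - b.1‖])

lemma norm_le_euclDist (a : Phase d) : ‖a‖ ≤ euclDist a 0 := by
  simpa using dist_le_euclDist a 0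

lemma euclDist_zero_le (a : Phase d) : euclDist a 0 ≤ 2 * ‖a‖ := by
  rw [euclDist, Real.sqrt_le_left (by positivity)]
  have h1 : ‖a.1 - (0 : Phase d).1‖ ≤ ‖a‖ := by simpa using norm_fst_le a
  have h2 : ‖a.2 - (0 : Phase d).2‖ ≤ ‖a‖ := by simpa using norm_snd_le a
  have h3 := pow_le_pow_left₀ (norm_nonneg _) h1 2
  have h4 := pow_le_pow_left₀ (norm_nonneg _) h2 2
  nlinarith [sq_nonneg ‖a‖]

lemma continuous_euclDist : Continuous fun p : Phase d × Phase d => euclDist p.1 p.2 := by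
  unfold euclDist; fun_prop

lemma continuous_euclDist_zero : Continuous fun a : Phase d => euclDist a 0 := by
  unfold euclDist; fun_prop

/-- The integral of a Lipschitz function changes by at most its constant times the transport
distance. -/
lemma lintegral_le_add_wasserstein {g : Phase d → ℝ≥0∞} (hg : Measurable g) {K : ℝ} (hK : 0 < K)
    (hle : ∀ a b, g a ≤ g b + ENNReal.ofReal (K * euclDist a b)) (μ ν : Measure (Phase d)) :
    ∫⁻ a, g a ∂μ ≤ ∫⁻ a, g a ∂ν + ENNReal.ofReal K * wasserstein euclDist μ ν ∧
    ∫⁻ a, g a ∂ν ≤ ∫⁻ a, g a ∂μ + ENNReal.ofReal K * wasserstein euclDist μ ν := by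
  unfold wasserstein
  simp_rw [ENNReal.mul_iInf_of_ne (ENNReal.ofReal_pos.2 hK).ne' ENNReal.ofReal_ne_top,
    ENNReal.add_iInf]
  have hm : Measurable fun p : Phase d × Phase d => ENNReal.ofReal (euclDist p.1 p.2) :=
    continuous_euclDist.measurable.ennreal_ofReal
  have hg₁ : Measurable fun p : Phase d × Phase d => g p.1 := hg.comp measurable_fst
  have hg₂ : Measurable fun p : Phase d × Phase d => g p.2 := hg.comp measurable_snd
  constructor
  · refine le_iInf₂ fun ω hω => ?_
    rw [← hω.1, ← hω.2, Measure.fst, Measure.snd, lintegral_map hg measurable_fst,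
      lintegral_map hg measurable_snd, ← lintegral_const_mul _ hm,
      ← lintegral_add_left hg₂]
    refine lintegral_mono fun p => (hle p.1 p.2).trans_eq ?_
    rw [ENNReal.ofReal_mul hK.le]
  · refine le_iInf₂ fun ω hω => ?_
    rw [← hω.1, ← hω.2, Measure.fst, Measure.snd, lintegral_map hg measurable_fst,
      lintegral_map hg measurable_snd, ← lintegral_const_mul _ hm,
      ← lintegral_add_left hg₁]
    refine lintegral_mono fun p => (hle p.2 p.1).trans_eq ?_
    rw [ENNReal.ofReal_mul hK.le, euclDist_comm]

lemma wasserstein_dirac_le (ν : Measure (Phase d)) [IsProbabilityMeasure ν] (a : Phase d) :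
    wasserstein euclDist (Measure.dirac a) ν ≤ ∫⁻ b, ENNReal.ofReal (euclDist a b) ∂ν := by
  refine (iInf₂_le ((Measure.dirac a).prod ν) ⟨?_, ?_⟩).trans_eq ?_
  · rw [Measure.dirac_prod, lintegral_map
      (continuous_euclDist.measurable.ennreal_ofReal) measurable_prodMk_left]
  · rw [Measure.fst_prod]
  · rw [Measure.snd_prod]

/-- The constant K + 1 instead of K stays positive, as `lintegral_le_add_wasserstein` requires. -/
lemma le_add_of_lipschitz {g : Phase d →ᵇ ℝ≥0} {K : ℝ≥0} (hg : LipschitzWith K g) (a b : Phase d) :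
    (g a : ℝ≥0∞) ≤ g b + ENNReal.ofReal ((K + 1 : ℝ) * euclDist a b) := by
  have h1 : dist (g a) (g b) ≤ K * dist a b := hg.dist_le_mul a b
  have h2 : (g a : ℝ) ≤ g b + (K + 1) * euclDist a b := by
    rw [NNReal.dist_eq] at h1
    have h3 := (le_abs_self _).trans h1
    have h4 := mul_le_mul_of_nonneg_left (dist_le_euclDist a b) K.2
    have h5 := euclDist_nonneg a b
    simp only [NNReal.val_eq_coe] at h4
    linarith
  have h3 : 0 ≤ (K + 1 : ℝ) * euclDist a b := mul_nonneg (by positivity) (euclDist_nonneg a b)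
  calc (g a : ℝ≥0∞) = ENNReal.ofReal (g a : ℝ) := (ENNReal.ofReal_coe_nnreal).symm
    _ ≤ ENNReal.ofReal (g b + (K + 1) * euclDist a b) := ENNReal.ofReal_le_ofReal h2
    _ = _ := by rw [ENNReal.ofReal_add (NNReal.coe_nonneg _) h3, ENNReal.ofReal_coe_nnreal]

/-- Bounded Lipschitz functions determine a probability measure. -/
lemma eq_of_forall_lipschitz {μ ν : Measure (Phase d)} [IsProbabilityMeasure μ]
    [IsProbabilityMeasure ν] (h : ∀ (g : Phase d →ᵇ ℝ≥0) (K : ℝ≥0), LipschitzWith K g →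
      ∫⁻ a, g a ∂μ = ∫⁻ a, g a ∂ν) : μ = ν := by
  refine ext_of_generate_finite _ (BorelSpace.measurable_eq.trans borel_eq_generateFrom_isClosed)
    isPiSystem_isClosed (fun F hF => ?_) (by simp)
  have hpos : ∀ n : ℕ, 0 < 1 / ((n : ℝ) + 1) := fun n => by positivity
  -- Indicators of closed sets are limits of thickened indicators, which are bounded and Lipschitz.
  have h1 := tendsto_lintegral_thickenedIndicator_of_isClosed μ hF hpos
    tendsto_one_div_add_atTop_nhds_zero_nat
  have h2 := tendsto_lintegral_thickenedIndicator_of_isClosed ν hF hpos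
    tendsto_one_div_add_atTop_nhds_zero_nat
  refine tendsto_nhds_unique h1 (h2.congr fun n => ?_)
  exact (h _ _ (lipschitzWith_thickenedIndicator (hpos n) F)).symm

end Dist

/-! ### The Markov operator -/

section Markov

variable {d : ℕ} {U : E d → ℝ} {γ h : ℝ}

lemma continuous_stepUBU_left (hU : Continuous (gradient U)) (γ h : ℝ) (ξ : Fin 4 → E d) :
    Continuous fun b => stepUBU U γ h b ξ := by
  have h1 := (continuous_stepUBU hU γ h).comp (continuous_id.prodMk (continuous_const (y := ξ)))
  exact h1

lemma continuous_stepUBU_right (hU : Continuous (gradient U)) (γ h : ℝ) (b : Phase d) :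
    Continuous fun ξ => stepUBU U γ h b ξ := by
  have h1 := (continuous_stepUBU hU γ h).comp ((continuous_const (y := b)).prodMk continuous_id)
  exact h1

/-- The Markov operator of the chain. -/
def markov (U : E d → ℝ) (γ h : ℝ) (g : Phase d → ℝ≥0∞) (a : Phase d) : ℝ≥0∞ :=
  ∫⁻ ξ, g (stepUBU U γ h a ξ) ∂(noiseLaw d)

lemma measurable_markov (hU : Continuous (gradient U)) {g : Phase d → ℝ≥0∞} (hg : Measurable g) :
    Measurable (markov U γ h g) :=
  (hg.comp (continuous_stepUBU hU γ h).measurable).lintegral_prod_right'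

lemma lintegral_ubuPush (hU : Continuous (gradient U)) {g : Phase d → ℝ≥0∞} (hg : Measurable g)
    (μ : Measure (Phase d)) [SFinite μ] :
    ∫⁻ a, g a ∂(ubuPush U γ h μ) = ∫⁻ a, markov U γ h g a ∂μ := by
  have h1 : Measurable fun p : Phase d × (Fin 4 → E d) => g (stepUBU U γ h p.1 p.2) :=
    hg.comp (continuous_stepUBU hU γ h).measurable
  rw [ubuPush, lintegral_map hg (continuous_stepUBU hU γ h).measurable,
    lintegral_prod _ h1.aemeasurable]
  rfl

lemma lintegral_ubuLaw (hU : Continuous (gradient U)) {μ : Measure (Phase d)}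
    (hμ : IsProbabilityMeasure μ) (k : ℕ) {g : Phase d → ℝ≥0∞} (hg : Measurable g) :
    Measurable ((markov U γ h)^[k] g) ∧
      ∫⁻ a, g a ∂(ubuLaw U γ h μ k) = ∫⁻ a, (markov U γ h)^[k] g a ∂μ := by
  induction k generalizing g with
  | zero => exact ⟨hg, rfl⟩
  | succ k ih =>
    have h1 := isProbabilityMeasure_ubuLaw (γ := γ) (h := h) hU hμ k
    have h2 := measurable_markov (γ := γ) (h := h) hU hg
    rw [ubuLaw, lintegral_ubuPush hU hg, Function.iterate_succ_apply]
    exact ih h2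

lemma iterate_markov_eq (hU : Continuous (gradient U)) (k : ℕ) {g : Phase d → ℝ≥0∞}
    (hg : Measurable g) (a : Phase d) :
    (markov U γ h)^[k] g a = ∫⁻ b, g b ∂(ubuLaw U γ h (Measure.dirac a) k) := by
  have h1 := lintegral_ubuLaw (γ := γ) (h := h) hU (μ := Measure.dirac a) inferInstance k hg
  rw [h1.2, lintegral_dirac' _ h1.1]

lemma ubuLaw_of_invariant {π : Measure (Phase d)} (hπ : ubuPush U γ h π = π) (k : ℕ) :
    ubuLaw U γ h π k = π := by
  induction k with
  | zero => rfl
  | succ k ih => rw [ubuLaw, ih, hπ]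

lemma ubuLaw_ubuPush (μ : Measure (Phase d)) (k : ℕ) :
    ubuLaw U γ h (ubuPush U γ h μ) k = ubuLaw U γ h μ (k + 1) := by
  induction k with
  | zero => rfl
  | succ k ih => rw [ubuLaw, ih, ubuLaw, ubuLaw, ubuLaw]

/-- The chain has the Feller property. -/
lemma continuous_markov (hU : Continuous (gradient U)) (g : Phase d →ᵇ ℝ≥0) :
    Continuous (markov U γ h fun a => (g a : ℝ≥0∞)) := by
  refine continuous_iff_continuousAt.2 fun a => ?_
  refine tendsto_lintegral_filter_of_dominated_convergence (fun _ => (nndist g 0 : ℝ≥0∞)) ?_ ?_ ?_ ?_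
  · refine .of_forall fun b => ?_
    have h2 : Continuous fun ξ => g (stepUBU U γ h b ξ) :=
      g.continuous.comp (continuous_stepUBU_right hU γ h b)
    exact h2.measurable.coe_nnreal_ennreal
  · refine .of_forall fun b => .of_forall fun ξ => ?_
    exact ENNReal.coe_le_coe.2 (BoundedContinuousFunction.NNReal.upper_bound g _)
  · simp
  · refine .of_forall fun ξ => ?_
    have h2 : Continuous fun b => (g (stepUBU U γ h b ξ) : ℝ≥0∞) :=
      ENNReal.continuous_coe.comp (g.continuous.comp (continuous_stepUBU_left hU γ h ξ))
    exact h2.continuousAt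

lemma markov_le (g : Phase d →ᵇ ℝ≥0) (a : Phase d) :
    markov U γ h (fun a => (g a : ℝ≥0∞)) a ≤ nndist g 0 := by
  calc _ ≤ ∫⁻ _, (nndist g 0 : ℝ≥0∞) ∂(noiseLaw d) := lintegral_mono fun ξ => by
        exact ENNReal.coe_le_coe.2 (BoundedContinuousFunction.NNReal.upper_bound g _)
    _ = _ := by simp

/-- A continuous function that takes values in `[0, B]`, as a bounded continuous function. -/
def boundedOfLe (g : Phase d → ℝ≥0) (hg : Continuous g) (B : ℝ≥0) (hB : ∀ a, g a ≤ B) :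
    Phase d →ᵇ ℝ≥0 :=
  BoundedContinuousFunction.mkOfBound ⟨g, hg⟩ B fun a b => by
    have h1 := NNReal.coe_le_coe.2 (hB a)
    have h2 := NNReal.coe_le_coe.2 (hB b)
    have h3 := NNReal.coe_nonneg (g a)
    have h4 := NNReal.coe_nonneg (g b)
    rw [ContinuousMap.coe_mk, NNReal.dist_eq, abs_sub_le_iff]
    constructor <;> linarith

/-- The image of a bounded continuous function under the Markov operator. -/
def markovBCF (hU : Continuous (gradient U)) (γ h : ℝ) (g : Phase d →ᵇ ℝ≥0) : Phase d →ᵇ ℝ≥0 :=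
  boundedOfLe (fun a => (markov U γ h (fun a => (g a : ℝ≥0∞)) a).toNNReal)
    (ENNReal.continuousOn_toNNReal.comp_continuous (continuous_markov hU g)
      fun a => ne_top_of_le_ne_top ENNReal.coe_ne_top (markov_le g a)) (nndist g 0)
    fun a => ENNReal.toNNReal_mono ENNReal.coe_ne_top (markov_le g a)

lemma markovBCF_apply (hU : Continuous (gradient U)) (g : Phase d →ᵇ ℝ≥0) (a : Phase d) :
    (markovBCF hU γ h g a : ℝ≥0∞) = markov U γ h (fun a => (g a : ℝ≥0∞)) a :=
  ENNReal.coe_toNNReal (ne_top_of_le_ne_top ENNReal.coe_ne_top (markov_le g a))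

end Markov

end KineticLangevin
end

noncomputable section

namespace KineticLangevin

open Filter Topology
open scoped RealInnerProductSpace ENNReal NNReal BoundedContinuousFunction

/-! ### The first moment after one step -/

section Moment

variable {d : ℕ}

/-- The step `𝓤` is linear in the position, the velocity and the noise. -/
def stepULinear (d : ℕ) (γ t : ℝ) : (Phase d × (E d × E d)) →ₗ[ℝ] Phase d where
  toFun p := stepU γ t p.2.1 p.2.2 p.1
  map_add' p q := by
    refine Prod.ext ?_ ?_ <;> simp only [stepU, noise1, noise2, Prod.fst_add, Prod.snd_add] <;> module
  map_smul' c p := by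
    refine Prod.ext ?_ ?_ <;>
      simp only [stepU, noise1, noise2, Prod.smul_fst, Prod.smul_snd, RingHom.id_apply] <;> module

lemma exists_norm_stepU_le (d : ℕ) (γ t : ℝ) :
    ∃ c, 0 ≤ c ∧ ∀ (ξ ζ : E d) (z : Phase d), ‖stepU γ t ξ ζ z‖ ≤ c * (‖z‖ + ‖ξ‖ + ‖ζ‖) := by
  refine ⟨‖(stepULinear d γ t).toContinuousLinearMap‖, norm_nonneg _, fun ξ ζ z => ?_⟩
  refine ((stepULinear d γ t).toContinuousLinearMap.le_opNorm (z, (ξ, ζ))).trans ?_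
  refine mul_le_mul_of_nonneg_left ?_ (norm_nonneg _)
  change max ‖z‖ (max ‖ξ‖ ‖ζ‖) ≤ _
  have h1 := norm_nonneg z
  have h2 := norm_nonneg ξ
  have h3 := norm_nonneg ζ
  exact max_le (by linarith) (max_le (by linarith) (by linarith))

lemma integrable_norm_noiseLaw (i : Fin 4) :
    Integrable (fun ξ : Fin 4 → E d => ‖ξ i‖) (noiseLaw d) := by
  have h1 : Integrable (fun x : E d => ‖x‖) (stdGaussian (E d)) :=
    (IsGaussian.integrable_id (μ := stdGaussian (E d))).norm
  have h2 : MeasurePreserving (Function.eval i) (noiseLaw d) (stdGaussian (E d)) :=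
    measurePreserving_eval (fun _ : Fin 4 => stdGaussian (E d)) i
  exact h2.integrable_comp_of_integrable h1

lemma Data.IsPotential.exists_norm_stepUBU_le {S : Data d} {U G : E d → ℝ}
    (hU : S.IsPotential U G) (h : ℝ) : ∃ A B : ℝ, ∀ ξ : Fin 4 → E d,
      ‖stepUBU U S.γ h 0 ξ‖ ≤ A + B * (‖ξ 0‖ + ‖ξ 1‖ + ‖ξ 2‖ + ‖ξ 3‖) := by
  obtain ⟨c, hc, hcle⟩ := exists_norm_stepU_le d S.γ (h / 2)
  have hL := hU.L_pos
  set l : ℝ := 1 + |h| * S.L with hl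
  have hl1 : 1 ≤ l := by
    have : 0 ≤ |h| * S.L := by positivity
    linarith
  have hB : ∀ z : Phase d, ‖stepB U h z‖ ≤ |h| * ‖gradient U 0‖ + l * ‖z‖ := by
    intro z
    have h1 := hU.lipschitz z.1 0
    rw [sub_zero] at h1
    have h2 : ‖gradient U z.1‖ ≤ ‖gradient U 0‖ + S.L * ‖z.1‖ := by
      have := norm_sub_norm_le (gradient U z.1) (gradient U 0)
      linarith
    have h3 := norm_fst_le z
    have h4 := norm_snd_le z
    have h5 : ‖z.2 - h • gradient U z.1‖ ≤ ‖z‖ + |h| * (‖gradient U 0‖ + S.L * ‖z‖) := by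
      refine (norm_sub_le _ _).trans ?_
      rw [norm_smul, Real.norm_eq_abs]
      have : S.L * ‖z.1‖ ≤ S.L * ‖z‖ := by gcongr
      have : |h| * ‖gradient U z.1‖ ≤ |h| * (‖gradient U 0‖ + S.L * ‖z‖) := by
        gcongr; linarith
      linarith
    have h6 : 0 ≤ |h| * ‖gradient U 0‖ := by positivity
    have h7 : ‖z‖ ≤ l * ‖z‖ := le_mul_of_one_le_left (norm_nonneg _) hl1
    rw [stepB, Prod.norm_def]
    refine max_le ?_ ?_
    · simp only; linarith
    · simp only; rw [hl]; linarith
  refine ⟨c * (|h| * ‖gradient U 0‖), c * (l * c) + c, fun ξ => ?_⟩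
  have h1 := hcle (ξ 0) (ξ 1) 0
  rw [norm_zero, zero_add] at h1
  have h2 := hB (stepU S.γ (h / 2) (ξ 0) (ξ 1) 0)
  have h3 := hcle (ξ 2) (ξ 3) (stepB U h (stepU S.γ (h / 2) (ξ 0) (ξ 1) 0))
  have h4 := mul_le_mul_of_nonneg_left h1 (by linarith : 0 ≤ l)
  have h5 := mul_le_mul_of_nonneg_left (h2.trans (add_le_add_right h4 _)) hc
  have h6 : 0 ≤ c * (l * c) * (‖ξ 2‖ + ‖ξ 3‖) := by positivity
  have h7 : 0 ≤ c * (‖ξ 0‖ + ‖ξ 1‖) := by positivity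
  rw [stepUBU]
  refine h3.trans ?_
  linarith

lemma Data.IsPotential.moment_ubuPush_dirac_lt_top {S : Data d} {U G : E d → ℝ}
    (hU : S.IsPotential U G) (h : ℝ) :
    ∫⁻ z, ENNReal.ofReal (euclDist z 0) ∂(ubuPush U S.γ h (Measure.dirac 0)) < ∞ := by
  have hg : Measurable fun z : Phase d => ENNReal.ofReal (euclDist z 0) :=
    continuous_euclDist_zero.measurable.ennreal_ofReal
  obtain ⟨A, B, hAB⟩ := hU.exists_norm_stepUBU_le h
  rw [lintegral_ubuPush hU.continuous_gradient hg, lintegral_dirac' _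
    (measurable_markov hU.continuous_gradient hg), markov]
  have hi : Integrable (fun ξ : Fin 4 → E d =>
      2 * (A + B * (‖ξ 0‖ + ‖ξ 1‖ + ‖ξ 2‖ + ‖ξ 3‖))) (noiseLaw d) := by
    have h1 := integrable_norm_noiseLaw (d := d)
    exact ((integrable_const A).add
      (((((h1 0).add (h1 1)).add (h1 2)).add (h1 3)).const_mul B)).const_mul 2
  refine lt_of_le_of_lt (lintegral_mono fun ξ => ENNReal.ofReal_le_ofReal ?_) hi.lintegral_lt_top
  exact (euclDist_zero_le _).trans (by linarith [hAB ξ])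

end Moment

/-! ### Existence and uniqueness of the invariant measure. -/

namespace Data

variable {d : ℕ} {S : Data d} {U G : E d → ℝ} {h : ℝ}

/-- The contraction factor of `k` steps. -/
def contr (S : Data d) (h : ℝ) (k : ℕ) : ℝ := S.C h * S.M * Real.exp (-(S.rate h * k * h))

lemma contr_eq (S : Data d) (h : ℝ) (k : ℕ) :
    S.contr h k = S.C h * S.M * Real.exp (-(S.rate h * h)) ^ k := by
  rw [contr, ← Real.exp_nat_mul]; congr 2; ring

lemma contr_nonneg (H : S.Admissible U G h) (k : ℕ) : 0 ≤ S.contr h k := by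
  have hγ := H.γ_pos
  have hm := min_pos H
  have hf := fPrime_pos H.potential hγ
  have hε := ε_pos H.potential hγ
  have hC := C_pos H
  rw [contr, M]
  positivity

lemma exp_neg_rate_lt_one (H : S.Admissible U G h) : Real.exp (-(S.rate h * h)) < 1 := by
  rw [Real.exp_lt_one_iff]
  linarith [mul_pos H.rate_pos H.h_pos]

lemma summable_contr (H : S.Admissible U G h) : Summable (S.contr h) := by
  simp_rw [funext (contr_eq S h)]
  exact (summable_geometric_of_lt_one (Real.exp_pos _).le (exp_neg_rate_lt_one H)).mul_left _

lemma tendsto_contr (H : S.Admissible U G h) :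
    Tendsto (fun k => ENNReal.ofReal (S.contr h k)) atTop (𝓝 0) := by
  rw [← ENNReal.ofReal_zero]
  exact (ENNReal.continuous_ofReal.tendsto 0).comp (summable_contr H).tendsto_atTop_zero

/-- The law of the chain started at the origin. -/
abbrev law (S : Data d) (U : E d → ℝ) (h : ℝ) (k : ℕ) : Measure (Phase d) :=
  ubuLaw U S.γ h (Measure.dirac 0) k

/-- The first moment of the chain started at the origin after one step. -/
abbrev moment (S : Data d) (U : E d → ℝ) (h : ℝ) : ℝ≥0∞ :=
  ∫⁻ z, ENNReal.ofReal (euclDist z 0) ∂(ubuPush U S.γ h (Measure.dirac 0))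

/-- The law after k + 1 steps is the law after k steps started from the one-step law, so contraction
applies to the pair δ₀ and one-step law. -/
lemma wasserstein_law_succ_le (H : S.Admissible U G h) (k : ℕ) :
    wasserstein euclDist (S.law U h k) (S.law U h (k + 1))
      ≤ ENNReal.ofReal (S.contr h k) * S.moment U h := by
  have h1 : IsProbabilityMeasure (ubuPush U S.γ h (Measure.dirac 0)) :=
    isProbabilityMeasure_ubuPush H.potential.continuous_gradient inferInstance
  rw [law, law, ← ubuLaw_ubuPush]
  refine (wasserstein_euclDist_ubuLaw_le H inferInstance h1 k).trans ?_
  refine mul_le_mul_right ((wasserstein_dirac_le _ 0).trans_eq ?_) _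
  simp_rw [euclDist_comm 0]

/-- The distance to 0 is 1-Lipschitz, so successive W₁ distances bound the increments of the first
moment. -/
lemma moment_law_le (H : S.Admissible U G h) (k : ℕ) :
    ∫⁻ z, ENNReal.ofReal (euclDist z 0) ∂(S.law U h k)
      ≤ ∑ j ∈ Finset.range k, ENNReal.ofReal (S.contr h j) * S.moment U h := by
  have hg : Measurable fun z : Phase d => ENNReal.ofReal (euclDist z 0) :=
    continuous_euclDist_zero.measurable.ennreal_ofReal
  induction k with
  | zero => simp [law, ubuLaw, euclDist]
  | succ k ih =>
    have h1 := (lintegral_le_add_wasserstein hg one_pos (fun a b => by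
      rw [one_mul, ← ENNReal.ofReal_add (euclDist_nonneg _ _) (euclDist_nonneg _ _)]
      refine ENNReal.ofReal_le_ofReal ?_
      linarith [euclDist_triangle a b 0]) (S.law U h k) (S.law U h (k + 1))).2
    rw [ENNReal.ofReal_one, one_mul] at h1
    rw [Finset.sum_range_succ]
    exact h1.trans (add_le_add ih (wasserstein_law_succ_le H k))

lemma exists_moment_bound (H : S.Admissible U G h) : ∃ m : ℝ≥0∞, m ≠ ∞ ∧
    ∀ k, ∫⁻ z, ENNReal.ofReal (euclDist z 0) ∂(S.law U h k) ≤ m := by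
  refine ⟨(∑' j, ENNReal.ofReal (S.contr h j)) * S.moment U h, ?_, fun k => ?_⟩
  · refine ENNReal.mul_ne_top ?_ (H.potential.moment_ubuPush_dirac_lt_top h).ne
    rw [← ENNReal.ofReal_tsum_of_nonneg (contr_nonneg H) (summable_contr H)]
    exact ENNReal.ofReal_ne_top
  · refine (moment_law_le H k).trans ?_
    rw [← Finset.sum_mul]
    exact mul_le_mul_left (ENNReal.sum_le_tsum _) _

/-- The law of the chain started at the origin, as a bundled probability measure. -/
def lawP (H : S.Admissible U G h) (k : ℕ) : ProbabilityMeasure (Phase d) :=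
  ⟨S.law U h k, isProbabilityMeasure_ubuLaw H.potential.continuous_gradient
    inferInstance k⟩

/-- Markov's inequality for the uniformly bounded first moments. -/
lemma isTightMeasureSet_law (H : S.Admissible U G h) :
    IsTightMeasureSet (Set.range (S.law U h)) := by
  obtain ⟨m, hm, hle⟩ := exists_moment_bound H
  refine isTightMeasureSet_of_tendsto_measure_norm_gt ?_
  have h1 : Tendsto (fun r : ℝ => m / ENNReal.ofReal r) atTop (𝓝 0) := by
    have h2 := ENNReal.Tendsto.const_div (a := m) ENNReal.tendsto_ofReal_atTop (Or.inr hm)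
    simpa using h2
  refine tendsto_of_tendsto_of_tendsto_of_le_of_le' tendsto_const_nhds h1 (.of_forall fun _ => zero_le)
    ((eventually_gt_atTop 0).mono fun r hr => ?_)
  refine iSup₂_le ?_
  rintro _ ⟨k, rfl⟩
  have h3 : Measurable fun z : Phase d => ENNReal.ofReal (euclDist z 0) :=
    continuous_euclDist_zero.measurable.ennreal_ofReal
  refine (measure_mono fun z hz => ?_).trans ((meas_ge_le_lintegral_div h3.aemeasurable
    (ENNReal.ofReal_pos.2 hr).ne' ENNReal.ofReal_ne_top).trans
      (ENNReal.div_le_div_right (hle k) _))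
  exact ENNReal.ofReal_le_ofReal ((le_of_lt hz).trans (norm_le_euclDist z))

/-- Prokhorov's theorem gives relative compactness. A limit along a nonprincipal ultrafilter
replaces the choice of a subsequence. -/
lemma exists_tendsto_law (H : S.Admissible U G h) : ∃ π : ProbabilityMeasure (Phase d),
    Tendsto (lawP H) (hyperfilter ℕ : Filter ℕ) (𝓝 π) := by
  have h1 : IsCompact (closure (Set.range (lawP H))) := by
    refine isCompact_closure_of_isTightMeasureSet ((isTightMeasureSet_law H).subset ?_)
    rintro _ ⟨_, ⟨k, rfl⟩, rfl⟩
    exact ⟨k, rfl⟩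
  obtain ⟨π, -, hπ⟩ := h1.ultrafilter_le_nhds' ((hyperfilter ℕ).map (lawP H))
    (Ultrafilter.mem_map.2 (Filter.univ_mem' fun k => subset_closure ⟨k, rfl⟩))
  exact ⟨π, hπ⟩

lemma hyperfilter_le : (hyperfilter ℕ : Filter ℕ) ≤ atTop := by
  rw [← Nat.cofinite_eq_atTop]
  exact hyperfilter_le_cofinite

/-- By the Feller property the laws shifted by one step converge to the image of π under one step.
The W₁ distance between consecutive laws tends to 0, so both limits agree on bounded Lipschitz
functions. -/
lemma ubuPush_eq_of_tendsto (H : S.Admissible U G h) {π : ProbabilityMeasure (Phase d)}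
    (hπ : Tendsto (lawP H) (hyperfilter ℕ : Filter ℕ) (𝓝 π)) : ubuPush U S.γ h π = π := by
  have hU := H.potential.continuous_gradient
  have hp : IsProbabilityMeasure (ubuPush U S.γ h π) := isProbabilityMeasure_ubuPush hU inferInstance
  rw [ProbabilityMeasure.tendsto_iff_forall_lintegral_tendsto] at hπ
  refine eq_of_forall_lipschitz fun g K hg => ?_
  have hgm : Measurable fun a => (g a : ℝ≥0∞) := g.continuous.measurable.coe_nnreal_ennreal
  have h1 := hπ g
  have h2 := hπ (markovBCF hU S.γ h g)
  simp_rw [markovBCF_apply] at h2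
  rw [← lintegral_ubuPush hU hgm] at h2
  have h3 : Tendsto (fun k => ENNReal.ofReal (K + 1 : ℝ)
      * (ENNReal.ofReal (S.contr h k) * S.moment U h)) (hyperfilter ℕ : Filter ℕ) (𝓝 0) := by
    have h4 := ENNReal.Tendsto.mul_const (b := S.moment U h) (tendsto_contr H)
      (Or.inr (H.potential.moment_ubuPush_dirac_lt_top h).ne)
    rw [zero_mul] at h4
    have h5 := ENNReal.Tendsto.const_mul (a := ENNReal.ofReal (K + 1 : ℝ)) h4
      (Or.inr ENNReal.ofReal_ne_top)
    rw [mul_zero] at h5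
    exact h5.mono_left hyperfilter_le
  have hK : (0 : ℝ) < K + 1 := by positivity
  have h4 : ∀ k, ∫⁻ a, markov U S.γ h (fun a => (g a : ℝ≥0∞)) a ∂(lawP H k : Measure (Phase d))
      = ∫⁻ a, g a ∂(S.law U h (k + 1)) := by
    intro k
    have : IsProbabilityMeasure (S.law U h k) := (lawP H k).2
    exact (lintegral_ubuPush hU hgm _).symm
  have h5 := fun k => lintegral_le_add_wasserstein hgm hK (le_add_of_lipschitz hg) (S.law U h k)
    (S.law U h (k + 1))
  have h6 := fun k => mul_le_mul_right (wasserstein_law_succ_le H k) (ENNReal.ofReal (K + 1 : ℝ))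
  refine le_antisymm ?_ ?_
  · have h7 := h1.add h3
    rw [add_zero] at h7
    refine le_of_tendsto_of_tendsto' h2 h7 fun k => ?_
    rw [h4]
    exact (h5 k).2.trans (add_le_add_right (h6 k) _)
  · have h7 := h2.add h3
    rw [add_zero] at h7
    refine le_of_tendsto_of_tendsto' h1 h7 fun k => ?_
    rw [h4]
    exact (h5 k).1.trans (add_le_add_right (h6 k) _)

/-- The distance is unbounded, so weak convergence is applied to its truncations, followed by
monotone convergence. -/
lemma moment_lt_top_of_tendsto (H : S.Admissible U G h) {π : ProbabilityMeasure (Phase d)}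
    (hπ : Tendsto (lawP H) (hyperfilter ℕ : Filter ℕ) (𝓝 π)) :
    ∫⁻ z, ENNReal.ofReal (euclDist z 0) ∂(π : Measure (Phase d)) < ∞ := by
  obtain ⟨m, hm, hle⟩ := exists_moment_bound H
  rw [ProbabilityMeasure.tendsto_iff_forall_lintegral_tendsto] at hπ
  have hc : ∀ n : ℕ, Continuous fun z : Phase d => min (euclDist z 0).toNNReal n := fun n =>
    (continuous_real_toNNReal.comp continuous_euclDist_zero).min continuous_const
  have h1 : ∀ n : ℕ, ∫⁻ z, ((min (euclDist z 0).toNNReal n : ℝ≥0) : ℝ≥0∞)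
      ∂(π : Measure (Phase d)) ≤ m := by
    intro n
    refine le_of_tendsto' (hπ (boundedOfLe _ (hc n) (n : ℝ≥0) fun _ => min_le_right _ _))
      fun k => ?_
    refine (lintegral_mono fun z => ?_).trans (hle k)
    exact ENNReal.coe_le_coe.2 (min_le_left _ _)
  refine lt_of_le_of_lt ?_ (lt_top_iff_ne_top.2 hm)
  calc ∫⁻ z, ENNReal.ofReal (euclDist z 0) ∂(π : Measure (Phase d))
      ≤ ∫⁻ z, ⨆ n : ℕ, ((min (euclDist z 0).toNNReal n : ℝ≥0) : ℝ≥0∞) ∂(π : Measure (Phase d)) := by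
        refine lintegral_mono fun z => ?_
        obtain ⟨n, hn⟩ := exists_nat_ge (euclDist z 0).toNNReal
        refine le_trans ?_ (le_iSup _ n)
        rw [min_eq_left hn]
        exact le_rfl
    _ = ⨆ n : ℕ, ∫⁻ z, ((min (euclDist z 0).toNNReal n : ℝ≥0) : ℝ≥0∞) ∂(π : Measure (Phase d)) :=
        lintegral_iSup (fun n => (hc n).measurable.coe_nnreal_ennreal) fun i j hij z =>
          ENNReal.coe_le_coe.2 (min_le_min_left _ (Nat.cast_le.2 hij))
    _ ≤ m := iSup_le h1

/-- The cap by the supremum of g makes the error bounded, so that it can be integrated against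
measures without a first moment. -/
lemma iterate_markov_le (H : S.Admissible U G h) {g : Phase d →ᵇ ℝ≥0} {K : ℝ≥0}
    (hg : LipschitzWith K g) (k : ℕ) (a b : Phase d) :
    (markov U S.γ h)^[k] (fun a => (g a : ℝ≥0∞)) a
      ≤ (markov U S.γ h)^[k] (fun a => (g a : ℝ≥0∞)) b
        + min (nndist g 0 : ℝ≥0∞) (ENNReal.ofReal (K + 1 : ℝ)
          * (ENNReal.ofReal (S.contr h k) * ENNReal.ofReal (euclDist a b))) := by
  have hU := H.potential.continuous_gradient
  have hgm : Measurable fun a => (g a : ℝ≥0∞) := g.continuous.measurable.coe_nnreal_ennreal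
  have hK : (0 : ℝ) < K + 1 := by positivity
  rw [iterate_markov_eq hU k hgm, iterate_markov_eq hU k hgm, ← min_add_add_left]
  refine le_min ?_ ?_
  · have := isProbabilityMeasure_ubuLaw (γ := S.γ) (h := h) hU
      (μ := Measure.dirac a) inferInstance k
    refine le_trans ?_ le_add_self
    calc _ ≤ ∫⁻ _, (nndist g 0 : ℝ≥0∞) ∂(ubuLaw U S.γ h (Measure.dirac a) k) :=
          lintegral_mono fun z =>
            ENNReal.coe_le_coe.2 (BoundedContinuousFunction.NNReal.upper_bound g _)
      _ = _ := by simp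
  · refine ((lintegral_le_add_wasserstein hgm hK (le_add_of_lipschitz hg) _
      (ubuLaw U S.γ h (Measure.dirac b) k)).1).trans ?_
    refine add_le_add_right (mul_le_mul_right ?_ _) _
    refine (wasserstein_euclDist_ubuLaw_le H inferInstance inferInstance k).trans ?_
    refine mul_le_mul_right ((wasserstein_dirac_le _ a).trans_eq ?_) _
    rw [lintegral_dirac' _ (by
      have := continuous_euclDist.comp ((continuous_const (y := a)).prodMk continuous_id)
      exact this.measurable.ennreal_ofReal)]

/-- W₁ between two invariant measures might be infinite, so contraction cannot be applied to them
directly. Instead the Markov iterates are compared pointwise under the product measure, where the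
capped error vanishes by dominated convergence. -/
lemma lintegral_le_of_invariant (H : S.Admissible U G h) {π π' : Measure (Phase d)}
    (hp : IsProbabilityMeasure π) (hp' : IsProbabilityMeasure π')
    (hπ : ubuPush U S.γ h π = π) (hπ' : ubuPush U S.γ h π' = π') {g : Phase d →ᵇ ℝ≥0} {K : ℝ≥0}
    (hg : LipschitzWith K g) : ∫⁻ a, g a ∂π ≤ ∫⁻ a, g a ∂π' := by
  have hU := H.potential.continuous_gradient
  have hgm : Measurable fun a => (g a : ℝ≥0∞) := g.continuous.measurable.coe_nnreal_ennreal
  set c : ℕ → Phase d × Phase d → ℝ≥0∞ := fun k p => min (nndist g 0 : ℝ≥0∞)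
    (ENNReal.ofReal (K + 1 : ℝ)
      * (ENNReal.ofReal (S.contr h k) * ENNReal.ofReal (euclDist p.1 p.2))) with hcdef
  have hcm : ∀ k, Measurable (c k) := fun k =>
    measurable_const.min ((continuous_euclDist.measurable.ennreal_ofReal.const_mul _).const_mul _)
  have h1 : Tendsto (fun k => ∫⁻ p, c k p ∂(π.prod π')) atTop (𝓝 0) := by
    have h2 : Tendsto (fun k => ∫⁻ p, c k p ∂(π.prod π')) atTop
        (𝓝 (∫⁻ _, 0 ∂(π.prod π'))) := by
      refine tendsto_lintegral_of_dominated_convergence (fun _ => (nndist g 0 : ℝ≥0∞)) hcm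
        (fun k => .of_forall fun p => min_le_left _ _) (by simp) (.of_forall fun p => ?_)
      have h3 := ENNReal.Tendsto.mul_const (b := ENNReal.ofReal (euclDist p.1 p.2))
        (tendsto_contr H) (Or.inr ENNReal.ofReal_ne_top)
      have h4 := ENNReal.Tendsto.const_mul (a := ENNReal.ofReal (K + 1 : ℝ)) h3
        (Or.inr ENNReal.ofReal_ne_top)
      rw [zero_mul, mul_zero] at h4
      exact tendsto_of_tendsto_of_tendsto_of_le_of_le tendsto_const_nhds h4 (fun _ => zero_le)
        fun k => min_le_right _ _
    simpa using h2
  have h5 : ∀ k, ∫⁻ a, g a ∂π ≤ ∫⁻ a, g a ∂π' + ∫⁻ p, c k p ∂(π.prod π') := by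
    intro k
    obtain ⟨hm, e1⟩ := lintegral_ubuLaw (γ := S.γ) (h := h) hU hp k hgm
    obtain ⟨-, e2⟩ := lintegral_ubuLaw (γ := S.γ) (h := h) hU hp' k hgm
    rw [ubuLaw_of_invariant hπ] at e1
    rw [ubuLaw_of_invariant hπ'] at e2
    set P := (markov U S.γ h)^[k] fun a => (g a : ℝ≥0∞)
    have hm₁ : Measurable fun p : Phase d × Phase d => P p.1 := hm.comp measurable_fst
    have hm₂ : Measurable fun p : Phase d × Phase d => P p.2 := hm.comp measurable_snd
    have e3 : ∫⁻ p, P p.1 ∂(π.prod π') = ∫⁻ a, P a ∂π := by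
      rw [lintegral_prod _ hm₁.aemeasurable]; simp
    have e4 : ∫⁻ p, P p.2 ∂(π.prod π') = ∫⁻ a, P a ∂π' := by
      rw [lintegral_prod _ hm₂.aemeasurable]; simp
    rw [e1, e2, ← e3, ← e4, ← lintegral_add_right _ (hcm k)]
    exact lintegral_mono fun p => iterate_markov_le H hg k p.1 p.2
  have h6 := h1.const_add (∫⁻ a, g a ∂π')
  rw [add_zero] at h6
  exact ge_of_tendsto' h6 h5

lemma eq_of_invariant (H : S.Admissible U G h) {π π' : Measure (Phase d)}
    (hp : IsProbabilityMeasure π) (hp' : IsProbabilityMeasure π')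
    (hπ : ubuPush U S.γ h π = π) (hπ' : ubuPush U S.γ h π' = π') : π = π' :=
  eq_of_forall_lipschitz fun _ _ hg => le_antisymm
    (lintegral_le_of_invariant H hp hp' hπ hπ' hg) (lintegral_le_of_invariant H hp' hp hπ' hπ hg)

end Data

end KineticLangevin
end

theorem mainTheorem9 {d : ℕ} (S : KineticLangevin.Data d) (U G : KineticLangevin.E d → ℝ) (h : ℝ)
    (hU : S.IsPotential U G) (hγ : 0 < S.γ) (hh : 0 < h)
    (hfriction : S.LargeFriction) (hstep : S.SmallStep h) :
    0 < S.rate h ∧ 0 < S.C h ∧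
    (∀ μ₀ ν₀ : MeasureTheory.Measure (KineticLangevin.Phase d),
      MeasureTheory.IsProbabilityMeasure μ₀ → MeasureTheory.IsProbabilityMeasure ν₀ → ∀ k : ℕ,
        KineticLangevin.wasserstein S.ρ
            (KineticLangevin.ubuLaw U S.γ h μ₀ k) (KineticLangevin.ubuLaw U S.γ h ν₀ k)
          ≤ ENNReal.ofReal (S.C h * Real.exp (-(S.rate h * k * h)))
            * KineticLangevin.wasserstein S.ρ μ₀ ν₀ ∧
        KineticLangevin.wasserstein KineticLangevin.euclDist
            (KineticLangevin.ubuLaw U S.γ h μ₀ k) (KineticLangevin.ubuLaw U S.γ h ν₀ k)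
          ≤ ENNReal.ofReal (S.C h * S.M * Real.exp (-(S.rate h * k * h)))
            * KineticLangevin.wasserstein KineticLangevin.euclDist μ₀ ν₀) ∧
    ∃ π : MeasureTheory.Measure (KineticLangevin.Phase d),
      MeasureTheory.IsProbabilityMeasure π ∧
      KineticLangevin.ubuPush U S.γ h π = π ∧
      (∀ π' : MeasureTheory.Measure (KineticLangevin.Phase d),
        MeasureTheory.IsProbabilityMeasure π' → KineticLangevin.ubuPush U S.γ h π' = π' → π' = π) ∧
      (∫⁻ z, ENNReal.ofReal (KineticLangevin.euclDist z 0) ∂π) < ⊤ ∧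
      ∀ μ₀ : MeasureTheory.Measure (KineticLangevin.Phase d),
        MeasureTheory.IsProbabilityMeasure μ₀ → ∀ k : ℕ,
          KineticLangevin.wasserstein S.ρ (KineticLangevin.ubuLaw U S.γ h μ₀ k) π
            ≤ ENNReal.ofReal (S.C h * Real.exp (-(S.rate h * k * h)))
              * KineticLangevin.wasserstein S.ρ μ₀ π ∧
          KineticLangevin.wasserstein KineticLangevin.euclDist
              (KineticLangevin.ubuLaw U S.γ h μ₀ k) π
            ≤ ENNReal.ofReal (S.C h * S.M * Real.exp (-(S.rate h * k * h)))
              * KineticLangevin.wasserstein KineticLangevin.euclDist μ₀ π := by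
  have H : S.Admissible U G h := ⟨hU, hγ, hh, hfriction, hstep⟩
  refine ⟨H.rate_pos, KineticLangevin.Data.C_pos H, fun μ₀ ν₀ hμ hν k =>
    ⟨KineticLangevin.Data.wasserstein_ρ_ubuLaw_le H hμ hν k, KineticLangevin.Data.wasserstein_euclDist_ubuLaw_le H hμ hν k⟩, ?_⟩
  obtain ⟨π, hlim⟩ := KineticLangevin.Data.exists_tendsto_law H
  have hinv := KineticLangevin.Data.ubuPush_eq_of_tendsto H hlim
  refine ⟨π, inferInstance, hinv, fun π' hp' hπ' => KineticLangevin.Data.eq_of_invariant H hp' inferInstance hπ' hinv,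
    KineticLangevin.Data.moment_lt_top_of_tendsto H hlim, fun μ₀ hμ k => ?_⟩
  have h1 := KineticLangevin.Data.wasserstein_ρ_ubuLaw_le H hμ (inferInstance : IsProbabilityMeasure π.toMeasure) k
  have h2 := KineticLangevin.Data.wasserstein_euclDist_ubuLaw_le H hμ
    (inferInstance : IsProbabilityMeasure π.toMeasure) k
  rw [KineticLangevin.ubuLaw_of_invariant hinv] at h1 h2
  exact ⟨h1, h2⟩
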